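/- Let $G$ be the augmented square antiprism graph: its vertices are $v_0$ and $a_i, b_i$ ($i\in\mathbb Z/4$); the edges of the square antiprism are $a_ia_{i+1}$ (the quadrilateral $\mathcal Q_1$), $b_ib_{i+1}$ (the quadrilateral $\mathcal Q_2$), $b_ia_i$ and $b_ia_{i+1}$, and in addition the central vertex $v_0$ is adjacent to all other eight vertices. A straight-line drawing of $G$ places the vertices at distinct points of the plane and draws each edge as the straight segment between its end points, such that no edge passes through a vertex other than its end points. Two distinct edges cross if they have a common interior point. A straight-line drawing is a RAC drawing if any two crossing edges are perpendicular. The combinatorial embedding of a straight-line drawing of the vertex-labelled graph $G$ consists of the set of pairs of crossing edges, the order of the crossings along each edge, the cyclic order of the edges around each vertex and around each crossing, and the external face; a drawing and its mirror image are considered to have the same combinatorial embedding. Theorem. The straight-line RAC drawings of $G$ have exactly two combinatorial embeddings. More precisely: 1. In every straight-line RAC drawing of $G$, no two edges of $\mathcal Q_1$ cross, no two edges of $\mathcal Q_2$ cross, no edge of $\mathcal Q_1$ crosses an edge of $\mathcal Q_2$, the vertex $v_0$ lies in the interior of both $\mathcal Q_1$ and $\mathcal Q_2$, and one of the two quadrilaterals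 (the inner one) lies in the interior of the other one (the outer one). Each of the four edges from $v_0$ to the vertices of the outer quadrilateral crosses exactly one edge of the inner quadrilateral, at a right angle, and each edge of the inner quadrilateral is crossed by exactly one of these four edges. 2. The set of combinatorial embeddings of straight-line RAC drawings of $G$ has exactly two elements, and two straight-line RAC drawings of $G$ have the same combinatorial embedding if and only if the same quadrilateral is the inner one in both. -/

import Mathlib

open Set Filter Topology

noncomputable section

/-- The Euclidean plane. -/
abbrev Plane : Type := EuclideanSpace ℝ (Fin 2)

namespace Plane

/-- The signed area `x₀ y₁ - x₁ y₀`; it is positive exactly when `y` points to the left of `x`. -/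
def det (x y : Plane) : ℝ := x 0 * y 1 - x 1 * y 0

/-- Counterclockwise rotation by a right angle. -/
def rot90 (x : Plane) : Plane := !₂[-x 1, x 0]

/-- Reflection in the first coordinate axis. -/
def mirror (x : Plane) : Plane := !₂[x 0, -x 1]

/-- Three directions `x, y, z` (spanning distinct rays) are met in this cyclic order when turning
counterclockwise. The three counterclockwise turning angles from `x` to `y`, from `y` to `z` and
from `z` to `x` are positive and add up to `2π` (order `x, y, z`) or `4π`
(order `x, z, y`); in the first case at least two of them are smaller than `π`, in the second case
at most one of them is. -/
def CyclicCCW (x y z : Plane) : Prop :=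
  (0 < det x y ∧ 0 < det y z) ∨ (0 < det y z ∧ 0 < det z x) ∨ (0 < det z x ∧ 0 < det x y)

end Plane

/-! ### Straight-line drawings and RAC drawings -/

section Drawing

variable {V : Type*}

/-- In the straight-line drawing given by the vertex positions `p`, the distinct edges `uv` and
`xy` cross, that is, they have an interior point in common. -/
def EdgesCross (p : V → Plane) (u v x y : V) : Prop :=
  s(u, v) ≠ s(x, y) ∧ (openSegment ℝ (p u) (p v) ∩ openSegment ℝ (p x) (p y)).Nonempty

/-- Vertex positions `p` define a straight-line drawing of `G`: distinct vertices are distinct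
points, and no edge passes through a vertex that is not one of its end points. -/
structure IsStraightLineDrawing (G : SimpleGraph V) (p : V → Plane) : Prop where
  injective : Function.Injective p
  notMem_segment : ∀ u v w : V, G.Adj u v → w ≠ u → w ≠ v → p w ∉ segment ℝ (p u) (p v)

/-- A straight-line RAC (right angle crossing) drawing: any two crossing edges are
perpendicular. -/
structure IsRACDrawing (G : SimpleGraph V) (p : V → Plane) : Prop
    extends IsStraightLineDrawing G p where
  right_angle : ∀ u v x y : V, G.Adj u v → G.Adj x y → EdgesCross p u v x y →
    inner ℝ (p v - p u) (p y - p x) = 0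

/-! ### Combinatorial embeddings -/

/-- The set of points of the plane that is covered by the drawing. -/
def drawnSet (G : SimpleGraph V) (p : V → Plane) : Set Plane :=
  range p ∪ ⋃ d : G.Dart, segment ℝ (p d.fst) (p d.snd)

/-- The external face of the drawing: the union of the unbounded connected components of the
complement of the drawing (there is exactly one of them if the graph is finite). -/
def outerFace (G : SimpleGraph V) (p : V → Plane) : Set Plane :=
  {z | z ∉ drawnSet G p ∧ ¬ Bornology.IsBounded (connectedComponentIn (drawnSet G p)ᶜ z)}

/-- The combinatorial data of a drawing in the oriented plane, in terms of the darts (directed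
edges) of the graph. Together the fields describe the planarization of the drawing (the crossings
and their order along each edge), its rotation system and its external face. -/
@[ext]
structure OrientedEmbedding (G : SimpleGraph V) where
  /-- the edges of `d` and `e` cross, and `e` passes from the right of `d` to the left of `d` -/
  crossing : G.Dart → G.Dart → Prop
  /-- along `d`, the crossing with `e` comes strictly before the crossing with `f` -/
  before : G.Dart → G.Dart → G.Dart → Prop
  /-- `d`, `e`, `f` leave the same vertex, in this counterclockwise cyclic order -/
  rotation : G.Dart → G.Dart → G.Dart → Prop
  /-- at the tail of `d`, the face immediately to the left of `d` is the external face -/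
  outer : G.Dart → Prop

/-- The combinatorial data of the straight-line drawing `p` of `G`. -/
def orientedEmbedding (G : SimpleGraph V) (p : V → Plane) : OrientedEmbedding G where
  crossing d e := EdgesCross p d.fst d.snd e.fst e.snd ∧
    0 < Plane.det (p d.snd - p d.fst) (p e.snd - p e.fst)
  before d e f := EdgesCross p d.fst d.snd e.fst e.snd ∧ EdgesCross p d.fst d.snd f.fst f.snd ∧
    ∃ s t : ℝ, 0 < s ∧ s < t ∧ t < 1 ∧
      AffineMap.lineMap (p d.fst) (p d.snd) s ∈ openSegment ℝ (p e.fst) (p e.snd) ∧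
      AffineMap.lineMap (p d.fst) (p d.snd) t ∈ openSegment ℝ (p f.fst) (p f.snd)
  rotation d e f := d.fst = e.fst ∧ e.fst = f.fst ∧
    Plane.CyclicCCW (p d.snd - p d.fst) (p e.snd - p e.fst) (p f.snd - p f.fst)
  outer d := ∀ᶠ δ in 𝓝[>] (0 : ℝ), ∀ᶠ r in 𝓝[>] (0 : ℝ),
    p d.fst + r • ((p d.snd - p d.fst) + δ • Plane.rot90 (p d.snd - p d.fst)) ∈ outerFace G p

/-- The combinatorial embedding of a straight-line drawing. Vertices are labelled, and a drawing
and its mirror image have the same combinatorial embedding: the combinatorial data of the two are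
taken as an unordered pair. -/
def combinatorialEmbedding (G : SimpleGraph V) (p : V → Plane) : Sym2 (OrientedEmbedding G) :=
  s(orientedEmbedding G p, orientedEmbedding G (Plane.mirror ∘ p))

end Drawing

/-- The bounded part of the complement of a curve; for a simple closed polygon this is its
interior. -/
def curveInterior (C : Set Plane) : Set Plane :=
  {z | z ∉ C ∧ Bornology.IsBounded (connectedComponentIn Cᶜ z)}

/-! ### The augmented square antiprism graph -/

/-- The skeleton of the square antiprism. The vertices `(false, i)` form one quadrilateral and the
vertices `(true, i)` the other one, `i` modulo 4; `(true, i)` is adjacent to `(false, i)` and to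
`(false, i + 1)`. -/
def squareAntiprism : SimpleGraph (Bool × ZMod 4) :=
  SimpleGraph.fromRel fun x y =>
    (x.1 = y.1 ∧ y.2 = x.2 + 1) ∨
    (x.1 = true ∧ y.1 = false ∧ (y.2 = x.2 ∨ y.2 = x.2 + 1))

/-- The vertices of the augmented square antiprism graph. -/
abbrev ASAVertex : Type := Option (Bool × ZMod 4)

namespace ASAVertex

/-- The central vertex. -/
abbrev center : ASAVertex := none

/-- The `i`-th vertex of the quadrilateral with index `k`. -/
abbrev quad (k : Bool) (i : ZMod 4) : ASAVertex := some (k, i)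

end ASAVertex

/-- The augmented square antiprism graph: the square antiprism together with a central vertex
that is adjacent to all other vertices. -/
def augmentedSquareAntiprism : SimpleGraph ASAVertex :=
  SimpleGraph.fromRel fun u v =>
    u = ASAVertex.center ∨ ∃ x y, u = some x ∧ v = some y ∧ squareAntiprism.Adj x y

/-- The closed polygon as which the quadrilateral `k` is drawn. -/
def quadCurve (p : ASAVertex → Plane) (k : Bool) : Set Plane :=
  ⋃ i : ZMod 4, segment ℝ (p (.quad k i)) (p (.quad k (i + 1)))

/-- The `i`-th edge of the quadrilateral `k` and the `j`-th edge of the quadrilateral `l` cross. -/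
def QuadEdgesCross (p : ASAVertex → Plane) (k : Bool) (i : ZMod 4) (l : Bool) (j : ZMod 4) : Prop :=
  EdgesCross p (.quad k i) (.quad k (i + 1)) (.quad l j) (.quad l (j + 1))

/-- The edge from the central vertex to the `i`-th vertex of the quadrilateral `k` crosses the
`j`-th edge of the quadrilateral `l` at a right angle. -/
def SpokeCrossesPerp (p : ASAVertex → Plane) (k : Bool) (i : ZMod 4) (l : Bool) (j : ZMod 4) :
    Prop :=
  EdgesCross p .center (.quad k i) (.quad l j) (.quad l (j + 1)) ∧
    inner ℝ (p (.quad k i) - p .center) (p (.quad l (j + 1)) - p (.quad l j)) = 0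

/-- The quadrilateral `k` is nested inside the other quadrilateral. -/
def IsInnerQuad (p : ASAVertex → Plane) (k : Bool) : Prop :=
  quadCurve p k ⊆ curveInterior (quadCurve p (!k))

end

/-!
# RAC drawings of the augmented square antiprism graph

Call the edges at the center spokes, and number the other vertices along the closed zigzag `a 0`,
`b 0`, `a 1`, `b 1`, …, so that the edges which are not spokes join vertices at distance 1 or 2
modulo 8. As the center is adjacent to all vertices, the drawing is best seen from there: every
edge `e` that is not a spoke spans a triangle with the center, and a vertex `z` in the angle of this
triangle at the center is either inside the triangle (`Plane.Near`) or the spoke of `z` crosses `e`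
(`Plane.Far`).

**The combinatorial part.** Right angles enter through two rules: an edge does not cross two
adjacent edges (`IsRACDrawing.not_edgesCross_fan`), and no three edges cross pairwise
(`IsRACDrawing.not_edgesCross_triangle`). In addition, near and far positions force some
of the edges to cross (`Plane.cross_of_near_near` and its companions). These rules are collected in
`RACSearch.Model.Lawful`. They mention only the orientations of pairs of spokes, the near pairs and
the crossing pairs, so that their consequences can be found by a finite search: insert the spokes
one after the other into their cyclic order, decide each vertex in the angle of an edge to be near
or far, add the forced crossings, and close a branch when a rule is violated. The search is written
so that the kernel can evaluate it, and it is sound by `RACSearch.Model.Op.run_sound`. Up to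
symmetry it excludes one fact after the other. A few configurations satisfy all the rules and are
refuted by their right angles (`ASAVertex.not_spurious`). There remains only that the spokes are in
the order of the zigzag and that the spokes of one quadrilateral cross the edges of the other one,
the inner one (`ASAVertex.exists_nested`).

**Standard position.** By the reflection and by the automorphism `ASAVertex.shift`, which exchanges
the quadrilaterals, one may assume that the order is counterclockwise and that the spoke of `b i`
crosses the edge from `a i` to `a (i + 1)` (`ASAVertex.IsStandard`, `ASAVertex.exists_isStandard`).
Then the vertex `a (i + 1)` is near the edge from `b i` to `b (i + 1)`
(`ASAVertex.IsStandard.near`). So all relevant signed areas have known signs. Both quadrilaterals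
are star-shaped with respect to the center, and their interiors are described by these signs
(`Star.curveInterior_curve`), as is the external face (`ASAVertex.IsStandard.outerFace_eq`). Hence
the inner quadrilateral is inside the outer one, and the only crossings are those of its edges with
the four spokes (`ASAVertex.IsStandard.edgesCross_iff`).

**The embeddings.** Crossings, rotations and the external face depend on the same signs, so that all
standard drawings have the same combinatorial data
(`ASAVertex.IsStandard.orientedEmbedding_eq`). A mirror image becomes standard by reversing the
zigzag, which preserves the quadrilaterals, so that the embedding is determined by the inner
quadrilateral. It also determines the inner quadrilateral, since that is the one whose edges are
crossed (`ASAVertex.combinatorialEmbedding_eq_iff`). Finally there is a RAC drawing with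
either quadrilateral as the inner one (`ASAVertex.exists_isRACDrawing`).
-/

/-! ### The search for the crossings of a RAC drawing -/

namespace RACSearch

/-- If-then-else on Booleans by the recursor, which the kernel evaluates lazily. -/
noncomputable def sel {α : Type} (c : Bool) (t e : α) : α :=
  Bool.rec (motive := fun _ => α) e t c

/-- The first end point of an edge. The vertices of the antiprism are numbered from 0 to 7 along
the closed zigzag `a 0`, `b 0`, `a 1`, `b 1`, …, and 8 is the center. Edge `j < 8` joins `j` and
`j + 1`, edge `8 + j` joins `j` and `j + 2` (both modulo 8), and edge `16 + j` is the spoke of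
`j`. -/
def edgeFst (e : ℕ) : ℕ := bif Nat.ble 16 e then e - 16 else bif Nat.ble 8 e then e - 8 else e

/-- The second end point of an edge, in the numbering that is explained at `edgeFst`. -/
def edgeSnd (e : ℕ) : ℕ :=
  bif Nat.ble 16 e then 8 else bif Nat.ble 8 e then (e - 6) % 8 else (e + 1) % 8

/-- A state of the search is a set of facts about the drawing, coded as the bits of a natural
number. This bit says that `b` is counterclockwise of `a`, as seen from the center. -/
def signBit (a b : ℕ) : ℕ := Nat.pow 2 (Nat.add (Nat.mul 8 a) b)

/-- The bit of the fact that the vertex `z` lies in the triangle that the center spans with the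
edge `e`. -/
def nearBit (e z : ℕ) : ℕ := Nat.pow 2 (Nat.add (Nat.add 64 (Nat.mul 8 e)) z)

/-- The bit of the fact that the edges `e` and `f` cross. -/
def crossBit (e f : ℕ) : ℕ := Nat.pow 2 (Nat.add (Nat.add 192 (Nat.mul 24 e)) f)

/-- All facts in `m` belong to the state `s`. -/
def has (s m : ℕ) : Bool := Nat.beq (Nat.land s m) m

/-- The facts which say that `z` lies in the convex angle from `a` counterclockwise to `b`. -/
def arcMask (a z b : ℕ) : ℕ := Nat.lor (Nat.lor (signBit a b) (signBit a z)) (signBit z b)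

/-- It is known that the vertex `z` lies in the angle that the edge `e` spans at the center. -/
noncomputable def inArc (s e z : ℕ) : Bool :=
  sel (has s (arcMask (edgeFst e) z (edgeSnd e))) true (has s (arcMask (edgeSnd e) z (edgeFst e)))

/-- The vertex `v` is an end point of the edge `e`. -/
def touches (e v : ℕ) : Bool := Nat.beq (edgeFst e) v || Nat.beq (edgeSnd e) v

/-- Distinct edges with a common end point. -/
def adjacentEdges (e f : ℕ) : Bool :=
  !(Nat.beq e f) && (touches e (edgeFst f) || touches e (edgeSnd f))

/-- The number whose bits below `n` are given by `p`. -/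
noncomputable def sumMask (p : ℕ → Bool) (n : ℕ) : ℕ :=
  Nat.rec 0 (fun i ih => sel (p i) (Nat.lor ih (Nat.pow 2 i)) ih) n

/-- The set of edges adjacent to `e`. -/
noncomputable def adjMask (e : ℕ) : ℕ := sumMask (adjacentEdges e) 24

/-- The set of edges that are known to cross `e`. -/
def crossRow (s e : ℕ) : ℕ := Nat.land (Nat.shiftRight s (Nat.add 192 (Nat.mul 24 e))) 16777215

/-- Add the crossing of `e` and `f` to the state, and close the branch if this contradicts the
two rules for RAC drawings: an edge does not cross two adjacent edges, and no three edges cross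
pairwise. All steps are in continuation passing style: `k` is the remaining search, and the value
is `true` if every branch is closed or reaches a goal. -/
noncomputable def addCross (e f : ℕ) (k : ℕ → Bool) (s : ℕ) : Bool :=
  sel (Nat.beq (Nat.land (crossRow s e) (adjMask f)) 0)
   (sel (Nat.beq (Nat.land (crossRow s f) (adjMask e)) 0)
    (sel (Nat.beq (Nat.land (crossRow s e) (crossRow s f)) 0)
      (k (Nat.lor s (Nat.lor (crossBit e f) (crossBit f e)))) true) true) true

/-- The facts `fwd t` for all `t` counterclockwise of `u`, and `bwd t` for all `t` clockwise of
`u`. -/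
noncomputable def rowBits (s u : ℕ) (fwd bwd : ℕ → ℕ) (prev : List ℕ) : ℕ :=
  List.rec 0 (fun t _ ih => sel (has s (signBit u t)) (Nat.lor ih (fwd t))
    (sel (has s (signBit t u)) (Nat.lor ih (bwd t)) ih)) prev

/-- Insert the vertex `w` into the cyclic order of the lines through the center: branch over the
vertex `u` whose line is the first one that the ray of `w` meets when it turns clockwise, and over
the two rays of this line. All other known vertices are on the same side of `w` as of the ray that
is met. -/
noncomputable def rowStep (all : List ℕ) (w : ℕ) (k : ℕ → Bool) (s : ℕ) (prev : List ℕ) : Bool :=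
  List.rec true (fun u _ ih =>
    sel (k (Nat.lor (Nat.lor s (signBit u w)) (rowBits s u (signBit w) (fun t => signBit t w) all)))
    (sel (k (Nat.lor (Nat.lor s (signBit w u))
      (rowBits s u (fun t => signBit t w) (signBit w) all))) ih false) false) prev

/-- The steps of the search: insert a vertex into the cyclic order; use the orientation of an
edge; use that a vertex lies in the angle of an edge; decide whether a vertex in the angle of an
edge is on its near or on its far side; conclude that two edges cross; look for a goal. -/
inductive Op
  | row (w : ℕ) (prev : List ℕ)
  | orient (a b : ℕ)
  | arc (e z : ℕ)
  | split (e z : ℕ)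
  | cross (e f : ℕ)
  | close

/-- Add the facts `m`, unless the state has a fact of `m'`, which contradicts them. -/
noncomputable def orientStep (m' : ℕ) (m : ℕ) (k : ℕ → Bool) (s : ℕ) : Bool :=
  sel (Nat.beq (Nat.land s m') 0) (k (Nat.lor s m)) true

/-- If `z` is in the angle of `e`, then either the spoke of `z` crosses `e`, or `z` is near.
Facts in `dead` are known to be impossible. -/
noncomputable def splitStep (dead : ℕ) (e z : ℕ) (k : ℕ → Bool) (s : ℕ) : Bool :=
  sel (inArc s e z)
    (sel (has s (crossBit e (16 + z))) (k s)
      (sel (sel (has dead (crossBit e (16 + z))) true (addCross e (16 + z) k s))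
        (sel (has dead (nearBit e z)) true (k (Nat.lor s (nearBit e z)))) false))
    (k s)

/-- It is known that the spoke of `z` crosses `e`. -/
def spokeOf (s e z : ℕ) : Bool := has s (crossBit e (16 + z))

/-- It is known that `z` lies in the triangle of `e`. -/
def near (s e z : ℕ) : Bool := has s (nearBit e z)

/-- Both end points of `f` are in the angle of `e`, one of them on the near side of `e` and the
other one on the far side. -/
noncomputable def nestedPattern (s e f : ℕ) : Bool :=
  sel (sel (spokeOf s e (edgeFst f)) (near s e (edgeSnd f)) false) true
  (sel (spokeOf s e (edgeSnd f)) (near s e (edgeFst f)) false)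

/-- The end point `c` of `f` is in the angle of `e` and the end point `b` of `e` is in the angle
of `f`, both on the near side or both on the far side. -/
noncomputable def interPattern (s e f c b : ℕ) : Bool :=
  sel (sel (near s e c) (near s f b) false) true (sel (spokeOf s e c) (spokeOf s f b) false)

/-- The facts in the state force the edges `e` and `f` to cross. -/
noncomputable def pattern (s e f : ℕ) : Bool :=
  sel (inArc s e (edgeFst f))
    (sel (inArc s e (edgeSnd f)) (nestedPattern s e f)
    (sel (inArc s f (edgeFst e)) (interPattern s e f (edgeFst f) (edgeFst e))
    (interPattern s e f (edgeFst f) (edgeSnd e))))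
  (sel (inArc s e (edgeSnd f))
    (sel (inArc s f (edgeFst e)) (interPattern s e f (edgeSnd f) (edgeFst e))
    (interPattern s e f (edgeSnd f) (edgeSnd e)))
  (nestedPattern s f e))

/-- Add the crossing of `e` and `f` if it is forced. -/
noncomputable def crossStep (dead e f : ℕ) (k : ℕ → Bool) (s : ℕ) : Bool :=
  sel (pattern s e f) (sel (has dead (crossBit e f)) true (addCross e f k s)) (k s)

/-- One of the goals `ms` holds in the state `s`. -/
noncomputable def anyHas (s : ℕ) (ms : List ℕ) : Bool :=
  List.rec false (fun m _ ih => sel (has s m) true ih) ms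

/-- One step of the search, followed by the continuation `k`. -/
noncomputable def Op.run (dead : ℕ) (closed : List ℕ) (op : Op) (k : ℕ → Bool) : ℕ → Bool :=
  Op.rec (motive := fun _ => ℕ → Bool)
  (fun w prev s =>
    List.rec (motive := fun _ => Bool) (k s) (fun _ _ _ => rowStep prev w k s prev) prev)
  (fun a b => orientStep (signBit b a) (signBit a b) k)
  (fun e z s =>
    sel (orientStep (arcMask (edgeSnd e) z (edgeFst e)) (arcMask (edgeFst e) z (edgeSnd e)) k s)
      (orientStep (arcMask (edgeFst e) z (edgeSnd e)) (arcMask (edgeSnd e) z (edgeFst e)) k s)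
      false)
  (fun e z => splitStep dead e z k)
  (fun e f => crossStep dead e f k)
  (fun s => sel (anyHas s closed) true (k s)) op

/-- The search: all branches have to be closed or to reach one of the goals `closed`. -/
noncomputable def run (dead : ℕ) (closed : List ℕ) (ops : List Op) : ℕ → Bool :=
  List.rec (fun s => anyHas s closed) (fun op _ ih s => op.run dead closed ih s) ops

/-- The edges of the antiprism that join vertices in `vs`. -/
def edgesIn (vs : List ℕ) : List ℕ :=
  (List.range 16).filter fun e => vs.contains (edgeFst e) && vs.contains (edgeSnd e)

/-- The vertices `vs` are known once `w` is inserted after `prev`, but not before. -/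
def newIn (prev : List ℕ) (w : ℕ) (vs : List ℕ) : Bool :=
  vs.contains w && vs.all (fun v => Nat.beq v w || prev.contains v)

/-- The edge `e` joins `z - 1` and `z + 1`. -/
def isMid (e z : ℕ) : Bool := Nat.ble 8 e && Nat.beq ((e - 7) % 8) z

/-- A near-far decision, followed by a test of the goals (if `cl` is set) where it matters. -/
def splitOps (cl : Bool) (e z : ℕ) : List Op :=
  bif cl && isMid e z then [.split e z, .close] else [.split e z]

/-- The steps that are taken when the vertex `w` is inserted after the vertices `prev`; `assm` is
a list of pairs `(e, z)` for which `z` is assumed to lie in the angle of `e`. -/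
def levelOps (cl : Bool) (assm : List (ℕ × ℕ)) (prev : List ℕ) (w : ℕ) : List Op :=
  .row w prev :: ((bif newIn prev w [0, 1] then [.orient 0 1] else []) ++
    ((assm.filter fun p => newIn prev w [edgeFst p.1, edgeSnd p.1, p.2]).map fun p =>
      .arc p.1 p.2) ++
    ((edgesIn prev).flatMap (splitOps cl · w)) ++
    ((List.range 16).filter fun e =>
      touches e w && (prev.contains (edgeFst e) || prev.contains (edgeSnd e))).flatMap
      fun e => (prev.filter fun z => !(touches e z)).flatMap (splitOps cl e) ++
        ((edgesIn prev).filter fun f => !(adjacentEdges e f)).map (.cross e))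

/-- The search program that inserts the vertices in the given order. -/
def program (cl : Bool) (assm : List (ℕ × ℕ)) : List ℕ → List ℕ → List Op
  | _, [] => []
  | prev, w :: ws => levelOps cl assm prev w ++ program cl assm (prev ++ [w]) ws

/-- The action on edges of the automorphism that moves every vertex by one along the zigzag. -/
def shiftE (e : ℕ) : ℕ :=
  bif Nat.ble 16 e then 16 + (e - 15) % 8 else bif Nat.ble 8 e then 8 + (e - 7) % 8 else (e + 1) % 8

/-- The action on edges of the automorphism that sends the vertex `z` to `-z`. -/
def reflE (e : ℕ) : ℕ :=
  bif Nat.ble 16 e then 16 + (24 - e) % 8 else bif Nat.ble 8 e then 8 + (22 - e) % 8 else 7 - e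

/-- The action on vertices of the automorphism that moves every vertex by one along the zigzag. -/
def shiftV (z : ℕ) : ℕ := (z + 1) % 8

/-- The automorphism that sends the vertex `z` to `-z`. -/
def reflV (z : ℕ) : ℕ := (8 - z) % 8

/-- The union of sets of facts. -/
def mask (l : List ℕ) : ℕ := l.foldr Nat.lor 0

/-- The first `n` iterates of a pair of maps. -/
def orb (p : ℕ × ℕ) (fe ff : ℕ → ℕ) : ℕ → List (ℕ × ℕ)
  | 0 => []
  | n + 1 => p :: orb (fe p.1, ff p.2) fe ff n

/-- The images under the dihedral group of the fact that `e` and `f` cross. -/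
def crossOrbit (e f : ℕ) : ℕ :=
  mask ((orb (e, f) shiftE shiftE 8 ++ orb (reflE e, reflE f) shiftE shiftE 8).map fun p =>
    Nat.lor (crossBit p.1 p.2) (crossBit p.2 p.1))

/-- The images under the dihedral group of the fact that `z` is near `e`. -/
def nearOrbit (e z : ℕ) : ℕ :=
  mask ((orb (e, z) shiftE shiftV 8 ++ orb (reflE e, reflV z) shiftE shiftV 8).map fun p =>
    nearBit p.1 p.2)

/-- The search that starts with the facts `start` and inserts the vertices in the given order. -/
noncomputable def search (dead start : ℕ) (assm : List (ℕ × ℕ)) (goals : List ℕ) (cl : Bool)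
    (order : List ℕ) : Bool :=
  run dead goals (program cl assm [] order) start

/-- The edge that joins `j - 1` and `j + 1`. -/
def midEdge (j : ℕ) : ℕ := 8 + (j + 7) % 8

/-- The facts which say that the spoke of `j` crosses the edge from `j - 1` to `j + 1`. -/
def midBit (j : ℕ) : ℕ := Nat.lor (crossBit (midEdge j) (16 + j)) (crossBit (16 + j) (midEdge j))

/-- The facts about a drawing that the search uses: the signs of the angles between spokes, the
vertices near an edge and the crossings. -/
structure Model where
  sgn : ℕ → ℕ → Prop
  near : ℕ → ℕ → Prop
  cross : ℕ → ℕ → Prop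

namespace Model
variable (M : Model)

/-- The vertex `z` lies in the angle that the edge `e` spans at the center. -/
def Arc (e z : ℕ) : Prop :=
  (M.sgn (edgeFst e) (edgeSnd e) ∧ M.sgn (edgeFst e) z ∧ M.sgn z (edgeSnd e)) ∨
  (M.sgn (edgeSnd e) (edgeFst e) ∧ M.sgn (edgeSnd e) z ∧ M.sgn z (edgeFst e))

/-- The laws on which the search relies. They hold in all RAC drawings, if the signs are taken
after a small perturbation that leaves no two spokes parallel. -/
structure Lawful : Prop where
  asymm : ∀ a b, M.sgn a b → ¬ M.sgn b a
  row : ∀ w < 8, ∀ prev : List ℕ, prev ≠ [] → w ∉ prev → (∀ t ∈ prev, t < 8) → ∃ u ∈ prev,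
    (M.sgn u w ∧ ∀ t ∈ prev, (M.sgn u t → M.sgn w t) ∧ (M.sgn t u → M.sgn t w)) ∨
    (M.sgn w u ∧ ∀ t ∈ prev, (M.sgn u t → M.sgn t w) ∧ (M.sgn t u → M.sgn w t))
  cross_symm : ∀ e f, M.cross e f → M.cross f e
  arc_of_cross : ∀ e < 16, ∀ z < 8, M.cross e (16 + z) → M.Arc e z
  arc_of_near : ∀ e < 16, ∀ z < 8, M.near e z → M.Arc e z
  split : ∀ e < 16, ∀ z < 8, touches e z = false → M.Arc e z → M.cross e (16 + z) ∨ M.near e z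
  fan : ∀ e < 24, ∀ f < 24, ∀ g < 24, adjacentEdges f g = true → M.cross e f → ¬ M.cross e g
  triangle : ∀ e < 24, ∀ f < 24, ∀ g < 24, M.cross e f → M.cross e g → ¬ M.cross f g
  nested : ∀ e < 16, ∀ f < 16, touches e (edgeFst f) = false → touches e (edgeSnd f) = false →
    ∀ c d, (c = edgeFst f ∧ d = edgeSnd f ∨ c = edgeSnd f ∧ d = edgeFst f) →
    M.cross e (16 + c) → M.near e d → M.cross e f
  inter : ∀ e < 16, ∀ f < 16, touches e (edgeFst f) = false → touches e (edgeSnd f) = false →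
    ∀ c b, (c = edgeFst f ∨ c = edgeSnd f) → (b = edgeFst e ∨ b = edgeSnd e) →
    (M.near e c ∧ M.near f b ∨ M.cross e (16 + c) ∧ M.cross f (16 + b)) → M.cross e f

/-- The fact that the `i`-th bit stands for. -/
def Fact (i : ℕ) : Prop :=
  if i < 64 then M.sgn (i / 8) (i % 8)
  else if i < 192 then M.near ((i - 64) / 8) ((i - 64) % 8)
  else M.cross ((i - 192) / 24) ((i - 192) % 24)

/-- All facts of the state `s` hold in the model. -/
def Holds (s : ℕ) : Prop := ∀ i, s.testBit i = true → M.Fact i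

variable {M}

theorem holds_lor {s m : ℕ} : M.Holds (Nat.lor s m) ↔ M.Holds s ∧ M.Holds m := by
  have h : Nat.lor s m = s ||| m := rfl
  simp only [Holds, h, Nat.testBit_or, Bool.or_eq_true]
  exact ⟨fun h => ⟨fun i hi => h i (.inl hi), fun i hi => h i (.inr hi)⟩,
    fun h i hi => hi.elim (h.1 i) (h.2 i)⟩

theorem holds_pow {i : ℕ} : M.Holds (Nat.pow 2 i) ↔ M.Fact i := by
  have h : Nat.pow 2 i = 2 ^ i := rfl
  simp [Holds, Nat.testBit_two_pow]

theorem holds_zero : M.Holds 0 := by simp [Holds]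

theorem holds_mask {l : List ℕ} : M.Holds (mask l) ↔ ∀ m ∈ l, M.Holds m := by
  induction l with
  | nil => simp [mask, holds_zero]
  | cons m l ih =>
    have : mask (m :: l) = Nat.lor m (mask l) := rfl
    rw [this, holds_lor, ih]; simp

theorem holds_signBit {a b : ℕ} (hb : b < 8) (ha : a < 8) :
    M.Holds (signBit a b) ↔ M.sgn a b := by
  have h : Nat.add (Nat.mul 8 a) b = 8 * a + b := rfl
  rw [signBit, h, holds_pow, Fact, if_pos (by omega)]
  rw [show (8 * a + b) / 8 = a by omega, show (8 * a + b) % 8 = b by omega]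

theorem holds_nearBit {e z : ℕ} (he : e < 16) (hz : z < 8) :
    M.Holds (nearBit e z) ↔ M.near e z := by
  have h : Nat.add (Nat.add 64 (Nat.mul 8 e)) z = 64 + 8 * e + z := rfl
  rw [nearBit, h, holds_pow, Fact, if_neg (by omega), if_pos (by omega)]
  rw [show (64 + 8 * e + z - 64) / 8 = e by omega, show (64 + 8 * e + z - 64) % 8 = z by omega]

theorem fact_cross {e f : ℕ} (hf : f < 24) : M.Fact (192 + 24 * e + f) ↔ M.cross e f := by
  rw [Fact, if_neg (by omega), if_neg (by omega)]
  rw [show (192 + 24 * e + f - 192) / 24 = e by omega,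
    show (192 + 24 * e + f - 192) % 24 = f by omega]

theorem holds_crossBit {e f : ℕ} (hf : f < 24) : M.Holds (crossBit e f) ↔ M.cross e f := by
  have h : Nat.add (Nat.add 192 (Nat.mul 24 e)) f = 192 + 24 * e + f := rfl
  rw [crossBit, h, holds_pow, fact_cross hf]

theorem holds_of_has {s m : ℕ} (h : has s m = true) (hs : M.Holds s) : M.Holds m := by
  intro i hi
  have h' : s &&& m = m := Nat.eq_of_beq_eq_true h
  rw [← h', Nat.testBit_and, Bool.and_eq_true] at hi
  exact hs i hi.1

theorem holds_arcMask {a z b : ℕ} (ha : a < 8) (hz : z < 8) (hb : b < 8) :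
    M.Holds (arcMask a z b) ↔ M.sgn a b ∧ M.sgn a z ∧ M.sgn z b := by
  rw [arcMask, holds_lor, holds_lor, holds_signBit hb ha, holds_signBit hz ha,
    holds_signBit hb hz, and_assoc]

end Model

theorem sel_true {α : Type} (t e : α) : sel true t e = t := rfl
theorem sel_false {α : Type} (t e : α) : sel false t e = e := rfl

theorem sel_eq_true_iff {c t e : Bool} :
    sel c t e = true ↔ (c = true ∧ t = true) ∨ (c = false ∧ e = true) := by
  cases c <;> simp [sel]

theorem edgeFst_lt {e : ℕ} (he : e < 16) : edgeFst e < 8 := by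
  interval_cases e <;> decide
theorem edgeSnd_lt {e : ℕ} (he : e < 16) : edgeSnd e < 8 := by
  interval_cases e <;> decide

namespace Model
variable {M : Model}

theorem arc_of_inArc {s e z : ℕ} (he : e < 16) (hz : z < 8) (h : inArc s e z = true)
    (hs : M.Holds s) : M.Arc e z := by
  rw [inArc, sel_eq_true_iff] at h
  rcases h with ⟨h, -⟩ | ⟨-, h⟩
  · exact .inl ((holds_arcMask (edgeFst_lt he) hz (edgeSnd_lt he)).1 (holds_of_has h hs))
  · exact .inr ((holds_arcMask (edgeSnd_lt he) hz (edgeFst_lt he)).1 (holds_of_has h hs))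

theorem cross_of_crossRow {s e f : ℕ} (hs : M.Holds s) (h : (crossRow s e).testBit f = true) :
    f < 24 ∧ M.cross e f := by
  have h' : crossRow s e = (s >>> (192 + 24 * e)) &&& (2 ^ 24 - 1) := rfl
  rw [h', Nat.testBit_and, Nat.testBit_shiftRight, Nat.testBit_two_pow_sub_one,
    Bool.and_eq_true, decide_eq_true_eq] at h
  exact ⟨h.2, (fact_cross h.2).1 (hs _ h.1)⟩

theorem testBit_sumMask {p : ℕ → Bool} {n i : ℕ} (h : (sumMask p n).testBit i = true) :
    i < n ∧ p i = true := by
  induction n with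
  | zero => simp [sumMask] at h
  | succ n ih =>
    have h' : sumMask p (n + 1) = sel (p n) (sumMask p n ||| 2 ^ n) (sumMask p n) := rfl
    rw [h'] at h
    cases hp : p n
    · rw [hp, sel_false] at h
      exact ⟨(ih h).1.trans (Nat.lt_succ_self n), (ih h).2⟩
    · rw [hp, sel_true, Nat.testBit_or, Bool.or_eq_true, Nat.testBit_two_pow,
        decide_eq_true_eq] at h
      rcases h with h | rfl
      · exact ⟨(ih h).1.trans (Nat.lt_succ_self n), (ih h).2⟩
      · exact ⟨Nat.lt_succ_self _, hp⟩

theorem land_beq_zero {a b : ℕ} (h : ∀ i, a.testBit i = true → b.testBit i = true → False) :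
    Nat.beq (Nat.land a b) 0 = true := by
  have : a &&& b = 0 := by
    apply Nat.eq_of_testBit_eq
    intro i
    rw [Nat.testBit_and, Nat.zero_testBit, Bool.and_eq_false_iff]
    by_contra hc
    simp only [not_or, Bool.not_eq_false] at hc
    exact h i hc.1 hc.2
  exact Nat.beq_eq ▸ this

variable {P : Prop} {k : ℕ → Bool} (hk : ∀ s, M.Holds s → k s = true → P)
include hk

theorem addCross_sound (hM : M.Lawful) {e f s : ℕ} (he : e < 24) (hf : f < 24)
    (hef : M.cross e f) (hs : M.Holds s) (h : addCross e f k s = true) : P := by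
  have hfe := hM.cross_symm _ _ hef
  rw [addCross, land_beq_zero, land_beq_zero, land_beq_zero] at h
  · refine hk _ ?_ h
    rw [holds_lor, holds_lor, holds_crossBit hf, holds_crossBit he]
    exact ⟨hs, hef, hfe⟩
  · intro g h1 h2
    obtain ⟨hg, h1⟩ := cross_of_crossRow hs h1
    obtain ⟨-, h2⟩ := cross_of_crossRow hs h2
    exact hM.triangle e he f hf g hg hef h1 h2
  · intro g h1 h2
    obtain ⟨hg, h1⟩ := cross_of_crossRow hs h1
    exact hM.fan f hf e he g hg (testBit_sumMask h2).2 hfe h1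
  · intro g h1 h2
    obtain ⟨hg, h1⟩ := cross_of_crossRow hs h1
    exact hM.fan e he f hf g hg (testBit_sumMask h2).2 hef h1

theorem orientStep_sound {m m' s : ℕ} (hm : M.Holds m)
    (hm' : ∀ i, m'.testBit i = true → ¬ M.Fact i) (hs : M.Holds s)
    (h : orientStep m' m k s = true) : P := by
  rw [orientStep, land_beq_zero] at h
  · exact hk _ (holds_lor.2 ⟨hs, hm⟩) h
  · exact fun i h1 h2 => hm' i h2 (hs i h1)

variable {dead : ℕ} (hd : ∀ i, dead.testBit i = true → ¬ M.Fact i)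
include hd

omit hk in
theorem has_dead {i : ℕ} (hi : M.Fact i) : has dead (Nat.pow 2 i) = false := by
  by_contra h
  rw [Bool.not_eq_false] at h
  have h' : dead &&& 2 ^ i = 2 ^ i := Nat.eq_of_beq_eq_true h
  refine hd i ?_ hi
  have := congrArg (fun n => n.testBit i) h'
  simpa [Nat.testBit_and, Nat.testBit_two_pow] using this

omit hk in
theorem has_dead_cross {e f : ℕ} (hf : f < 24) (h : M.cross e f) :
    has dead (crossBit e f) = false := has_dead hd ((fact_cross hf).2 h)

omit hk in
theorem has_dead_near {e z : ℕ} (he : e < 16) (hz : z < 8) (h : M.near e z) :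
    has dead (nearBit e z) = false :=
  has_dead hd (holds_pow.1 ((holds_nearBit he hz).2 h))

theorem splitStep_sound (hM : M.Lawful) {e z s : ℕ} (he : e < 16) (hz : z < 8)
    (hez : touches e z = false) (hs : M.Holds s) (h : splitStep dead e z k s = true) : P := by
  rw [splitStep] at h
  cases ha : inArc s e z
  · rw [ha] at h; exact hk _ hs h
  rw [ha, sel_true] at h
  cases hc : has s (crossBit e (16 + z))
  · rw [hc, sel_false, sel_eq_true_iff] at h
    obtain ⟨h1, h2⟩ := h.resolve_right (by simp)
    rcases hM.split e he z hz hez (arc_of_inArc he hz ha hs) with hx | hx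
    · rw [has_dead_cross hd (by omega) hx] at h1
      exact addCross_sound hk hM (by omega) (by omega) hx hs h1
    · rw [has_dead_near hd he hz hx] at h2
      exact hk _ (holds_lor.2 ⟨hs, (holds_nearBit he hz).2 hx⟩) h2
  · rw [hc] at h; exact hk _ hs h

end Model
end RACSearch

/-! ### Soundness of the search -/

namespace RACSearch

namespace Model
variable {M : Model}

theorem holds_rowBits {s u : ℕ} {fwd bwd : ℕ → ℕ} (hs : M.Holds s) (hu : u < 8)
    {prev : List ℕ} (hp : ∀ t ∈ prev, t < 8)
    (hf : ∀ t ∈ prev, M.sgn u t → M.Holds (fwd t)) (hb : ∀ t ∈ prev, M.sgn t u → M.Holds (bwd t)) :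
    M.Holds (rowBits s u fwd bwd prev) := by
  induction prev with
  | nil => exact holds_zero
  | cons t l ih =>
    have ih := ih (fun t ht => hp t (.tail _ ht)) (fun t ht => hf t (.tail _ ht))
      (fun t ht => hb t (.tail _ ht))
    have ht : t < 8 := hp t (.head _)
    have h' : rowBits s u fwd bwd (t :: l) = sel (has s (signBit u t))
        (Nat.lor (rowBits s u fwd bwd l) (fwd t)) (sel (has s (signBit t u))
          (Nat.lor (rowBits s u fwd bwd l) (bwd t)) (rowBits s u fwd bwd l)) := rfl
    rw [h']
    cases h1 : has s (signBit u t)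
    · cases h2 : has s (signBit t u)
      · exact ih
      · exact holds_lor.2 ⟨ih, hb t (.head _) ((holds_signBit hu ht).1 (holds_of_has h2 hs))⟩
    · exact holds_lor.2 ⟨ih, hf t (.head _) ((holds_signBit ht hu).1 (holds_of_has h1 hs))⟩

theorem rowStep_sound {P : Prop} {k : ℕ → Bool} (hk : ∀ s, M.Holds s → k s = true → P)
    {w s : ℕ} (hw : w < 8) {all : List ℕ} (ha : ∀ t ∈ all, t < 8) (hs : M.Holds s)
    {prev : List ℕ} (hp : ∀ t ∈ prev, t < 8)
    (hr : ∃ u ∈ prev,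
      (M.sgn u w ∧ ∀ t ∈ all, (M.sgn u t → M.sgn w t) ∧ (M.sgn t u → M.sgn t w)) ∨
      (M.sgn w u ∧ ∀ t ∈ all, (M.sgn u t → M.sgn t w) ∧ (M.sgn t u → M.sgn w t)))
    (h : rowStep all w k s prev = true) : P := by
  induction prev with
  | nil => simp at hr
  | cons v l ih =>
    have h' : rowStep all w k s (v :: l) = sel
      (k (Nat.lor (Nat.lor s (signBit v w))
        (rowBits s v (signBit w) (fun t => signBit t w) all)))
      (sel (k (Nat.lor (Nat.lor s (signBit w v))
        (rowBits s v (fun t => signBit t w) (signBit w) all))) (rowStep all w k s l) false)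
      false := rfl
    rw [h', sel_eq_true_iff, sel_eq_true_iff] at h
    obtain ⟨h1, h⟩ := h.resolve_right (by simp)
    obtain ⟨h2, h3⟩ := h.resolve_right (by simp)
    obtain ⟨u, hu, hr⟩ := hr
    rcases List.mem_cons.1 hu with rfl | hu
    · have hu8 := hp u (.head _)
      rcases hr with ⟨hr, hr'⟩ | ⟨hr, hr'⟩
      · exact hk _ (holds_lor.2 ⟨holds_lor.2 ⟨hs, (holds_signBit hw hu8).2 hr⟩,
          holds_rowBits hs hu8 ha (fun t ht h => (holds_signBit (ha t ht) hw).2 ((hr' t ht).1 h))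
            (fun t ht h => (holds_signBit hw (ha t ht)).2 ((hr' t ht).2 h))⟩) h1
      · exact hk _ (holds_lor.2 ⟨holds_lor.2 ⟨hs, (holds_signBit hu8 hw).2 hr⟩,
          holds_rowBits hs hu8 ha (fun t ht h => (holds_signBit hw (ha t ht)).2 ((hr' t ht).1 h))
            (fun t ht h => (holds_signBit (ha t ht) hw).2 ((hr' t ht).2 h))⟩) h2
    · exact ih (fun t ht => hp t (.tail _ ht)) ⟨u, hu, hr⟩ h3

theorem cross_of_spokeOf {s e z : ℕ} (hz : z < 8) (hs : M.Holds s)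
    (h : spokeOf s e z = true) : M.cross e (16 + z) :=
  (holds_crossBit (by omega)).1 (holds_of_has h hs)

theorem near_of_near {s e z : ℕ} (he : e < 16) (hz : z < 8) (hs : M.Holds s)
    (h : RACSearch.near s e z = true) : M.near e z :=
  (holds_nearBit he hz).1 (holds_of_has h hs)

theorem cross_of_nestedPattern (hM : M.Lawful) {s e f : ℕ} (he : e < 16) (hf : f < 16)
    (h1 : touches e (edgeFst f) = false) (h2 : touches e (edgeSnd f) = false) (hs : M.Holds s)
    (h : nestedPattern s e f = true) : M.cross e f := by
  have := edgeFst_lt hf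
  have := edgeSnd_lt hf
  simp only [nestedPattern, sel_eq_true_iff] at h
  rcases h with ⟨⟨h3, h4⟩ | h, -⟩ | ⟨-, ⟨h3, h4⟩ | h⟩
  · exact hM.nested e he f hf h1 h2 _ _ (.inl ⟨rfl, rfl⟩) (cross_of_spokeOf (by omega) hs h3)
      (near_of_near he (by omega) hs h4)
  · simp at h
  · exact hM.nested e he f hf h1 h2 _ _ (.inr ⟨rfl, rfl⟩) (cross_of_spokeOf (by omega) hs h3)
      (near_of_near he (by omega) hs h4)
  · simp at h

theorem cross_of_interPattern (hM : M.Lawful) {s e f c b : ℕ} (he : e < 16) (hf : f < 16)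
    (h1 : touches e (edgeFst f) = false) (h2 : touches e (edgeSnd f) = false)
    (hc : c = edgeFst f ∨ c = edgeSnd f) (hb : b = edgeFst e ∨ b = edgeSnd e) (hs : M.Holds s)
    (h : interPattern s e f c b = true) : M.cross e f := by
  have := edgeFst_lt hf
  have := edgeSnd_lt hf
  have := edgeFst_lt he
  have := edgeSnd_lt he
  have hc8 : c < 8 := by omega
  have hb8 : b < 8 := by omega
  simp only [interPattern, sel_eq_true_iff] at h
  refine hM.inter e he f hf h1 h2 c b hc hb ?_
  rcases h with ⟨⟨h3, h4⟩ | h, -⟩ | ⟨-, ⟨h3, h4⟩ | h⟩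
  · exact .inl ⟨near_of_near he hc8 hs h3, near_of_near hf hb8 hs h4⟩
  · simp at h
  · exact .inr ⟨cross_of_spokeOf hc8 hs h3, cross_of_spokeOf hb8 hs h4⟩
  · simp at h

theorem cross_of_pattern (hM : M.Lawful) {s e f : ℕ} (he : e < 16) (hf : f < 16)
    (h1 : touches e (edgeFst f) = false) (h2 : touches e (edgeSnd f) = false)
    (h3 : touches f (edgeFst e) = false) (h4 : touches f (edgeSnd e) = false) (hs : M.Holds s)
    (h : pattern s e f = true) : M.cross e f := by
  simp only [pattern, sel_eq_true_iff] at h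
  rcases h with ⟨-, ⟨-, h⟩ | ⟨-, ⟨-, h⟩ | ⟨-, h⟩⟩⟩ | ⟨-, ⟨-, ⟨-, h⟩ | ⟨-, h⟩⟩ | ⟨-, h⟩⟩
  · exact cross_of_nestedPattern hM he hf h1 h2 hs h
  · exact cross_of_interPattern hM he hf h1 h2 (.inl rfl) (.inl rfl) hs h
  · exact cross_of_interPattern hM he hf h1 h2 (.inl rfl) (.inr rfl) hs h
  · exact cross_of_interPattern hM he hf h1 h2 (.inr rfl) (.inl rfl) hs h
  · exact cross_of_interPattern hM he hf h1 h2 (.inr rfl) (.inr rfl) hs h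
  · exact hM.cross_symm _ _ (cross_of_nestedPattern hM hf he h3 h4 hs h)

theorem exists_holds_of_anyHas {s : ℕ} (hs : M.Holds s) {ms : List ℕ}
    (h : anyHas s ms = true) : ∃ m ∈ ms, M.Holds m := by
  induction ms with
  | nil => cases h
  | cons m l ih =>
    have h' : anyHas s (m :: l) = sel (has s m) true (anyHas s l) := rfl
    rw [h', sel_eq_true_iff] at h
    rcases h with ⟨h, -⟩ | ⟨-, h⟩
    · exact ⟨m, .head _, holds_of_has h hs⟩
    · obtain ⟨m, hm, h⟩ := ih h
      exact ⟨m, .tail _ hm, h⟩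

end Model

/-- The side conditions under which a step of the search is sound. -/
def Op.valid (assm : List (ℕ × ℕ)) : Op → Bool
  | .row w prev => Nat.blt w 8 && !prev.contains w && prev.all (Nat.blt · 8)
  | .orient a b => Nat.beq a 0 && Nat.beq b 1
  | .arc e z => Nat.blt e 16 && Nat.blt z 8 && assm.contains (e, z)
  | .split e z => Nat.blt e 16 && Nat.blt z 8 && !touches e z
  | .cross e f => Nat.blt e 16 && Nat.blt f 16 && !touches e (edgeFst f) && !touches e (edgeSnd f)
      && !touches f (edgeFst e) && !touches f (edgeSnd e)
  | .close => true

namespace Model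
variable {M : Model}

theorem not_fact_arcMask (hM : M.Lawful) {a z b : ℕ} (ha : a < 8) (hz : z < 8) (hb : b < 8)
    (h1 : M.sgn b a) (h2 : M.sgn z a) (h3 : M.sgn b z) (i : ℕ)
    (hi : (arcMask a z b).testBit i = true) : ¬ M.Fact i := by
  have key : ∀ {c d}, c < 8 → d < 8 → M.sgn d c → (signBit c d).testBit i = true →
      ¬ M.Fact i := by
    intro c d hc hd h hi hF
    refine hM.asymm _ _ h ?_
    have h' : Nat.add (Nat.mul 8 c) d = 8 * c + d := rfl
    have h'' : Nat.pow 2 (8 * c + d) = 2 ^ (8 * c + d) := rfl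
    rw [signBit, h', h'', Nat.testBit_two_pow, decide_eq_true_eq] at hi
    subst hi
    exact (holds_signBit hd hc).1 (by rw [signBit, h']; exact holds_pow.2 hF)
  have h' : arcMask a z b = signBit a b ||| signBit a z ||| signBit z b := rfl
  rw [h', Nat.testBit_or, Nat.testBit_or, Bool.or_eq_true, Bool.or_eq_true] at hi
  rcases hi with (hi | hi) | hi
  · exact key ha hb h1 hi
  · exact key ha hz h2 hi
  · exact key hz hb h3 hi

/-- A step that succeeds leads to a goal: some branch always agrees with the model. -/
theorem Op.run_sound (hM : M.Lawful) (h01 : M.sgn 0 1) {assm : List (ℕ × ℕ)}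
    (harc : ∀ p ∈ assm, M.Arc p.1 p.2) {dead : ℕ}
    (hd : ∀ i, dead.testBit i = true → ¬ M.Fact i) {closed : List ℕ} {op : Op}
    (hop : op.valid assm = true) {k : ℕ → Bool}
    (hk : ∀ s, M.Holds s → k s = true → ∃ m ∈ closed, M.Holds m) {s : ℕ} (hs : M.Holds s)
    (h : op.run dead closed k s = true) : ∃ m ∈ closed, M.Holds m := by
  cases op with
  | row w prev =>
    simp only [Op.valid, Bool.and_eq_true, Nat.blt_eq, Bool.not_eq_true', List.all_eq_true,
      List.contains_eq_mem, decide_eq_false_iff_not] at hop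
    obtain ⟨⟨hw, hwp⟩, hp⟩ := hop
    cases prev with
    | nil => exact hk s hs h
    | cons v l => exact rowStep_sound hk hw hp hs hp (hM.row w hw _ (by simp) hwp hp) h
  | orient a b =>
    simp only [Op.valid, Bool.and_eq_true, Nat.beq_eq] at hop
    obtain ⟨rfl, rfl⟩ := hop
    refine orientStep_sound hk ((holds_signBit (by omega) (by omega)).2 h01) ?_ hs h
    intro i hi hF
    have h' : signBit 1 0 = 2 ^ 8 := rfl
    rw [h', Nat.testBit_two_pow, decide_eq_true_eq] at hi
    subst hi
    exact hM.asymm _ _ h01 hF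
  | arc e z =>
    simp only [Op.valid, Bool.and_eq_true, Nat.blt_eq, List.contains_eq_mem,
      decide_eq_true_eq] at hop
    obtain ⟨⟨he, hz⟩, hp⟩ := hop
    have h' : sel (orientStep (arcMask (edgeSnd e) z (edgeFst e))
        (arcMask (edgeFst e) z (edgeSnd e)) k s) (orientStep (arcMask (edgeFst e) z (edgeSnd e))
        (arcMask (edgeSnd e) z (edgeFst e)) k s) false = true := h
    rw [sel_eq_true_iff] at h'
    obtain ⟨h1, h2⟩ := h'.resolve_right (by simp)
    have e1 := edgeFst_lt he
    have e2 := edgeSnd_lt he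
    rcases harc _ hp with ha | ha
    · exact orientStep_sound hk ((holds_arcMask e1 hz e2).2 ha)
        (not_fact_arcMask hM e2 hz e1 ha.1 ha.2.2 ha.2.1) hs h1
    · exact orientStep_sound hk ((holds_arcMask e2 hz e1).2 ha)
        (not_fact_arcMask hM e1 hz e2 ha.1 ha.2.2 ha.2.1) hs h2
  | split e z =>
    simp only [Op.valid, Bool.and_eq_true, Nat.blt_eq, Bool.not_eq_true'] at hop
    exact splitStep_sound hk hd hM hop.1.1 hop.1.2 hop.2 hs h
  | cross e f =>
    simp only [Op.valid, Bool.and_eq_true, Nat.blt_eq, Bool.not_eq_true'] at hop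
    obtain ⟨⟨⟨⟨⟨he, hf⟩, h1⟩, h2⟩, h3⟩, h4⟩ := hop
    have h' : sel (pattern s e f)
      (sel (has dead (crossBit e f)) true (addCross e f k s)) (k s) = true := h
    cases hp : pattern s e f
    · rw [hp] at h'; exact hk s hs h'
    · have hx := cross_of_pattern hM he hf h1 h2 h3 h4 hs hp
      rw [hp, has_dead_cross hd (by omega) hx] at h'
      exact addCross_sound hk hM (by omega) (by omega) hx hs h'
  | close =>
    have h' : sel (anyHas s closed) true (k s) = true := h
    rw [sel_eq_true_iff] at h'
    rcases h' with ⟨h, -⟩ | ⟨-, h⟩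
    · exact exists_holds_of_anyHas hs h
    · exact hk s hs h

theorem run_sound (hM : M.Lawful) (h01 : M.sgn 0 1) {assm : List (ℕ × ℕ)}
    (harc : ∀ p ∈ assm, M.Arc p.1 p.2) {dead : ℕ}
    (hd : ∀ i, dead.testBit i = true → ¬ M.Fact i) {closed : List ℕ} {ops : List Op}
    (hops : ops.all (Op.valid assm) = true) {s : ℕ} (hs : M.Holds s)
    (h : run dead closed ops s = true) : ∃ m ∈ closed, M.Holds m := by
  induction ops generalizing s with
  | nil => exact exists_holds_of_anyHas hs h
  | cons op l ih =>
    rw [List.all_cons, Bool.and_eq_true] at hops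
    exact Op.run_sound hM h01 harc hd hops.1 (fun s hs h => ih hops.2 hs h) hs h

theorem search_sound (hM : M.Lawful) (h01 : M.sgn 0 1) {assm : List (ℕ × ℕ)}
    (harc : ∀ p ∈ assm, M.Arc p.1 p.2) {dead : ℕ}
    (hd : ∀ i, dead.testBit i = true → ¬ M.Fact i) {goals : List ℕ} {cl : Bool} {order : List ℕ}
    (hops : (program cl assm [] order).all (Op.valid assm) = true) {s : ℕ} (hs : M.Holds s)
    (h : search dead s assm goals cl order = true) : ∃ m ∈ goals, M.Holds m :=
  run_sound hM h01 harc hd hops hs h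

end Model
end RACSearch

/-! ### The results of the search -/

namespace RACSearch

/-- The fact that `e` and `f` cross, in both orders. -/
def crossPair (e f : ℕ) : ℕ := Nat.lor (crossBit e f) (crossBit f e)

/-- Facts that are impossible in every RAC drawing. This and the following sets arise by adding
one orbit after the other, in the order in which they are refuted. A crossing with an edge `16 +
z` is one with the spoke of `z`. -/
def deadCross_0_20 : ℕ := crossOrbit 0 (16 + 4)
def deadCross_8_20 : ℕ := Nat.lor deadCross_0_20 (crossOrbit 8 (16 + 4))
def deadCross_8_19 : ℕ := Nat.lor deadCross_8_20 (crossOrbit 8 (16 + 3))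
def deadCross_0_18 : ℕ := Nat.lor deadCross_8_19 (crossOrbit 0 (16 + 2))
def deadCross_0_19 : ℕ := Nat.lor deadCross_0_18 (crossOrbit 0 (16 + 3))
def deadCross_8_21 : ℕ := Nat.lor deadCross_0_19 (crossOrbit 8 (16 + 5))
def deadNear_0_4 : ℕ := Nat.lor deadCross_8_21 (nearOrbit 0 4)
def deadNear_0_3 : ℕ := Nat.lor deadNear_0_4 (nearOrbit 0 3)
def deadNear_0_2 : ℕ := Nat.lor deadNear_0_3 (nearOrbit 0 2)
def deadCross_8_9 : ℕ := Nat.lor deadNear_0_2 (crossOrbit 8 9)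

/-- Three crossings that do not occur together: three spokes `j`, `j + 3`, `j + 5`, each crossing
the edge that joins the two neighbors of its end point along the zigzag. -/
def bans : List ℕ :=
  (List.range 8).map fun j => mask [midBit j, midBit ((j + 3) % 8), midBit ((j + 5) % 8)]

/-- All vertices are in counterclockwise order along the zigzag, and the spokes in `l` cross the
edges that join the neighbors of their end points. -/
def goalMask (l : List ℕ) : ℕ :=
  mask (l.map midBit ++ (List.range 8).map fun j => signBit j ((j + 1) % 8))

/-- The two solutions: the spokes of either one of the two squares cross the edges of the other
one. -/
def goals : List ℕ := [goalMask [1, 3, 5, 7], goalMask [0, 2, 4, 6]]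

/-- Configurations that satisfy the combinatorial rules but are refuted by metric arguments. -/
def spuriousGoals : List ℕ :=
  [mask [nearBit 13 0, crossBit 13 14, signBit 0 6, signBit 0 1],
   mask [nearBit 13 0, crossBit 13 14, signBit 0 5, signBit 5 6, signBit 0 1],
   mask [nearBit 9 0, crossBit 9 8, signBit 2 0, signBit 0 1],
   mask [nearBit 9 0, crossBit 9 8, signBit 3 0, signBit 2 3, signBit 0 1],
   mask [nearBit 9 2, crossBit 9 8, nearBit 13 6, crossBit 13 14, signBit 1 3, signBit 3 5,
     signBit 5 7, signBit 0 1],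
   mask [signBit 3 4, signBit 4 5, signBit 5 3]]

/-- The program consists of sound steps and every branch is closed or reaches a goal. -/
def SearchSucceeds (dead start : ℕ) (assm : List (ℕ × ℕ)) (goals : List ℕ) (cl : Bool)
    (order : List ℕ) : Prop :=
  (program cl assm [] order).all (Op.valid assm) = true ∧
    search dead start assm goals cl order = true

set_option maxRecDepth 100000

/-! In each of the following searches a fact is assumed whose orbit is still possible, and the
orbits that have been refuted are excluded. The orders in which the vertices are inserted are
chosen so that most branches close early. -/

theorem search_cross_0_20 :
    SearchSucceeds 0 (crossPair 0 (16 + 4)) [(0, 4)] [] false [4, 1, 0, 7, 3, 2, 5, 6] := by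
  constructor <;> decide +kernel

theorem search_cross_8_20 :
    SearchSucceeds deadCross_0_20 (crossPair 8 (16 + 4)) [(8, 4)] [] false
      [0, 4, 2, 6, 1, 5, 3, 7] := by
  constructor <;> decide +kernel

theorem search_cross_8_19 :
    SearchSucceeds deadCross_8_20 (crossPair 8 (16 + 3)) [(8, 3)] [] false
      [0, 2, 3, 1, 4, 5, 6, 7] := by
  constructor <;> decide +kernel

theorem search_cross_0_18 :
    SearchSucceeds deadCross_8_19 (crossPair 0 (16 + 2)) [(0, 2)] [] false
      [0, 2, 1, 7, 3, 4, 5, 6] := by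
  constructor <;> decide +kernel

theorem search_cross_0_19 :
    SearchSucceeds deadCross_0_18 (crossPair 0 (16 + 3)) [(0, 3)] [] false
      [0, 3, 1, 7, 2, 4, 6, 5] := by
  constructor <;> decide +kernel

theorem search_cross_8_21 :
    SearchSucceeds deadCross_0_19 (crossPair 8 (16 + 5)) [(8, 5)] [] false
      [5, 2, 0, 1, 6, 7, 3, 4] := by
  constructor <;> decide +kernel

theorem search_spurious :
    SearchSucceeds deadCross_8_21 (mask [midBit 0, midBit 3, midBit 5])
      [(midEdge 0, 0), (midEdge 3, 3), (midEdge 5, 5)] spuriousGoals false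
      [0, 1, 7, 2, 3, 4, 5, 6] := by
  constructor <;> decide +kernel

theorem search_near_0_4 :
    SearchSucceeds deadCross_8_21 (nearBit 0 4) [(0, 4)] bans true [4, 0, 1, 2, 6, 7, 3, 5] := by
  constructor <;> decide +kernel

theorem search_near_0_3 :
    SearchSucceeds deadNear_0_4 (nearBit 0 3) [(0, 3)] bans true [0, 1, 3, 4, 6, 7, 2, 5] := by
  constructor <;> decide +kernel

theorem search_near_0_2 :
    SearchSucceeds deadNear_0_3 (nearBit 0 2) [(0, 2)] bans true [0, 1, 2, 4, 5, 6, 7, 3] := by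
  constructor <;> decide +kernel

theorem search_cross_8_9 :
    SearchSucceeds deadNear_0_2 (crossPair 8 9) [] bans true [0, 2, 1, 3, 4, 7, 5, 6] := by
  constructor <;> decide +kernel

theorem search_final :
    SearchSucceeds deadCross_8_9 0 [] (goals ++ bans) true [1, 2, 0, 7, 3, 4, 6, 5] := by
  constructor <;> decide +kernel

end RACSearch

/-! ### The combinatorial classification -/

namespace RACSearch

-- The masks are huge numbers that must not be unfolded.
attribute [local irreducible] crossOrbit nearOrbit crossPair goalMask nearBit midBit
  deadCross_0_20 deadCross_8_20 deadCross_8_19 deadCross_0_18 deadCross_0_19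
  deadCross_8_21 deadNear_0_4 deadNear_0_3 deadNear_0_2 deadCross_8_9

/-- A set of models, such as those of all RAC drawings, that is closed under the dihedral
symmetries of the antiprism and under reflection, up to a change of the perturbation. Hence a
fact that is impossible in all models is impossible together with its whole orbit, and one may
assume that vertex 1 is counterclockwise of vertex 0. -/
structure IsFamily (F : Set Model) : Prop where
  lawful : ∀ M ∈ F, M.Lawful
  orient : ∀ M ∈ F, ∃ N ∈ F, N.sgn 0 1 ∧ N.cross = M.cross ∧ N.near = M.near
  shift : ∀ M ∈ F, ∃ N ∈ F, (∀ e < 24, ∀ f < 24, M.cross (shiftE e) (shiftE f) → N.cross e f) ∧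
    ∀ e < 16, ∀ z < 8, M.near (shiftE e) (shiftV z) → N.near e z
  refl : ∀ M ∈ F, ∃ N ∈ F, (∀ e < 24, ∀ f < 24, M.cross (reflE e) (reflE f) → N.cross e f) ∧
    ∀ e < 16, ∀ z < 8, M.near (reflE e) (reflV z) → N.near e z
  not_spurious : ∀ M ∈ F, M.cross (midEdge 0) 16 → M.cross (midEdge 3) 19 →
    M.cross (midEdge 5) 21 → ∀ m ∈ spuriousGoals, ¬ M.Holds m

theorem shiftE_lt {e : ℕ} (he : e < 24) : shiftE e < 24 := by
  interval_cases e <;> decide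
theorem reflE_lt {e : ℕ} (he : e < 24) : reflE e < 24 := by
  interval_cases e <;> decide
theorem shiftE_lt' {e : ℕ} (he : e < 16) : shiftE e < 16 := by
  interval_cases e <;> decide
theorem reflE_lt' {e : ℕ} (he : e < 16) : reflE e < 16 := by
  interval_cases e <;> decide
theorem shiftV_lt (z : ℕ) : shiftV z < 8 := Nat.mod_lt _ (by omega)
theorem reflV_lt (z : ℕ) : reflV z < 8 := Nat.mod_lt _ (by omega)

theorem exists_testBit_of_mask {l : List ℕ} {i : ℕ}
    (h : (mask l).testBit i = true) : ∃ m ∈ l, m.testBit i = true := by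
  induction l with
  | nil => simp [mask] at h
  | cons m l ih =>
    have h' : mask (m :: l) = m ||| mask l := rfl
    rw [h', Nat.testBit_or, Bool.or_eq_true] at h
    rcases h with h | h
    · exact ⟨m, .head _, h⟩
    · obtain ⟨m, hm, h⟩ := ih h
      exact ⟨m, .tail _ hm, h⟩

theorem eq_of_testBit_pow {i j : ℕ} (h : (Nat.pow 2 i).testBit j = true) : i = j := by
  have h' : Nat.pow 2 i = 2 ^ i := rfl
  rw [h', Nat.testBit_two_pow] at h
  simpa using h

namespace IsFamily
variable {F : Set Model} (hF : IsFamily F)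
include hF

theorem not_cross_orb {e f : ℕ} (n : ℕ) (he : e < 24) (hf : f < 24)
    (h : ∀ M ∈ F, ¬ M.cross e f) : ∀ M ∈ F, ∀ p ∈ orb (e, f) shiftE shiftE n,
      ¬ M.cross p.1 p.2 := by
  intro M hM p hp
  have key : ∀ n e f, e < 24 → f < 24 → (∀ M ∈ F, ¬ M.cross e f) →
      p ∈ orb (e, f) shiftE shiftE n → ¬ M.cross p.1 p.2 := by
    clear h he hf hp
    intro n
    induction n with
    | zero => intro e f _ _ _ hp; cases hp
    | succ n ih =>
      intro e f he hf h hp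
      rcases List.mem_cons.1 hp with rfl | hp
      · exact h M hM
      · refine ih _ _ (shiftE_lt he) (shiftE_lt hf) (fun M hM hx => ?_) hp
        obtain ⟨N, hN, h', -⟩ := hF.shift M hM
        exact h N hN (h' e he f hf hx)
  exact key n e f he hf h hp

theorem not_near_orb {e z : ℕ} (n : ℕ) (he : e < 16) (hz : z < 8)
    (h : ∀ M ∈ F, ¬ M.near e z) : ∀ M ∈ F, ∀ p ∈ orb (e, z) shiftE shiftV n,
      p.1 < 16 ∧ p.2 < 8 ∧ ¬ M.near p.1 p.2 := by
  intro M hM p hp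
  have key : ∀ n e z, e < 16 → z < 8 → (∀ M ∈ F, ¬ M.near e z) →
      p ∈ orb (e, z) shiftE shiftV n → p.1 < 16 ∧ p.2 < 8 ∧ ¬ M.near p.1 p.2 := by
    clear h he hz hp
    intro n
    induction n with
    | zero => intro e f _ _ _ hp; cases hp
    | succ n ih =>
      intro e z he hz h hp
      rcases List.mem_cons.1 hp with rfl | hp
      · exact ⟨he, hz, h M hM⟩
      · refine ih _ _ (shiftE_lt' he) (shiftV_lt z) (fun M hM hx => ?_) hp
        obtain ⟨N, hN, -, h'⟩ := hF.shift M hM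
        exact h N hN (h' e he z hz hx)
  exact key n e z he hz h hp

omit hF in
theorem orb_lt {e f : ℕ} (n : ℕ) (he : e < 24) (hf : f < 24) :
    ∀ p ∈ orb (e, f) shiftE shiftE n, p.1 < 24 ∧ p.2 < 24 := by
  induction n generalizing e f with
  | zero => intro p hp; cases hp
  | succ n ih =>
    intro p hp
    rcases List.mem_cons.1 hp with rfl | hp
    · exact ⟨he, hf⟩
    · exact ih (shiftE_lt he) (shiftE_lt hf) p hp

theorem not_fact_crossOrbit {e f : ℕ} (he : e < 24) (hf : f < 24)
    (h : ∀ M ∈ F, ¬ M.cross e f) (M : Model) (hM : M ∈ F) (i : ℕ)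
    (hi : (crossOrbit e f).testBit i = true) : ¬ M.Fact i := by
  have h' : ∀ M ∈ F, ¬ M.cross (reflE e) (reflE f) := by
    intro M hM hx
    obtain ⟨N, hN, h', -⟩ := hF.refl M hM
    exact h N hN (h' _ he _ hf hx)
  rw [crossOrbit] at hi
  obtain ⟨m, hm, hi⟩ := exists_testBit_of_mask hi
  obtain ⟨p, hp, rfl⟩ := List.mem_map.1 hm
  have hx : p.1 < 24 ∧ p.2 < 24 ∧ ¬ M.cross p.1 p.2 := by
    rcases List.mem_append.1 hp with hp | hp
    · exact ⟨(orb_lt 8 he hf p hp).1, (orb_lt 8 he hf p hp).2,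
        hF.not_cross_orb 8 he hf h M hM p hp⟩
    · exact ⟨(orb_lt 8 (reflE_lt he) (reflE_lt hf) p hp).1,
        (orb_lt 8 (reflE_lt he) (reflE_lt hf) p hp).2,
        hF.not_cross_orb 8 (reflE_lt he) (reflE_lt hf) h' M hM p hp⟩
  obtain ⟨h1, h2, hx⟩ := hx
  have h3 : Nat.lor (crossBit p.1 p.2) (crossBit p.2 p.1) =
    crossBit p.1 p.2 ||| crossBit p.2 p.1 := rfl
  rw [h3, Nat.testBit_or, Bool.or_eq_true] at hi
  rcases hi with hi | hi
  · rw [← eq_of_testBit_pow hi]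
    exact fun hc => hx ((Model.fact_cross h2).1 hc)
  · rw [← eq_of_testBit_pow hi]
    exact fun hc => hx ((hF.lawful M hM).cross_symm _ _ ((Model.fact_cross h1).1 hc))

theorem not_fact_nearOrbit {e z : ℕ} (he : e < 16) (hz : z < 8)
    (h : ∀ M ∈ F, ¬ M.near e z) (M : Model) (hM : M ∈ F) (i : ℕ)
    (hi : (nearOrbit e z).testBit i = true) : ¬ M.Fact i := by
  have h' : ∀ M ∈ F, ¬ M.near (reflE e) (reflV z) := by
    intro M hM hx
    obtain ⟨N, hN, -, h'⟩ := hF.refl M hM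
    exact h N hN (h' _ he _ hz hx)
  rw [nearOrbit] at hi
  obtain ⟨m, hm, hi⟩ := exists_testBit_of_mask hi
  obtain ⟨p, hp, rfl⟩ := List.mem_map.1 hm
  have hx : p.1 < 16 ∧ p.2 < 8 ∧ ¬ M.near p.1 p.2 := by
    rcases List.mem_append.1 hp with hp | hp
    · exact hF.not_near_orb 8 he hz h M hM p hp
    · exact hF.not_near_orb 8 (reflE_lt' he) (reflV_lt z) h' M hM p hp
  obtain ⟨h1, h2, hx⟩ := hx
  rw [nearBit] at hi
  rw [← eq_of_testBit_pow hi]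
  exact fun hc => hx ((Model.holds_nearBit h1 h2).1 (by rw [nearBit]; exact Model.holds_pow.2 hc))

/-- None of the facts in `d` holds in any model of the family. -/
def Dead (F : Set Model) (d : ℕ) : Prop := ∀ M ∈ F, ∀ i, d.testBit i = true → ¬ M.Fact i

omit hF in
theorem Dead.lor {d d' : ℕ} (h : Dead F d) (h' : Dead F d') : Dead F (Nat.lor d d') := by
  intro M hM i hi
  have h3 : Nat.lor d d' = d ||| d' := rfl
  rw [h3, Nat.testBit_or, Bool.or_eq_true] at hi
  exact hi.elim (h M hM i) (h' M hM i)

theorem exists_goal {dead start : ℕ} {assm : List (ℕ × ℕ)} {goals : List ℕ} {cl : Bool}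
    {order : List ℕ} (hd : Dead F dead) (h : SearchSucceeds dead start assm goals cl order)
    {M : Model} (hM : M ∈ F) (h01 : M.sgn 0 1) (hs : M.Holds start)
    (ha : ∀ p ∈ assm, M.Arc p.1 p.2) : ∃ m ∈ goals, M.Holds m :=
  Model.search_sound (hF.lawful M hM) h01 ha (hd M hM) h.1 hs h.2

theorem holds_crossPair {M : Model} (hM : M ∈ F) {e f : ℕ} (he : e < 24) (hf : f < 24)
    (h : M.cross e f) : M.Holds (crossPair e f) := by
  rw [crossPair]
  exact Model.holds_lor.2 ⟨(Model.holds_crossBit hf).2 h,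
    (Model.holds_crossBit he).2 ((hF.lawful M hM).cross_symm _ _ h)⟩

theorem not_cross_spoke {dead e z : ℕ} {gs : List ℕ} {cl : Bool} {order : List ℕ}
    (hd : Dead F dead) (he : e < 16) (hz : z < 8)
    (h : SearchSucceeds dead (crossPair e (16 + z)) [(e, z)] gs cl order)
    (hgs : ∀ M ∈ F, ∀ m ∈ gs, ¬ M.Holds m) : ∀ M ∈ F, ¬ M.cross e (16 + z) := by
  intro M hM hx
  obtain ⟨N, hN, h01, hc, -⟩ := hF.orient M hM
  rw [← hc] at hx
  obtain ⟨m, hm, hm'⟩ := hF.exists_goal hd h hN h01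
    (hF.holds_crossPair hN (by omega) (by omega) hx)
    (by rintro p hp; obtain rfl := List.mem_singleton.1 hp
        exact (hF.lawful N hN).arc_of_cross e he z hz hx)
  exact hgs N hN m hm hm'

theorem not_near {dead e z : ℕ} {gs : List ℕ} {cl : Bool} {order : List ℕ}
    (hd : Dead F dead) (he : e < 16) (hz : z < 8)
    (h : SearchSucceeds dead (nearBit e z) [(e, z)] gs cl order)
    (hgs : ∀ M ∈ F, ∀ m ∈ gs, ¬ M.Holds m) : ∀ M ∈ F, ¬ M.near e z := by
  intro M hM hx
  obtain ⟨N, hN, h01, -, hc⟩ := hF.orient M hM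
  rw [← hc] at hx
  obtain ⟨m, hm, hm'⟩ := hF.exists_goal hd h hN h01 ((Model.holds_nearBit he hz).2 hx)
    (by rintro p hp; obtain rfl := List.mem_singleton.1 hp
        exact (hF.lawful N hN).arc_of_near e he z hz hx)
  exact hgs N hN m hm hm'

theorem holds_midBit {M : Model} (hM : M ∈ F) {j : ℕ} (hj : j < 8) :
    M.Holds (midBit j) ↔ M.cross (midEdge j) (16 + j) := by
  rw [midBit, Model.holds_lor, Model.holds_crossBit (by omega),
    Model.holds_crossBit (by unfold midEdge; omega)]
  exact ⟨And.left, fun h => ⟨h, (hF.lawful M hM).cross_symm _ _ h⟩⟩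

theorem lor_crossOrbit {d e f : ℕ} (hd : Dead F d) (he : e < 24) (hf : f < 24)
    (h : ∀ M ∈ F, ¬ M.cross e f) : Dead F (Nat.lor d (crossOrbit e f)) :=
  hd.lor fun M hM i hi => hF.not_fact_crossOrbit he hf h M hM i hi

theorem lor_nearOrbit {d e z : ℕ} (hd : Dead F d) (he : e < 16) (hz : z < 8)
    (h : ∀ M ∈ F, ¬ M.near e z) : Dead F (Nat.lor d (nearOrbit e z)) :=
  hd.lor fun M hM i hi => hF.not_fact_nearOrbit he hz h M hM i hi

theorem dead_deadCross_8_21 : Dead F deadCross_8_21 := by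
  have d0 : Dead F 0 := by simp [Dead]
  have d1 : Dead F deadCross_0_20 := by
    unfold deadCross_0_20
    exact fun M hM i hi => hF.not_fact_crossOrbit (by omega) (by omega)
      (hF.not_cross_spoke d0 (by omega) (by omega) search_cross_0_20 (by simp)) M hM i hi
  have d2 : Dead F deadCross_8_20 := by
    unfold deadCross_8_20
    exact hF.lor_crossOrbit d1 (by omega) (by omega)
      (hF.not_cross_spoke d1 (by omega) (by omega) search_cross_8_20 (by simp))
  have d3 : Dead F deadCross_8_19 := by
    unfold deadCross_8_19
    exact hF.lor_crossOrbit d2 (by omega) (by omega)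
      (hF.not_cross_spoke d2 (by omega) (by omega) search_cross_8_19 (by simp))
  have d4 : Dead F deadCross_0_18 := by
    unfold deadCross_0_18
    exact hF.lor_crossOrbit d3 (by omega) (by omega)
      (hF.not_cross_spoke d3 (by omega) (by omega) search_cross_0_18 (by simp))
  have d5 : Dead F deadCross_0_19 := by
    unfold deadCross_0_19
    exact hF.lor_crossOrbit d4 (by omega) (by omega)
      (hF.not_cross_spoke d4 (by omega) (by omega) search_cross_0_19 (by simp))
  unfold deadCross_8_21
  exact hF.lor_crossOrbit d5 (by omega) (by omega)
    (hF.not_cross_spoke d5 (by omega) (by omega) search_cross_8_21 (by simp))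

/-- The configurations in `bans` do not occur: the search reduces one of them to the spurious
goals, and the others are its rotations. -/
theorem not_three_mids : ∀ j < 8, ∀ M ∈ F, ¬ (M.cross (midEdge j) (16 + j) ∧
    M.cross (midEdge ((j + 3) % 8)) (16 + (j + 3) % 8) ∧
    M.cross (midEdge ((j + 5) % 8)) (16 + (j + 5) % 8)) := by
  intro j
  induction j with
  | zero =>
    rintro - M hM ⟨h0, h3, h5⟩
    obtain ⟨N, hN, h01, hc, -⟩ := hF.orient M hM
    rw [← hc] at h0 h3 h5
    obtain ⟨m, hm, hm'⟩ := hF.exists_goal hF.dead_deadCross_8_21 search_spurious hN h01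
      (by
        simp only [Model.holds_mask, List.forall_mem_cons, List.not_mem_nil, false_imp_iff,
          imp_true_iff, and_true]
        exact ⟨(hF.holds_midBit hN (by omega)).2 h0, (hF.holds_midBit hN (by omega)).2 h3,
          (hF.holds_midBit hN (by omega)).2 h5⟩)
      (by
        simp only [List.forall_mem_cons, List.not_mem_nil, false_imp_iff, imp_true_iff, and_true]
        exact ⟨(hF.lawful N hN).arc_of_cross _ (by decide) _ (by omega) h0,
          (hF.lawful N hN).arc_of_cross _ (by decide) _ (by omega) h3,
          (hF.lawful N hN).arc_of_cross _ (by decide) _ (by omega) h5⟩)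
    exact hF.not_spurious N hN h0 h3 h5 m hm hm'
  | succ j ih =>
    rintro hj M hM h
    obtain ⟨N, hN, hs, -⟩ := hF.shift M hM
    have key : ∀ i < 8, M.cross (midEdge ((i + 1) % 8)) (16 + (i + 1) % 8) →
        N.cross (midEdge i) (16 + i) := by
      intro i hi h
      refine hs _ (by unfold midEdge; omega) _ (by omega) ?_
      have : shiftE (midEdge i) = midEdge ((i + 1) % 8) ∧ shiftE (16 + i) = 16 + (i + 1) % 8 := by
        interval_cases i <;> decide
      rwa [this.1, this.2]
    refine ih (by omega) N hN ⟨key _ (by omega) ?_, key _ (by omega) ?_, key _ (by omega) ?_⟩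
    · rw [Nat.mod_eq_of_lt hj]; exact h.1
    · rw [show ((j + 3) % 8 + 1) % 8 = (j + 1 + 3) % 8 by omega]; exact h.2.1
    · rw [show ((j + 5) % 8 + 1) % 8 = (j + 1 + 5) % 8 by omega]; exact h.2.2

theorem not_holds_bans : ∀ M ∈ F, ∀ m ∈ bans, ¬ M.Holds m := by
  intro M hM m hm h
  obtain ⟨j, hj, rfl⟩ := List.mem_map.1 hm
  rw [List.mem_range] at hj
  rw [Model.holds_mask] at h
  refine hF.not_three_mids j hj M hM ⟨?_, ?_, ?_⟩
  · exact (hF.holds_midBit hM hj).1 (h _ (by simp))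
  · exact (hF.holds_midBit hM (by omega)).1 (h _ (by simp))
  · exact (hF.holds_midBit hM (by omega)).1 (h _ (by simp))

theorem dead_deadCross_8_9 : Dead F deadCross_8_9 := by
  have hb := hF.not_holds_bans
  have d7 : Dead F deadNear_0_4 := by
    unfold deadNear_0_4
    exact hF.lor_nearOrbit hF.dead_deadCross_8_21 (by omega) (by omega)
      (hF.not_near hF.dead_deadCross_8_21 (by omega) (by omega) search_near_0_4 hb)
  have d8 : Dead F deadNear_0_3 := by
    unfold deadNear_0_3
    exact hF.lor_nearOrbit d7 (by omega) (by omega)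
      (hF.not_near d7 (by omega) (by omega) search_near_0_3 hb)
  have d9 : Dead F deadNear_0_2 := by
    unfold deadNear_0_2
    exact hF.lor_nearOrbit d8 (by omega) (by omega)
      (hF.not_near d8 (by omega) (by omega) search_near_0_2 hb)
  unfold deadCross_8_9
  refine hF.lor_crossOrbit d9 (by omega) (by omega) ?_
  intro M hM hx
  obtain ⟨N, hN, h01, hc, -⟩ := hF.orient M hM
  rw [← hc] at hx
  obtain ⟨m, hm, hm'⟩ := hF.exists_goal d9 search_cross_8_9 hN h01
    (hF.holds_crossPair hN (by omega) (by omega) hx) (by simp)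
  exact hb N hN m hm hm'

/-- The vertices are in counterclockwise order along the zigzag, and the spokes of one of the two
squares cross the edges of the other one. -/
theorem nested_squares {M : Model} (hM : M ∈ F) (h01 : M.sgn 0 1) :
    (∀ j < 8, M.sgn j ((j + 1) % 8)) ∧
    ((∀ j < 8, j % 2 = 1 → M.cross (midEdge j) (16 + j)) ∨
      (∀ j < 8, j % 2 = 0 → M.cross (midEdge j) (16 + j))) := by
  obtain ⟨m, hm, hm'⟩ := hF.exists_goal hF.dead_deadCross_8_9 search_final hM h01
    Model.holds_zero (by simp)
  rcases List.mem_append.1 hm with hm | hm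
  · have key : ∀ l : List ℕ, (∀ j ∈ l, j < 8) →
        M.Holds (goalMask l) →
        (∀ j < 8, M.sgn j ((j + 1) % 8)) ∧ ∀ j ∈ l, M.cross (midEdge j) (16 + j) := by
      intro l hl h
      rw [goalMask, Model.holds_mask] at h
      refine ⟨fun j hj => (Model.holds_signBit (by omega) hj).1 (h _ ?_), fun j hj =>
        (hF.holds_midBit hM (hl j hj)).1 (h _ ?_)⟩
      · exact List.mem_append_right _ (List.mem_map.2 ⟨j, List.mem_range.2 hj, rfl⟩)
      · exact List.mem_append_left _ (List.mem_map_of_mem hj)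
    rcases List.mem_cons.1 hm with rfl | hm
    · obtain ⟨h1, h2⟩ := key [1, 3, 5, 7] (by simp) hm'
      refine ⟨h1, .inl fun j hj hj' => h2 j ?_⟩
      interval_cases j <;> simp at hj' ⊢
    · rw [List.mem_singleton] at hm
      subst hm
      obtain ⟨h1, h2⟩ := key [0, 2, 4, 6] (by simp) hm'
      refine ⟨h1, .inr fun j hj hj' => h2 j ?_⟩
      interval_cases j <;> simp at hj' ⊢
  · exact absurd hm' (hF.not_holds_bans M hM m hm)

end IsFamily
end RACSearch

/-! ### Signed areas and crossings in RAC drawings -/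

namespace Plane

theorem inner_eq (x y : Plane) : inner ℝ x y = x 0 * y 0 + x 1 * y 1 := by
  simp [PiLp.inner_apply, Fin.sum_univ_two, mul_comm]

theorem ext_iff' {x y : Plane} : x = y ↔ x 0 = y 0 ∧ x 1 = y 1 := by
  constructor
  · rintro rfl; exact ⟨rfl, rfl⟩
  · rintro ⟨h0, h1⟩
    ext i; fin_cases i
    · exact h0
    · exact h1

theorem sq_add_sq_pos {x : Plane} (hx : x ≠ 0) : 0 < x 0 ^ 2 + x 1 ^ 2 := by
  by_contra h
  apply hx
  rw [ext_iff']
  simp only [PiLp.zero_apply]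
  constructor <;> nlinarith [sq_nonneg (x 0), sq_nonneg (x 1)]

theorem det_ne_zero_of_inner_eq_zero {x y : Plane} (hx : x ≠ 0) (hy : y ≠ 0)
    (h : inner ℝ x y = 0) : det x y ≠ 0 := by
  intro h'
  rw [inner_eq] at h
  rw [det] at h'
  have h1 := mul_pos (sq_add_sq_pos hx) (sq_add_sq_pos hy)
  nlinarith [show (x 0 ^ 2 + x 1 ^ 2) * (y 0 ^ 2 + y 1 ^ 2) =
    (x 0 * y 0 + x 1 * y 1) ^ 2 + (x 0 * y 1 - x 1 * y 0) ^ 2 by ring]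

/-- Vectors of the same direction: one of the two segments that start at the origin contains the
tip of the other. -/
theorem mem_segment_of_det_eq_zero {x y : Plane} (h : det x y = 0) (h' : 0 ≤ inner ℝ x y)
    (hx : x ≠ 0) (hy : y ≠ 0) : x ∈ segment ℝ 0 y ∨ y ∈ segment ℝ 0 x := by
  have key : ∀ x y : Plane, det x y = 0 → 0 ≤ inner ℝ x y → x ≠ 0 → y ≠ 0 →
      x 0 ^ 2 + x 1 ^ 2 ≤ y 0 ^ 2 + y 1 ^ 2 → x ∈ segment ℝ 0 y := by
    intro x y h h' hx hy hxy
    rw [inner_eq] at h'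
    rw [det] at h
    have h2 := sq_add_sq_pos hy
    set t := (x 0 * y 0 + x 1 * y 1) / (y 0 ^ 2 + y 1 ^ 2) with ht
    have ht' : t * (y 0 ^ 2 + y 1 ^ 2) = x 0 * y 0 + x 1 * y 1 := by
      rw [ht]; field_simp
    have ht0 : 0 ≤ t := div_nonneg h' h2.le
    have e0 : x 0 = t * y 0 := by
      have : (y 0 ^ 2 + y 1 ^ 2) * (x 0 - t * y 0) = 0 := by
        linear_combination (-y 0) * ht' + y 1 * h
      have := (mul_eq_zero.1 this).resolve_left h2.ne'
      linarith
    have e1 : x 1 = t * y 1 := by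
      have : (y 0 ^ 2 + y 1 ^ 2) * (x 1 - t * y 1) = 0 := by
        linear_combination (-y 1) * ht' - y 0 * h
      have := (mul_eq_zero.1 this).resolve_left h2.ne'
      linarith
    have ht1 : t ≤ 1 := by
      rw [e0, e1] at hxy
      by_contra hc
      push Not at hc
      nlinarith [mul_pos (sub_pos.2 hc) h2,
        mul_pos (mul_pos (sub_pos.2 hc) h2) (by linarith : 0 < t)]
    refine ⟨1 - t, t, by linarith, ht0, by ring, ?_⟩
    rw [ext_iff']
    simp [e0, e1]
  rcases le_total (x 0 ^ 2 + x 1 ^ 2) (y 0 ^ 2 + y 1 ^ 2) with hxy | hxy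
  · exact .inl (key x y h h' hx hy hxy)
  · refine .inr (key y x ?_ ?_ hy hx hxy)
    · rw [det] at h ⊢; linarith
    · rw [real_inner_comm]; exact h'

/-- Two segments cross if the end points of each lie strictly on opposite sides of the line through
the other. -/
theorem openSegment_inter_nonempty {a b c d : Plane}
    (h1 : det (b - a) (c - a) * det (b - a) (d - a) < 0)
    (h2 : det (d - c) (a - c) * det (d - c) (b - c) < 0) :
    (openSegment ℝ a b ∩ openSegment ℝ c d).Nonempty := by
  have key : ∀ u v : ℝ, u * v < 0 → u - v ≠ 0 ∧ 0 < u / (u - v) ∧ u / (u - v) < 1 := by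
    intro u v h
    rcases mul_neg_iff.1 h with ⟨hu, hv⟩ | ⟨hu, hv⟩
    · have : 0 < u - v := by linarith
      exact ⟨this.ne', div_pos hu this, by rw [div_lt_one this]; linarith⟩
    · have : u - v < 0 := by linarith
      refine ⟨this.ne, div_pos_of_neg_of_neg hu this, ?_⟩
      rw [div_lt_one_of_neg this]; linarith
  obtain ⟨n1, p1, q1⟩ := key _ _ h1
  obtain ⟨n2, p2, q2⟩ := key _ _ h2
  set t := det (b - a) (c - a) / (det (b - a) (c - a) - det (b - a) (d - a)) with ht
  set s := det (d - c) (a - c) / (det (d - c) (a - c) - det (d - c) (b - c)) with hs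
  have ht' : t * (det (b - a) (c - a) - det (b - a) (d - a)) = det (b - a) (c - a) := by
    rw [ht]; field_simp
  have hs' : s * (det (d - c) (a - c) - det (d - c) (b - c)) = det (d - c) (a - c) := by
    rw [hs]; field_simp
  refine ⟨(1 - s) • a + s • b, ⟨1 - s, s, by linarith, p2, by ring, rfl⟩,
    ⟨1 - t, t, by linarith, p1, by ring, ?_⟩⟩
  have hD : det (b - a) (c - a) - det (b - a) (d - a) ≠ 0 := n1
  rw [ext_iff']
  clear_value s t
  simp only [det, PiLp.sub_apply, PiLp.add_apply, PiLp.smul_apply, smul_eq_mul] at *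
  constructor
  · apply mul_left_cancel₀ hD
    linear_combination (d 0 - c 0) * ht' + (b 0 - a 0) * hs'
  · apply mul_left_cancel₀ hD
    linear_combination (d 1 - c 1) * ht' + (b 1 - a 1) * hs'

theorem det_mul_det_neg_of_inter {a b c d : Plane} (hD : det (b - a) (d - c) ≠ 0)
    (h : (openSegment ℝ a b ∩ openSegment ℝ c d).Nonempty) :
    det (b - a) (c - a) * det (b - a) (d - a) < 0 := by
  obtain ⟨p, ⟨s', s, hs', hs, hss, rfl⟩, ⟨t', t, ht', ht, htt, h⟩⟩ := h
  rw [ext_iff'] at h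
  obtain rfl : s' = 1 - s := by linarith
  obtain rfl : t' = 1 - t := by linarith
  simp only [det, PiLp.sub_apply, PiLp.add_apply, PiLp.smul_apply, smul_eq_mul] at *
  have hD2 := sq_pos_of_ne_zero hD
  set D := (b 0 - a 0) * (d 1 - c 1) - (b 1 - a 1) * (d 0 - c 0) with hDdef
  have e1 : (b 0 - a 0) * (c 1 - a 1) - (b 1 - a 1) * (c 0 - a 0) = - t * D := by
    rw [hDdef]; linear_combination (b 0 - a 0) * h.2 - (b 1 - a 1) * h.1
  have e2 : (b 0 - a 0) * (d 1 - a 1) - (b 1 - a 1) * (d 0 - a 0) = (1 - t) * D := by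
    rw [hDdef]; linear_combination (b 0 - a 0) * h.2 - (b 1 - a 1) * h.1
  rw [e1, e2]
  nlinarith [mul_pos (mul_pos ht ht') hD2]

end Plane

section RAC
variable {V : Type*} {G : SimpleGraph V} {p : V → Plane}

theorem EdgesCross.symm {u v x y : V} (h : EdgesCross p u v x y) : EdgesCross p x y u v :=
  ⟨h.1.symm, by rw [inter_comm]; exact h.2⟩

theorem edgesCross_comm {u v x y : V} : EdgesCross p u v x y ↔ EdgesCross p x y u v :=
  ⟨EdgesCross.symm, EdgesCross.symm⟩

theorem edgesCross_swap_left {u v x y : V} : EdgesCross p u v x y ↔ EdgesCross p v u x y := by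
  rw [EdgesCross, EdgesCross, openSegment_symm ℝ (p u), Sym2.eq_swap (a := u)]

theorem edgesCross_swap_right {u v x y : V} : EdgesCross p u v x y ↔ EdgesCross p u v y x := by
  rw [EdgesCross, EdgesCross, openSegment_symm ℝ (p x), Sym2.eq_swap (a := x)]

namespace IsStraightLineDrawing
variable (hp : IsStraightLineDrawing G p)
include hp

theorem sub_ne_zero {u v : V} (h : u ≠ v) : p u - p v ≠ 0 :=
  _root_.sub_ne_zero.2 fun h' => h (hp.injective h')

/-- Two edges with a common end point do not leave it in the same direction. -/
theorem inner_neg_of_det_eq_zero {u v w : V} (huv : G.Adj u v) (huw : G.Adj u w) (hvw : v ≠ w)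
    (h : Plane.det (p v - p u) (p w - p u) = 0) : inner ℝ (p v - p u) (p w - p u) < 0 := by
  by_contra hc
  push Not at hc
  rcases Plane.mem_segment_of_det_eq_zero h hc (hp.sub_ne_zero huv.ne') (hp.sub_ne_zero huw.ne')
    with h | h
  · refine hp.notMem_segment u w v huw huv.ne' hvw ?_
    rw [← sub_self (p u)] at h
    simpa using (mem_segment_translate ℝ (p u)).2 h
  · refine hp.notMem_segment u v w huv huw.ne' hvw.symm ?_
    rw [← sub_self (p u)] at h
    simpa using (mem_segment_translate ℝ (p u)).2 h

theorem not_edgesCross_of_common {u v w : V} (huv : G.Adj u v) (huw : G.Adj u w) :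
    ¬ EdgesCross p u v u w := by
  rintro ⟨hne, z, ⟨s', s, hs', hs, hss, rfl⟩, ⟨t', t, ht', ht, htt, h⟩⟩
  have hvw : v ≠ w := fun h => hne (by rw [h])
  rw [Plane.ext_iff'] at h
  obtain rfl : s' = 1 - s := by linarith
  obtain rfl : t' = 1 - t := by linarith
  have h1 := hp.inner_neg_of_det_eq_zero huv huw hvw
  have h2 := Plane.sq_add_sq_pos (hp.sub_ne_zero huv.ne')
  simp only [Plane.inner_eq, Plane.det, PiLp.sub_apply, PiLp.add_apply, PiLp.smul_apply,
    smul_eq_mul] at *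
  have e0 : t * (p w 0 - p u 0) = s * (p v 0 - p u 0) := by linear_combination h.1
  have e1 : t * (p w 1 - p u 1) = s * (p v 1 - p u 1) := by linear_combination h.2
  have h3 : (p v 0 - p u 0) * (p w 1 - p u 1) - (p v 1 - p u 1) * (p w 0 - p u 0) = 0 := by
    apply mul_left_cancel₀ ht.ne'
    linear_combination (p v 0 - p u 0) * e1 - (p v 1 - p u 1) * e0
  have h4 := h1 h3
  have h5 : t * ((p v 0 - p u 0) * (p w 0 - p u 0) + (p v 1 - p u 1) * (p w 1 - p u 1)) =
      s * ((p v 0 - p u 0) ^ 2 + (p v 1 - p u 1) ^ 2) := by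
    linear_combination (p v 0 - p u 0) * e0 + (p v 1 - p u 1) * e1
  nlinarith [mul_pos hs h2, mul_pos_of_neg_of_neg h4 (neg_neg_of_pos ht)]

end IsStraightLineDrawing

namespace IsRACDrawing
variable (hp : IsRACDrawing G p)
include hp

theorem det_ne_zero {u v x y : V} (huv : G.Adj u v) (hxy : G.Adj x y)
    (h : EdgesCross p u v x y) : Plane.det (p v - p u) (p y - p x) ≠ 0 :=
  Plane.det_ne_zero_of_inner_eq_zero (hp.sub_ne_zero huv.ne') (hp.sub_ne_zero hxy.ne')
    (hp.right_angle u v x y huv hxy h)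

theorem det_mul_det_neg {u v x y : V} (huv : G.Adj u v) (hxy : G.Adj x y)
    (h : EdgesCross p u v x y) :
    Plane.det (p v - p u) (p x - p u) * Plane.det (p v - p u) (p y - p u) < 0 :=
  Plane.det_mul_det_neg_of_inter (hp.det_ne_zero huv hxy h) h.2

/-- No edge crosses two edges that have a common end point. -/
theorem not_edgesCross_fan {u v x y z : V} (huv : G.Adj u v) (hxy : G.Adj x y) (hxz : G.Adj x z)
    (hyz : y ≠ z) (h : EdgesCross p u v x y) : ¬ EdgesCross p u v x z := by
  intro h'
  have a1 := hp.right_angle u v x y huv hxy h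
  have a2 := hp.right_angle u v x z huv hxz h'
  have b1 := hp.det_mul_det_neg huv hxy h
  have b2 := hp.det_mul_det_neg huv hxz h'
  have c := hp.inner_neg_of_det_eq_zero hxy hxz hyz
  have d := Plane.sq_add_sq_pos (hp.sub_ne_zero huv.ne')
  simp only [Plane.inner_eq, Plane.det, PiLp.sub_apply] at *
  set n0 := p v 0 - p u 0
  set n1 := p v 1 - p u 1
  set y0 := p y 0 - p x 0 with hy0
  set y1 := p y 1 - p x 1 with hy1
  set z0 := p z 0 - p x 0 with hz0
  set z1 := p z 1 - p x 1 with hz1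
  have key : (n0 ^ 2 + n1 ^ 2) * (y0 * z1 - y1 * z0) = 0 := by
    linear_combination (n0 * z1 - n1 * z0) * a1 - (n0 * y1 - n1 * y0) * a2
  have c' := c ((mul_eq_zero.1 key).resolve_left d.ne')
  have e : (n0 ^ 2 + n1 ^ 2) * (y0 * z0 + y1 * z1) = (n0 * y1 - n1 * y0) * (n0 * z1 - n1 * z0) := by
    linear_combination (n0 * z0 + n1 * z1) * a1
  set X := n0 * (p x 1 - p u 1) - n1 * (p x 0 - p u 0) with hX
  have f1 : n0 * (p y 1 - p u 1) - n1 * (p y 0 - p u 0) = X + (n0 * y1 - n1 * y0) := by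
    rw [hX, hy0, hy1]; ring
  have f2 : n0 * (p z 1 - p u 1) - n1 * (p z 0 - p u 0) = X + (n0 * z1 - n1 * z0) := by
    rw [hX, hz0, hz1]; ring
  rw [f1] at b1
  rw [f2] at b2
  have g : (n0 * y1 - n1 * y0) * (n0 * z1 - n1 * z0) < 0 := by
    rw [← e]; exact mul_neg_of_pos_of_neg d c'
  generalize n0 * y1 - n1 * y0 = A at *
  generalize n0 * z1 - n1 * z0 = B at *
  have hA : X * A < 0 := by nlinarith only [b1, sq_nonneg X]
  have hB : X * B < 0 := by nlinarith only [b2, sq_nonneg X]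
  nlinarith only [mul_pos_of_neg_of_neg hA hB, mul_nonneg (sq_nonneg X) (neg_nonneg.2 g.le)]

/-- No three edges cross pairwise. -/
theorem not_edgesCross_triangle {u v x y z w : V} (huv : G.Adj u v) (hxy : G.Adj x y)
    (hzw : G.Adj z w) (h1 : EdgesCross p u v x y) (h2 : EdgesCross p u v z w) :
    ¬ EdgesCross p x y z w := by
  intro h3
  have a1 := hp.right_angle u v x y huv hxy h1
  have a2 := hp.right_angle u v z w huv hzw h2
  have a3 := hp.right_angle x y z w hxy hzw h3
  have d1 := Plane.sq_add_sq_pos (hp.sub_ne_zero huv.ne')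
  have d2 := Plane.det_ne_zero_of_inner_eq_zero (hp.sub_ne_zero hxy.ne') (hp.sub_ne_zero hzw.ne') a3
  rw [Plane.inner_eq] at a1 a2
  apply d2
  apply mul_left_cancel₀ d1.ne'
  simp only [Plane.det] at *
  linear_combination ((p v - p u) 0 * (p w - p z) 1 - (p v - p u) 1 * (p w - p z) 0) * a1 -
    ((p v - p u) 0 * (p y - p x) 1 - (p v - p u) 1 * (p y - p x) 0) * a2

end IsRACDrawing
end RAC

/-! ### Near and far points of an angle -/

namespace Plane

/-- The direction `w` is strictly between the directions `a` and `b`, in the angle smaller than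
`π`. -/
def Cone (a b w : Plane) : Prop :=
  (0 < det a b ∧ 0 < det a w ∧ 0 < det w b) ∨ (0 < det b a ∧ 0 < det b w ∧ 0 < det w a)

/-- The point `w` lies in the interior of the triangle with the vertices `0`, `a`, `b`. -/
def Near (a b w : Plane) : Prop :=
  (0 < det a w ∧ 0 < det w b ∧ det a w + det w b < det a b) ∨
    (0 < det b w ∧ 0 < det w a ∧ det b w + det w a < det b a)

/-- The point `w` lies in the angle between `a` and `b`, beyond the line through `a` and `b`. -/
def Far (a b w : Plane) : Prop :=
  (0 < det a b ∧ 0 < det a w ∧ 0 < det w b ∧ det a b < det a w + det w b) ∨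
    (0 < det b a ∧ 0 < det b w ∧ 0 < det w a ∧ det b a < det b w + det w a)

theorem Near.swap {a b w : Plane} (h : Near a b w) : Near b a w := h.symm
theorem Far.swap {a b w : Plane} (h : Far a b w) : Far b a w := h.symm
theorem Near.cone {a b w : Plane} (h : Near a b w) : Cone a b w :=
  h.imp (fun h => ⟨by linarith [h.1, h.2.1, h.2.2], h.1, h.2.1⟩)
    (fun h => ⟨by linarith [h.1, h.2.1, h.2.2], h.1, h.2.1⟩)
theorem Far.cone {a b w : Plane} (h : Far a b w) : Cone a b w :=
  h.imp (fun h => ⟨h.1, h.2.1, h.2.2.1⟩) (fun h => ⟨h.1, h.2.1, h.2.2.1⟩)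

theorem det_comm (a b : Plane) : det a b = - det b a := by simp only [det]; ring

theorem mem_segment_of_det {a b x : Plane} (h1 : 0 < det a b) (h2 : 0 ≤ det a x)
    (h3 : 0 ≤ det x b) (h4 : det a x + det x b = det a b) : x ∈ segment ℝ a b := by
  refine ⟨det x b / det a b, det a x / det a b, by positivity, by positivity,
    by rw [← add_div, add_comm, h4]; field_simp, ?_⟩
  have hx : det x b • a + det a x • b = det a b • x := by
    rw [ext_iff']
    simp only [det, PiLp.add_apply, PiLp.smul_apply, smul_eq_mul]
    constructor <;> ring
  rw [div_eq_inv_mul, div_eq_inv_mul, ← smul_smul, ← smul_smul, ← smul_add, hx, smul_smul,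
    inv_mul_cancel₀ h1.ne', one_smul]

/-- If the directions `a`, `c`, `b`, `d` are in counterclockwise order, `c` lies on the near side
of the segment from `a` to `b`, and `b` lies on the near side of the segment from `c` to `d`, then
the two segments cross. -/
theorem segments_cross_of_near {a b c d : Plane} (hac : 0 < det a c) (hcb : 0 < det c b)
    (hbd : 0 < det b d) (h1 : det a c + det c b < det a b) (h2 : det c b + det b d < det c d) :
    (openSegment ℝ a b ∩ openSegment ℝ c d).Nonempty := by
  have hab : 0 < det a b := by linarith
  have hcd : 0 < det c d := by linarith
  have e1 : det c b * (det a d + det d b - det a b) = - det b d * (det a c + det c b - det a b) +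
      (det c d - det c b - det b d) * det a b := by
    simp only [det]; ring
  have e2 : det c b * (det c a + det a d - det c d) = - det a c * (det c b + det b d - det c d) +
      (det a b - det c b - det a c) * det c d := by
    simp only [det]; ring
  have f1 : 0 < det a d + det d b - det a b := by
    refine pos_of_mul_pos_right (a := det c b) ?_ hcb.le
    rw [e1]; nlinarith [mul_pos hbd (by linarith : 0 < det a b - (det a c + det c b)),
      mul_pos (by linarith : 0 < det c d - det c b - det b d) hab]
  have f2 : 0 < det c a + det a d - det c d := by
    refine pos_of_mul_pos_right (a := det c b) ?_ hcb.le
    rw [e2]; nlinarith [mul_pos hac (by linarith : 0 < det c d - (det c b + det b d)),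
      mul_pos (by linarith : 0 < det a b - det c b - det a c) hcd]
  refine openSegment_inter_nonempty ?_ ?_
  · have g1 : det (b - a) (c - a) = det a b - (det a c + det c b) := by
      simp only [det, PiLp.sub_apply]; ring
    have g2 : det (b - a) (d - a) = - (det a d + det d b - det a b) := by
      simp only [det, PiLp.sub_apply]; ring
    rw [g1, g2]; nlinarith [mul_pos (by linarith : 0 < det a b - (det a c + det c b)) f1]
  · have g1 : det (d - c) (b - c) = det c d - (det c b + det b d) := by
      simp only [det, PiLp.sub_apply]; ring
    have g2 : det (d - c) (a - c) = - (det c a + det a d - det c d) := by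
      simp only [det, PiLp.sub_apply]; ring
    rw [g1, g2]; nlinarith [mul_pos (by linarith : 0 < det c d - (det c b + det b d)) f2]

theorem segments_cross_of_far {a b c d : Plane} (hac : 0 < det a c) (hcb : 0 < det c b)
    (hbd : 0 < det b d) (hab : 0 < det a b) (hcd : 0 < det c d)
    (h1 : det a b < det a c + det c b) (h2 : det c d < det c b + det b d) :
    (openSegment ℝ a b ∩ openSegment ℝ c d).Nonempty := by
  have e1 : det c b * (det a d + det d b - det a b) = - det b d * (det a c + det c b - det a b) +
      (det c d - det c b - det b d) * det a b := by
    simp only [det]; ring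
  have e2 : det c b * (det c a + det a d - det c d) = - det a c * (det c b + det b d - det c d) +
      (det a b - det c b - det a c) * det c d := by
    simp only [det]; ring
  have f1 : 0 < -(det a d + det d b - det a b) := by
    refine pos_of_mul_pos_right (a := det c b) ?_ hcb.le
    rw [mul_neg, e1]; nlinarith [mul_pos hbd (by linarith : 0 < (det a c + det c b) - det a b),
      mul_pos (by linarith : 0 < -(det c d - det c b - det b d)) hab]
  have f2 : 0 < -(det c a + det a d - det c d) := by
    refine pos_of_mul_pos_right (a := det c b) ?_ hcb.le
    rw [mul_neg, e2]; nlinarith [mul_pos hac (by linarith : 0 < (det c b + det b d) - det c d),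
      mul_pos (by linarith : 0 < -(det a b - det c b - det a c)) hcd]
  refine openSegment_inter_nonempty ?_ ?_
  · have g1 : det (b - a) (c - a) = -((det a c + det c b) - det a b) := by
      simp only [det, PiLp.sub_apply]; ring
    have g2 : det (b - a) (d - a) = - (det a d + det d b - det a b) := by
      simp only [det, PiLp.sub_apply]; ring
    rw [g1, g2]; nlinarith [mul_pos (by linarith : 0 < (det a c + det c b) - det a b) f1]
  · have g1 : det (d - c) (b - c) = -((det c b + det b d) - det c d) := by
      simp only [det, PiLp.sub_apply]; ring
    have g2 : det (d - c) (a - c) = - (det c a + det a d - det c d) := by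
      simp only [det, PiLp.sub_apply]; ring
    rw [g1, g2]; nlinarith [mul_pos (by linarith : 0 < (det c b + det b d) - det c d) f2]

/-- If each of two segments has an end point in the triangle that the other one spans with the
origin, then the segments cross. -/
theorem cross_of_near_near {a b c d : Plane} (h1 : Near a b c) (h2 : Near c d b) :
    (openSegment ℝ a b ∩ openSegment ℝ c d).Nonempty := by
  rcases h1 with ⟨h1, h1', h1''⟩ | ⟨h1, h1', h1''⟩ <;>
    rcases h2 with ⟨h2, h2', h2''⟩ | ⟨h2, h2', h2''⟩
  · exact segments_cross_of_near h1 h1' h2' h1'' h2''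
  · linarith [det_comm b c]
  · linarith [det_comm b c]
  · rw [inter_comm, openSegment_symm ℝ c, openSegment_symm ℝ a]
    exact segments_cross_of_near h2 h2' h1' h2'' h1''

/-- If each of two segments has an end point in the angle of the other one, beyond that segment,
then the segments cross. -/
theorem cross_of_far_far {a b c d : Plane} (h1 : Far a b c) (h2 : Far c d b) :
    (openSegment ℝ a b ∩ openSegment ℝ c d).Nonempty := by
  rcases h1 with ⟨h0, h1, h1', h1''⟩ | ⟨h0, h1, h1', h1''⟩ <;>
    rcases h2 with ⟨h3, h2, h2', h2''⟩ | ⟨h3, h2, h2', h2''⟩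
  · exact segments_cross_of_far h1 h1' h2' h0 h3 h1'' h2''
  · linarith [det_comm b c]
  · linarith [det_comm b c]
  · rw [inter_comm, openSegment_symm ℝ c, openSegment_symm ℝ a]
    exact segments_cross_of_far h2 h2' h1' h3 h0 h2'' h1''

theorem cross_of_far_near_aux {a b c d : Plane} (hab : 0 < det a b) (hac : 0 < det a c)
    (hcb : 0 < det c b) (had : 0 < det a d) (hdb : 0 < det d b)
    (h1 : det a b < det a c + det c b) (h2 : det a d + det d b < det a b) :
    (openSegment ℝ a b ∩ openSegment ℝ c d).Nonempty := by
  set u := det a c + det c b - det a b with hu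
  set v := det a b - (det a d + det d b) with hv
  have hu0 : 0 < u := by linarith
  have hv0 : 0 < v := by linarith
  have e1 : det a (v • c + u • d) = v * det a c + u * det a d := by
    simp only [det, PiLp.add_apply, PiLp.smul_apply, smul_eq_mul]; ring
  have e2 : det (v • c + u • d) b = v * det c b + u * det d b := by
    simp only [det, PiLp.add_apply, PiLp.smul_apply, smul_eq_mul]; ring
  set A := v * det a c + u * det a d with hA
  set B := v * det c b + u * det d b with hB
  have hA0 : 0 < A := by positivity
  have hB0 : 0 < B := by positivity
  have hAB : A + B = (u + v) * det a b := by
    rw [hA, hB, hu, hv]; ring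
  have huv : 0 < u + v := by positivity
  refine ⟨(v / (u + v)) • c + (u / (u + v)) • d, ⟨B / ((u + v) * det a b), A / ((u + v) * det a b),
    by positivity, by positivity, ?_, ?_⟩, ⟨v / (u + v), u / (u + v), by positivity, by positivity,
    by field_simp; ring, rfl⟩⟩
  · rw [← hAB]; field_simp; ring
  · have key : B • a + A • b = det a b • (v • c + u • d) := by
      rw [← e1, ← e2, ext_iff']
      simp only [det, PiLp.add_apply, PiLp.smul_apply, smul_eq_mul]
      constructor <;> ring
    have h3 : (v / (u + v)) • c + (u / (u + v)) • d = (u + v)⁻¹ • (v • c + u • d) := by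
      rw [smul_add, smul_smul, smul_smul, div_eq_inv_mul, div_eq_inv_mul]
    have h4 : (B / ((u + v) * det a b)) • a + (A / ((u + v) * det a b)) • b =
        ((u + v) * det a b)⁻¹ • (B • a + A • b) := by
      rw [smul_add, smul_smul, smul_smul, div_eq_inv_mul, div_eq_inv_mul]
    rw [h3, h4, key, smul_smul]
    congr 1
    field_simp

theorem cross_of_far_near {a b c d : Plane} (h1 : Far a b c) (h2 : Near a b d) :
    (openSegment ℝ a b ∩ openSegment ℝ c d).Nonempty := by
  rcases h1 with ⟨h0, h1, h1', h1''⟩ | ⟨h0, h1, h1', h1''⟩ <;>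
    rcases h2 with ⟨h2, h2', h2''⟩ | ⟨h2, h2', h2''⟩
  · exact cross_of_far_near_aux h0 h1 h1' h2 h2' h1'' h2''
  · linarith [det_comm a b]
  · linarith [det_comm a b]
  · rw [openSegment_symm ℝ a]
    exact cross_of_far_near_aux h0 h1 h1' h2 h2' h1'' h2''

end Plane

namespace IsStraightLineDrawing
variable {V : Type*} {G : SimpleGraph V} {p : V → Plane} (hp : IsStraightLineDrawing G p)
include hp

open Plane

/-- The vertices of a triangle of the graph are not collinear. -/
theorem det_ne_zero_of_triangle {u v c : V} (huv : G.Adj u v) (hcu : G.Adj c u)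
    (hcv : G.Adj c v) : det (p u - p c) (p v - p c) ≠ 0 := by
  intro h
  have h1 := hp.inner_neg_of_det_eq_zero hcu hcv huv.ne h
  have h2 := hp.inner_neg_of_det_eq_zero huv hcu.symm hcv.ne'
    (by simp only [det, PiLp.sub_apply] at *; linarith)
  have := Plane.sq_add_sq_pos (hp.sub_ne_zero hcu.ne')
  simp only [inner_eq, PiLp.sub_apply] at *
  nlinarith

/-- The edge `wc` crosses the opposite edge `uv` of the triangle `uvc` exactly if `w` lies in the
angle of the triangle at `c`, beyond the line `uv`. -/
theorem edgesCross_iff_far {u v w c : V} (huv : G.Adj u v) (hcu : G.Adj c u) (hcv : G.Adj c v) :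
    EdgesCross p u v w c ↔ Far (p u - p c) (p v - p c) (p w - p c) := by
  have hD := hp.det_ne_zero_of_triangle huv hcu hcv
  constructor
  · rintro ⟨-, z, ⟨s', s, hs', hs, hss, rfl⟩, ⟨t, t', ht, ht', htt, h⟩⟩
    rw [ext_iff'] at h
    obtain rfl : s' = 1 - s := by linarith
    obtain rfl : t' = 1 - t := by linarith
    simp only [PiLp.add_apply, PiLp.smul_apply, smul_eq_mul] at h
    have e1 : t * det (p u - p c) (p w - p c) = s * det (p u - p c) (p v - p c) := by
      simp only [det, PiLp.sub_apply]
      linear_combination (p u 0 - p c 0) * h.2 - (p u 1 - p c 1) * h.1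
    have e2 : t * det (p w - p c) (p v - p c) = (1 - s) * det (p u - p c) (p v - p c) := by
      simp only [det, PiLp.sub_apply]
      linear_combination (p v 1 - p c 1) * h.1 - (p v 0 - p c 0) * h.2
    have f1 := det_comm (p v - p c) (p u - p c)
    have f2 := det_comm (p v - p c) (p w - p c)
    have f3 := det_comm (p w - p c) (p u - p c)
    rw [Far]
    generalize det (p u - p c) (p v - p c) = D at hD e1 e2 f1 ⊢
    generalize det (p u - p c) (p w - p c) = A at e1 f3 ⊢
    generalize det (p w - p c) (p v - p c) = B at e2 f2 ⊢
    have e3 : t * (A + B) = D := by linarith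
    rcases lt_or_gt_of_ne hD with hD | hD
    · have hA : A < 0 := by
        by_contra hc; nlinarith
      have hB : B < 0 := by
        by_contra hc; nlinarith
      right
      refine ⟨by linarith, by linarith, by linarith, ?_⟩
      rw [f1, f2, f3]
      nlinarith
    · have hA : 0 < A := by
        by_contra hc; nlinarith
      have hB : 0 < B := by
        by_contra hc; nlinarith
      left
      refine ⟨by linarith, by linarith, by linarith, ?_⟩
      nlinarith
  · intro h
    refine ⟨?_, ?_⟩
    · intro h'
      rcases Sym2.eq_iff.1 h' with ⟨-, h'⟩ | ⟨h', -⟩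
      · exact hcv.ne h'.symm
      · exact hcu.ne h'.symm
    · have e1 : det (p v - p u) (p w - p u) = det (p u - p c) (p v - p c) -
          (det (p u - p c) (p w - p c) + det (p w - p c) (p v - p c)) := by
        simp only [det, PiLp.sub_apply]; ring
      have e2 : det (p v - p u) (p c - p u) = det (p u - p c) (p v - p c) := by
        simp only [det, PiLp.sub_apply]; ring
      have e3 : det (p c - p w) (p u - p w) = det (p u - p c) (p w - p c) := by
        simp only [det, PiLp.sub_apply]; ring
      have e4 : det (p c - p w) (p v - p w) = - det (p w - p c) (p v - p c) := by
        simp only [det, PiLp.sub_apply]; ring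
      have f1 := det_comm (p v - p c) (p u - p c)
      have f2 := det_comm (p v - p c) (p w - p c)
      have f3 := det_comm (p w - p c) (p u - p c)
      apply openSegment_inter_nonempty
      · rw [e1, e2]
        rcases h with h | h
        · exact mul_neg_of_neg_of_pos (by linarith [h.2.2.2]) h.1
        · exact mul_neg_of_pos_of_neg (by linarith [h.2.2.2]) (by linarith [h.1])
      · rw [e3, e4]
        rcases h with h | h
        · exact mul_neg_of_pos_of_neg h.2.1 (by linarith [h.2.2.1])
        · exact mul_neg_of_neg_of_pos (by linarith [h.2.2.1]) (by linarith [h.2.1])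

theorem near_or_far_of_cone {u v w c : V} (huv : G.Adj u v) (hwu : w ≠ u) (hwv : w ≠ v)
    (h : Cone (p u - p c) (p v - p c) (p w - p c)) :
    Near (p u - p c) (p v - p c) (p w - p c) ∨ Far (p u - p c) (p v - p c) (p w - p c) := by
  have hmem := hp.notMem_segment u v w huv hwu hwv
  have tr : ∀ a b x : V, p x - p c ∈ segment ℝ (p a - p c) (p b - p c) →
      p x ∈ segment ℝ (p a) (p b) := by
    intro a b x h
    have := (mem_segment_translate ℝ (p c)).2 h
    simpa using this
  rcases h with ⟨h1, h2, h3⟩ | ⟨h1, h2, h3⟩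
  · rcases lt_trichotomy (det (p u - p c) (p w - p c) + det (p w - p c) (p v - p c))
      (det (p u - p c) (p v - p c)) with h | h | h
    · exact .inl (.inl ⟨h2, h3, h⟩)
    · exact absurd (tr _ _ _ (mem_segment_of_det h1 h2.le h3.le h)) hmem
    · exact .inr (.inl ⟨h1, h2, h3, h⟩)
  · rcases lt_trichotomy (det (p v - p c) (p w - p c) + det (p w - p c) (p u - p c))
      (det (p v - p c) (p u - p c)) with h | h | h
    · exact .inl (.inr ⟨h2, h3, h⟩)
    · rw [segment_symm] at hmem
      exact absurd (tr _ _ _ (mem_segment_of_det h1 h2.le h3.le h)) hmem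
    · exact .inr (.inr ⟨h1, h2, h3, h⟩)

end IsStraightLineDrawing

/-! ### Relabelling, reflection and the symmetries of the graph -/

section Transfer
variable {V W : Type*}

theorem edgesCross_comp {e : W → V} (he : Function.Injective e) {p : V → Plane} {u v x y : W} :
    EdgesCross (p ∘ e) u v x y ↔ EdgesCross p (e u) (e v) (e x) (e y) := by
  have h : s(e u, e v) = s(e x, e y) ↔ s(u, v) = s(x, y) :=
    (Sym2.map.injective he).eq_iff (a := s(u, v)) (b := s(x, y))
  rw [EdgesCross, EdgesCross, Ne, Ne, h]
  rfl

theorem IsRACDrawing.comp {G : SimpleGraph V} {H : SimpleGraph W} (e : H ↪g G) {p : V → Plane}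
    (hp : IsRACDrawing G p) : IsRACDrawing H (p ∘ e) where
  injective := hp.injective.comp e.injective
  notMem_segment u v w h hu hv := hp.notMem_segment (e u) (e v) (e w) (e.map_adj_iff.2 h)
    (e.injective.ne hu) (e.injective.ne hv)
  right_angle u v x y huv hxy h := hp.right_angle (e u) (e v) (e x) (e y) (e.map_adj_iff.2 huv)
    (e.map_adj_iff.2 hxy) ((edgesCross_comp e.injective).1 h)

namespace Plane

/-- The reflection `mirror` as a linear map. -/
def mirrorLin : Plane →ₗ[ℝ] Plane where
  toFun := mirror
  map_add' x y := by rw [ext_iff']; simp [mirror]; ring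
  map_smul' c x := by rw [ext_iff']; simp [mirror]

theorem mirror_zero_apply (x : Plane) : mirror x 0 = x 0 := by simp [mirror]
theorem mirror_one_apply (x : Plane) : mirror x 1 = - x 1 := by simp [mirror]
theorem mirror_mirror (x : Plane) : mirror (mirror x) = x := by
  rw [ext_iff']; simp [mirror]
theorem mirror_injective : Function.Injective mirror :=
  Function.LeftInverse.injective mirror_mirror
theorem mirror_sub (x y : Plane) : mirror x - mirror y = mirror (x - y) :=
  (map_sub mirrorLin x y).symm
theorem det_mirror (x y : Plane) : det (mirror x) (mirror y) = det y x := by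
  simp only [det, mirror_zero_apply, mirror_one_apply]; ring
theorem inner_mirror (x y : Plane) : inner ℝ (mirror x) (mirror y) = inner ℝ x y := by
  simp only [inner_eq, mirror_zero_apply, mirror_one_apply]; ring
theorem mirror_image_segment (x y : Plane) :
    mirror '' segment ℝ x y = segment ℝ (mirror x) (mirror y) :=
  image_segment ℝ mirrorLin.toAffineMap x y
theorem mirror_image_openSegment (x y : Plane) :
    mirror '' openSegment ℝ x y = openSegment ℝ (mirror x) (mirror y) :=
  image_openSegment ℝ mirrorLin.toAffineMap x y

end Plane

theorem edgesCross_mirror {p : V → Plane} {u v x y : V} :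
    EdgesCross (Plane.mirror ∘ p) u v x y ↔ EdgesCross p u v x y := by
  rw [EdgesCross, EdgesCross]
  simp only [Function.comp_apply]
  rw [← Plane.mirror_image_openSegment, ← Plane.mirror_image_openSegment,
    ← image_inter Plane.mirror_injective, image_nonempty]

theorem IsRACDrawing.mirror {G : SimpleGraph V} {p : V → Plane}
    (hp : IsRACDrawing G p) : IsRACDrawing G (Plane.mirror ∘ p) where
  injective := Plane.mirror_injective.comp hp.injective
  notMem_segment u v w h hu hv := by
    simp only [Function.comp_apply]
    rw [← Plane.mirror_image_segment, Plane.mirror_injective.mem_set_image]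
    exact hp.notMem_segment u v w h hu hv
  right_angle u v x y huv hxy h := by
    simp only [Function.comp_apply, Plane.mirror_sub, Plane.inner_mirror]
    exact hp.right_angle u v x y huv hxy (edgesCross_mirror.1 h)

end Transfer

instance : DecidableRel squareAntiprism.Adj := fun x y => by
  unfold squareAntiprism; rw [SimpleGraph.fromRel_adj]; infer_instance

instance : DecidableRel augmentedSquareAntiprism.Adj := fun x y => by
  unfold augmentedSquareAntiprism; rw [SimpleGraph.fromRel_adj]; infer_instance

namespace ASAVertex

/-- The automorphism that moves every vertex by one along the zigzag `a 0`, `b 0`, `a 1`, …; it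
exchanges the two quadrilaterals. -/
def shift : ASAVertex ≃ ASAVertex where
  toFun
    | none => none
    | some (false, i) => some (true, i)
    | some (true, i) => some (false, i + 1)
  invFun
    | none => none
    | some (true, i) => some (false, i)
    | some (false, i) => some (true, i - 1)
  left_inv := by decide
  right_inv := by decide

/-- The automorphism that reverses the zigzag and fixes `a 0`. -/
def flip : ASAVertex ≃ ASAVertex where
  toFun
    | none => none
    | some (false, i) => some (false, -i)
    | some (true, i) => some (true, -i - 1)
  invFun
    | none => none
    | some (false, i) => some (false, -i)
    | some (true, i) => some (true, -i - 1)
  left_inv := by decide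
  right_inv := by decide

/-- The map `shift` as a graph isomorphism. -/
def shiftIso : augmentedSquareAntiprism ≃g augmentedSquareAntiprism where
  toEquiv := shift
  map_rel_iff' := by decide +kernel

/-- The map `flip` as a graph isomorphism. -/
def flipIso : augmentedSquareAntiprism ≃g augmentedSquareAntiprism where
  toEquiv := flip
  map_rel_iff' := by decide +kernel

/-- The numbering of the vertices along the zigzag that the search uses; 8 is the center. -/
def ofNat (n : ℕ) : ASAVertex :=
  bif Nat.blt n 8 then some (Nat.beq (n % 2) 1, ((n / 2 : ℕ) : ZMod 4)) else none

open RACSearch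

theorem ofNat_injOn : ∀ a < 9, ∀ b < 9, ofNat a = ofNat b → a = b := by decide +kernel
theorem adj_edge : ∀ e < 24,
    augmentedSquareAntiprism.Adj (ofNat (edgeFst e)) (ofNat (edgeSnd e)) := by
  decide +kernel
theorem adj_none : ∀ a < 8, augmentedSquareAntiprism.Adj none (ofNat a) := by decide +kernel
theorem shift_edge : ∀ e < 24, ofNat (edgeFst (shiftE e)) = shift (ofNat (edgeFst e)) ∧
    ofNat (edgeSnd (shiftE e)) = shift (ofNat (edgeSnd e)) := by decide +kernel
theorem flip_edge : ∀ e < 24, (ofNat (edgeFst (reflE e)) = flip (ofNat (edgeFst e)) ∧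
    ofNat (edgeSnd (reflE e)) = flip (ofNat (edgeSnd e))) ∨
    (ofNat (edgeSnd (reflE e)) = flip (ofNat (edgeFst e)) ∧
    ofNat (edgeFst (reflE e)) = flip (ofNat (edgeSnd e))) := by decide +kernel
theorem shift_ofNat : ∀ z < 8, ofNat (shiftV z) = shift (ofNat z) := by decide +kernel
theorem flip_ofNat : ∀ z < 8, ofNat (reflV z) = flip (ofNat z) := by decide +kernel
set_option synthInstance.maxSize 1000 in
set_option synthInstance.maxHeartbeats 200000 in
theorem exists_common : ∀ e < 24, ∀ f < 24, adjacentEdges e f = true →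
    (edgeFst e = edgeFst f ∧ edgeSnd e ≠ edgeSnd f) ∨
    (edgeFst e = edgeSnd f ∧ edgeSnd e ≠ edgeFst f) ∨
    (edgeSnd e = edgeFst f ∧ edgeFst e ≠ edgeSnd f) ∨
    (edgeSnd e = edgeSnd f ∧ edgeFst e ≠ edgeFst f) := by
  decide +kernel
theorem edge_lt : ∀ e < 24, edgeFst e < 9 ∧ edgeSnd e < 9 := by decide +kernel
theorem spoke_ends : ∀ z < 8, edgeFst (16 + z) = z ∧ edgeSnd (16 + z) = 8 := by decide +kernel

end ASAVertex

/-! ### Perturbation to general position -/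

section

open RACSearch Plane ASAVertex

namespace Plane

theorem det_perturb (x y : Plane) (s t : ℝ) :
    det (x + s • rot90 x) (y + t • rot90 y) =
      (1 + s * t) * det x y + (t - s) * inner ℝ x y := by
  rw [inner_eq]
  simp [det, rot90]
  ring

/-- Finitely many nonzero vectors can be rotated slightly so that no two of them are parallel. -/
theorem exists_perturb (y : ℕ → Plane) (n : ℕ)
    (hy : ∀ i < n, ∀ j < n, i ≠ j → det (y i) (y j) = 0 → inner ℝ (y i) (y j) ≠ 0) :
    ∃ y' : ℕ → Plane, (∀ i < n, ∀ j < n, i ≠ j → det (y' i) (y' j) ≠ 0) ∧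
      ∀ i < n, ∀ j < n, 0 < det (y i) (y j) → 0 < det (y' i) (y' j) := by
  have key : ∀ i j : ℕ, (0 < det (y i) (y j) → ∀ᶠ ε : ℝ in 𝓝[>] (0 : ℝ),
      0 < det (y i + (ε * i) • rot90 (y i)) (y j + (ε * j) • rot90 (y j))) := by
    intro i j h
    have hc : Continuous fun ε : ℝ =>
        det (y i + (ε * i) • rot90 (y i)) (y j + (ε * j) • rot90 (y j)) := by
      simp only [det_perturb]; fun_prop
    refine (hc.tendsto 0).mono_left nhdsWithin_le_nhds |>.eventually (lt_mem_nhds ?_)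
    simpa using h
  have key' : ∀ i < n, ∀ j < n, i ≠ j → ∀ᶠ ε : ℝ in 𝓝[>] (0 : ℝ),
      det (y i + (ε * i) • rot90 (y i)) (y j + (ε * j) • rot90 (y j)) ≠ 0 := by
    intro i hi j hj hij
    rcases lt_trichotomy (det (y i) (y j)) 0 with h | h | h
    · filter_upwards [key j i (by rw [det_comm]; linarith)] with ε hε
      rw [det_comm]; linarith
    · filter_upwards [self_mem_nhdsWithin] with ε (hε : 0 < ε)
      rw [det_perturb, h, mul_zero, zero_add, ← mul_sub]
      exact mul_ne_zero (mul_ne_zero hε.ne' (sub_ne_zero.2 (by exact_mod_cast hij.symm)))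
        (hy i hi j hj hij h)
    · filter_upwards [key i j h] with ε hε using hε.ne'
  have h1 : ∀ᶠ ε : ℝ in 𝓝[>] (0 : ℝ), ∀ i < n, ∀ j < n, i ≠ j →
      det (y i + (ε * i) • rot90 (y i)) (y j + (ε * j) • rot90 (y j)) ≠ 0 := by
    refine (Set.finite_lt_nat n).eventually_all.2 fun i hi =>
      (Set.finite_lt_nat n).eventually_all.2 fun j hj => ?_
    by_cases hij : i = j
    · simp [hij]
    · simpa [hij] using key' i hi j hj hij
  have h2 : ∀ᶠ ε : ℝ in 𝓝[>] (0 : ℝ), ∀ i < n, ∀ j < n,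
      0 < det (y i) (y j) →
      0 < det (y i + (ε * i) • rot90 (y i)) (y j + (ε * j) • rot90 (y j)) := by
    refine (Set.finite_lt_nat n).eventually_all.2 fun i hi =>
      (Set.finite_lt_nat n).eventually_all.2 fun j hj => ?_
    by_cases hij : 0 < det (y i) (y j)
    · simpa [hij] using key i j hij
    · simp [hij]
  obtain ⟨ε, h1, h2⟩ := (h1.and h2).exists
  exact ⟨fun i => y i + (ε * i) • rot90 (y i), h1, h2⟩

/-- Among finitely many lines through the origin there is one that is met first when the ray `w`
turns clockwise; the other vectors lie on the same side of `w` as of the ray that is met. -/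
theorem exists_previous_line (y : ℕ → Plane) (n : ℕ)
    (hy : ∀ i < n, ∀ j < n, i ≠ j → det (y i) (y j) ≠ 0) (w : ℕ) (hw : w < n) (prev : List ℕ)
    (hne : prev ≠ []) (hwp : w ∉ prev) (hp : ∀ t ∈ prev, t < n) : ∃ u ∈ prev,
    (0 < det (y u) (y w) ∧ ∀ t ∈ prev, (0 < det (y u) (y t) → 0 < det (y w) (y t)) ∧
      (0 < det (y t) (y u) → 0 < det (y t) (y w))) ∨
    (0 < det (y w) (y u) ∧ ∀ t ∈ prev, (0 < det (y u) (y t) → 0 < det (y t) (y w)) ∧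
      (0 < det (y t) (y u) → 0 < det (y w) (y t))) := by
  -- The first line is the one with the largest cotangent of the angle to `w`.
  obtain ⟨u, hu, hmax⟩ := prev.toFinset.exists_max_image
    (fun u => inner ℝ (y u) (y w) / det (y u) (y w)) (by simpa using hne)
  simp only [List.mem_toFinset] at hu hmax
  have hdet : ∀ t ∈ prev, det (y t) (y w) ≠ 0 := fun t ht =>
    hy t (hp t ht) w hw (fun h => hwp (h ▸ ht))
  have hmax' : ∀ t ∈ prev, 0 ≤ det (y u) (y w) * det (y t) (y w) * det (y t) (y u) := by
    intro t ht
    have h := hmax t ht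
    have hut := hdet t ht
    have huu := hdet u hu
    have hw2 : 0 < (y w 0) ^ 2 + (y w 1) ^ 2 := by
      refine sq_add_sq_pos fun h => huu ?_
      rw [h]; simp [det]
    have h1 : (inner ℝ (y u) (y w) / det (y u) (y w) - inner ℝ (y t) (y w) / det (y t) (y w)) *
        (det (y u) (y w) * det (y t) (y w)) ^ 2 =
        (y w 0 ^ 2 + y w 1 ^ 2) * (det (y u) (y w) * det (y t) (y w) * det (y t) (y u)) := by
      have : (inner ℝ (y u) (y w) / det (y u) (y w) - inner ℝ (y t) (y w) / det (y t) (y w)) *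
        (det (y u) (y w) * det (y t) (y w)) ^ 2 = (inner ℝ (y u) (y w) * det (y t) (y w) -
          inner ℝ (y t) (y w) * det (y u) (y w)) * (det (y u) (y w) * det (y t) (y w)) := by
        field_simp
      rw [this]
      simp only [inner_eq, det]
      ring
    have h2 : 0 ≤ (inner ℝ (y u) (y w) / det (y u) (y w) -
        inner ℝ (y t) (y w) / det (y t) (y w)) * (det (y u) (y w) * det (y t) (y w)) ^ 2 :=
      mul_nonneg (sub_nonneg.2 h) (sq_nonneg _)
    rw [h1] at h2
    exact nonneg_of_mul_nonneg_right h2 hw2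
  refine ⟨u, hu, ?_⟩
  rcases lt_or_gt_of_ne (hdet u hu) with h | h
  · right
    have h' : 0 < det (y w) (y u) := by rw [det_comm]; linarith
    refine ⟨h', fun t ht => ⟨fun htu => ?_, fun htu => ?_⟩⟩
    · have h1 := hmax' t ht
      rw [det_comm (y t) (y u)] at h1
      by_contra hc
      have h2 : det (y t) (y w) < 0 := lt_of_le_of_ne (not_lt.1 hc) (hdet t ht)
      nlinarith [mul_pos (mul_pos_of_neg_of_neg h h2) htu]
    · have h1 := hmax' t ht
      rw [det_comm (y w) (y t)]
      by_contra hc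
      have h2 : 0 < det (y t) (y w) := lt_of_le_of_ne (by linarith) (hdet t ht).symm
      nlinarith [mul_pos (mul_pos (neg_pos.2 h) h2) htu]
  · left
    refine ⟨h, fun t ht => ⟨fun htu => ?_, fun htu => ?_⟩⟩
    · have h1 := hmax' t ht
      rw [det_comm (y t) (y u)] at h1
      rw [det_comm (y w) (y t)]
      by_contra hc
      have h2 : 0 < det (y t) (y w) := lt_of_le_of_ne (by linarith) (hdet t ht).symm
      nlinarith [mul_pos (mul_pos h h2) htu]
    · have h1 := hmax' t ht
      by_contra hc
      have h2 : det (y t) (y w) < 0 := lt_of_le_of_ne (not_lt.1 hc) (hdet t ht)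
      nlinarith [mul_pos (mul_pos h (neg_pos.2 h2)) htu]

end Plane

end

/-! ### The model of a RAC drawing -/

noncomputable section

open RACSearch Plane ASAVertex

namespace ASAVertex

theorem touches_eq_false_iff {e v : ℕ} :
    touches e v = false ↔ edgeFst e ≠ v ∧ edgeSnd e ≠ v := by
  rw [← Bool.not_eq_true, touches, Bool.or_eq_true, Nat.beq_eq, Nat.beq_eq, not_or]

/-- The position of vertex number `n` relative to the center. -/
def relPos (q : ASAVertex → Plane) (n : ℕ) : Plane := q (ofNat n) - q none

/-- The edges number `e` and `f` cross. -/
def crossing (q : ASAVertex → Plane) (e f : ℕ) : Prop :=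
  EdgesCross q (ofNat (edgeFst e)) (ofNat (edgeSnd e)) (ofNat (edgeFst f)) (ofNat (edgeSnd f))

/-- The vertex number `z` lies in the triangle that edge `e` spans with the center. -/
def nearVertex (q : ASAVertex → Plane) (e z : ℕ) : Prop :=
  Near (relPos q (edgeFst e)) (relPos q (edgeSnd e)) (relPos q z)

/-- The vectors `y` are pairwise nonparallel and have the same orientations as the spokes
wherever these are not parallel. -/
def IsPerturbation (q : ASAVertex → Plane) (y : ℕ → Plane) : Prop :=
  (∀ i < 8, ∀ j < 8, i ≠ j → det (y i) (y j) ≠ 0) ∧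
    ∀ i < 8, ∀ j < 8, 0 < det (relPos q i) (relPos q j) → 0 < det (y i) (y j)

/-- The facts about a drawing. The signs are those of a perturbation, as opposite spokes may be
parallel. -/
def modelOf (q : ASAVertex → Plane) (y : ℕ → Plane) : Model :=
  ⟨fun a b => 0 < det (y a) (y b), nearVertex q, crossing q⟩

/-- The models of all RAC drawings with all their perturbations. -/
def drawingFamily : Set Model :=
  {M | ∃ q y, IsRACDrawing augmentedSquareAntiprism q ∧ IsPerturbation q y ∧ M = modelOf q y}

section
variable {q : ASAVertex → Plane} (hq : IsRACDrawing augmentedSquareAntiprism q)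
include hq

/-- Parallel spokes point in opposite directions. -/
theorem inner_neg_of_det_relPos_eq_zero {i j : ℕ} (hi : i < 8) (hj : j < 8) (hij : i ≠ j)
    (h : det (relPos q i) (relPos q j) = 0) : inner ℝ (relPos q i) (relPos q j) < 0 :=
  hq.inner_neg_of_det_eq_zero (adj_none i hi) (adj_none j hj)
    (fun h => hij (ofNat_injOn i (by omega) j (by omega) h)) h

theorem det_relPos_edge_ne_zero {e : ℕ} (he : e < 16) :
    det (relPos q (edgeFst e)) (relPos q (edgeSnd e)) ≠ 0 :=
  hq.det_ne_zero_of_triangle (adj_edge e (by omega)) (adj_none _ (edgeFst_lt he))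
    (adj_none _ (edgeSnd_lt he))

theorem crossing_spoke_iff {e z : ℕ} (he : e < 16) (hz : z < 8) : crossing q e (16 + z) ↔
    Far (relPos q (edgeFst e)) (relPos q (edgeSnd e)) (relPos q z) := by
  rw [crossing, (spoke_ends z hz).1, (spoke_ends z hz).2]
  exact hq.edgesCross_iff_far (adj_edge e (by omega)) (adj_none _ (edgeFst_lt he))
    (adj_none _ (edgeSnd_lt he))

theorem exists_isPerturbation : ∃ y, IsPerturbation q y :=
  exists_perturb (relPos q) 8 fun _ hi _ hj hij h =>
    (inner_neg_of_det_relPos_eq_zero hq hi hj hij h).ne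

omit hq in
theorem crossing_of_segments {e f : ℕ} (he : e < 16) (hf : f < 16)
    (h1 : touches e (edgeFst f) = false) (h2 : touches e (edgeSnd f) = false) {a b c d : ℕ}
    (hab : a = edgeFst e ∧ b = edgeSnd e ∨ a = edgeSnd e ∧ b = edgeFst e)
    (hcd : c = edgeFst f ∧ d = edgeSnd f ∨ c = edgeSnd f ∧ d = edgeFst f)
    (h : (openSegment ℝ (relPos q a) (relPos q b) ∩
      openSegment ℝ (relPos q c) (relPos q d)).Nonempty) : crossing q e f := by
  rw [touches_eq_false_iff] at h1 h2
  have e1 := edgeFst_lt he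
  have e2 := edgeSnd_lt he
  have f1 := edgeFst_lt hf
  have f2 := edgeSnd_lt hf
  have h' : (openSegment ℝ (relPos q (edgeFst e)) (relPos q (edgeSnd e)) ∩
      openSegment ℝ (relPos q (edgeFst f)) (relPos q (edgeSnd f))).Nonempty := by
    rcases hab with ⟨rfl, rfl⟩ | ⟨rfl, rfl⟩ <;> rcases hcd with ⟨rfl, rfl⟩ | ⟨rfl, rfl⟩
    · exact h
    · rwa [openSegment_symm ℝ (relPos q (edgeFst f))]
    · rwa [openSegment_symm ℝ (relPos q (edgeFst e))]
    · rwa [openSegment_symm ℝ (relPos q (edgeFst e)), openSegment_symm ℝ (relPos q (edgeFst f))]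
  refine ⟨?_, ?_⟩
  · rw [Ne, Sym2.eq_iff]
    rintro (⟨h, -⟩ | ⟨h, -⟩)
    · exact h1.1 (ofNat_injOn _ (by omega) _ (by omega) h)
    · exact h2.1 (ofNat_injOn _ (by omega) _ (by omega) h)
  · obtain ⟨z, hz1, hz2⟩ := h'
    refine ⟨q none + z, ?_, ?_⟩
    · have := (mem_openSegment_translate ℝ (q none)).2 hz1
      simpa [relPos] using this
    · have := (mem_openSegment_translate ℝ (q none)).2 hz2
      simpa [relPos] using this

theorem not_crossing_fan {e f g : ℕ} (he : e < 24) (hf : f < 24) (hg : g < 24)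
    (hfg : adjacentEdges f g = true) (h : crossing q e f) : ¬ crossing q e g := by
  have ae := adj_edge e he
  have af := adj_edge f hf
  have ag := adj_edge g hg
  have l1 := edge_lt f hf
  have l2 := edge_lt g hg
  intro hc
  rw [crossing] at hc h
  rcases exists_common f hf g hg hfg with ⟨hv, hn⟩ | ⟨hv, hn⟩ | ⟨hv, hn⟩ | ⟨hv, hn⟩
  · rw [hv] at h af
    exact hq.not_edgesCross_fan ae af ag
      (fun h => hn (ofNat_injOn _ l1.2 _ l2.2 h)) h hc
  · rw [edgesCross_swap_right] at hc
    rw [hv] at h af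
    exact hq.not_edgesCross_fan ae af ag.symm
      (fun h => hn (ofNat_injOn _ l1.2 _ l2.1 h)) h hc
  · rw [edgesCross_swap_right, hv] at h
    rw [hv] at af
    exact hq.not_edgesCross_fan ae af.symm ag
      (fun h => hn (ofNat_injOn _ l1.1 _ l2.2 h)) h hc
  · rw [edgesCross_swap_right] at hc
    rw [edgesCross_swap_right, hv] at h
    rw [hv] at af
    exact hq.not_edgesCross_fan ae af.symm ag.symm
      (fun h => hn (ofNat_injOn _ l1.1 _ l2.1 h)) h hc

omit hq in
theorem arc_of_cone {y : ℕ → Plane} (hy : IsPerturbation q y) {e z : ℕ} (he : e < 16) (hz : z < 8)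
    (h : Cone (relPos q (edgeFst e)) (relPos q (edgeSnd e)) (relPos q z)) :
    (modelOf q y).Arc e z := by
  have e1 := edgeFst_lt he
  have e2 := edgeSnd_lt he
  rcases h with ⟨h1, h2, h3⟩ | ⟨h1, h2, h3⟩
  · exact .inl ⟨hy.2 _ e1 _ e2 h1, hy.2 _ e1 _ hz h2, hy.2 _ hz _ e2 h3⟩
  · exact .inr ⟨hy.2 _ e2 _ e1 h1, hy.2 _ e2 _ hz h2, hy.2 _ hz _ e1 h3⟩

omit hq in
theorem det_nonneg_of_perturbation {y : ℕ → Plane} (hy : IsPerturbation q y) {i j : ℕ} (hi : i < 8)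
    (hj : j < 8) (h : 0 < det (y i) (y j)) : 0 ≤ det (relPos q i) (relPos q j) := by
  by_contra hc
  have := hy.2 j hj i hi (by rw [det_comm]; linarith)
  rw [det_comm] at this
  linarith

/-- The perturbation does not move a vertex into the angle of an edge: a spoke on the boundary of
the angle would be opposite to one of its sides, and the perturbed spoke would then lie outside. -/
theorem cone_of_arc {y : ℕ → Plane} (hy : IsPerturbation q y) {e z : ℕ} (he : e < 16) (hz : z < 8)
    (hez : touches e z = false) (h : (modelOf q y).Arc e z) :
    Cone (relPos q (edgeFst e)) (relPos q (edgeSnd e)) (relPos q z) := by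
  have key : ∀ a < 8, ∀ b < 8, a ≠ z → b ≠ z → det (relPos q a) (relPos q b) ≠ 0 →
      0 < det (y a) (y b) → 0 < det (y a) (y z) → 0 < det (y z) (y b) →
      0 < det (relPos q a) (relPos q b) ∧ 0 < det (relPos q a) (relPos q z) ∧
        0 < det (relPos q z) (relPos q b) := by
    intro a ha b hb haz hbz hab h1 h2 h3
    have g1 := lt_of_le_of_ne (det_nonneg_of_perturbation hy ha hb h1) hab.symm
    have g2 := det_nonneg_of_perturbation hy ha hz h2
    have g3 := det_nonneg_of_perturbation hy hz hb h3
    have key1 : inner ℝ (relPos q a) (relPos q a) * det (relPos q z) (relPos q b) =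
        inner ℝ (relPos q a) (relPos q z) * det (relPos q a) (relPos q b) -
        inner ℝ (relPos q a) (relPos q b) * det (relPos q a) (relPos q z) := by
      simp only [inner_eq, det]; ring
    have key2 : inner ℝ (relPos q b) (relPos q b) * det (relPos q a) (relPos q z) =
        inner ℝ (relPos q b) (relPos q z) * det (relPos q a) (relPos q b) -
        inner ℝ (relPos q a) (relPos q b) * det (relPos q z) (relPos q b) := by
      simp only [inner_eq, det]; ring
    refine ⟨g1, lt_of_le_of_ne g2 fun h0 => ?_, lt_of_le_of_ne g3 fun h0 => ?_⟩
    · have := inner_neg_of_det_relPos_eq_zero hq ha hz haz h0.symm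
      rw [← h0, mul_zero, sub_zero] at key1
      nlinarith [mul_nonneg (real_inner_self_nonneg (x := relPos q a)) g3,
        mul_pos (neg_pos.2 this) g1]
    · have := inner_neg_of_det_relPos_eq_zero hq hz hb hbz.symm h0.symm
      rw [real_inner_comm] at this
      rw [← h0, mul_zero, sub_zero] at key2
      nlinarith [mul_nonneg (real_inner_self_nonneg (x := relPos q b)) g2,
        mul_pos (neg_pos.2 this) g1]
  rw [touches_eq_false_iff] at hez
  have e1 := edgeFst_lt he
  have e2 := edgeSnd_lt he
  have h0 := det_relPos_edge_ne_zero hq he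
  rcases h with ⟨h1, h2, h3⟩ | ⟨h1, h2, h3⟩
  · exact .inl (key _ e1 _ e2 hez.1 hez.2 h0 h1 h2 h3)
  · exact .inr (key _ e2 _ e1 hez.2 hez.1 (by rw [det_comm]; simpa using h0) h1 h2 h3)

theorem lawful_modelOf {y : ℕ → Plane} (hy : IsPerturbation q y) : (modelOf q y).Lawful where
  asymm a b h h' := by
    have h1 : 0 < det (y a) (y b) := h
    have h2 : 0 < det (y b) (y a) := h'
    rw [det_comm] at h1
    linarith
  row w hw prev hne hwp hp := exists_previous_line y 8 hy.1 w hw prev hne hwp hp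
  cross_symm e f h := h.symm
  arc_of_cross e he z hz h := arc_of_cone hy he hz ((crossing_spoke_iff hq he hz).1 h).cone
  arc_of_near e he z hz h := arc_of_cone hy he hz (Near.cone h)
  split e he z hz hez h := by
    have hn := hez
    rw [touches_eq_false_iff] at hn
    have e1 := edgeFst_lt he
    have e2 := edgeSnd_lt he
    refine (hq.near_or_far_of_cone (adj_edge e (by omega)) ?_ ?_
      (cone_of_arc hq hy he hz hez h)).symm.imp_left (crossing_spoke_iff hq he hz).2
    · exact fun h => hn.1 (ofNat_injOn _ (by omega) _ (by omega) h).symm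
    · exact fun h => hn.2 (ofNat_injOn _ (by omega) _ (by omega) h).symm
  fan e he f hf g hg hfg h := not_crossing_fan hq he hf hg hfg h
  triangle e he f hf g hg h1 h2 :=
    hq.not_edgesCross_triangle (adj_edge e he) (adj_edge f hf) (adj_edge g hg) h1 h2
  nested e he f hf h1 h2 c d hcd h3 h4 := by
    have hc : c < 8 := by
      have := edgeFst_lt hf
      have := edgeSnd_lt hf
      omega
    exact crossing_of_segments he hf h1 h2 (.inl ⟨rfl, rfl⟩) hcd
      (cross_of_far_near ((crossing_spoke_iff hq he hc).1 h3) h4)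
  inter e he f hf h1 h2 c b hc hb h := by
    have f1 := edgeFst_lt hf
    have f2 := edgeSnd_lt hf
    have e1 := edgeFst_lt he
    have e2 := edgeSnd_lt he
    have hc8 : c < 8 := by omega
    have hb8 : b < 8 := by omega
    obtain ⟨a, hab⟩ : ∃ a, a = edgeFst e ∧ b = edgeSnd e ∨ a = edgeSnd e ∧ b = edgeFst e :=
      hb.elim (fun h => ⟨_, .inr ⟨rfl, h⟩⟩) (fun h => ⟨_, .inl ⟨rfl, h⟩⟩)
    obtain ⟨d, hcd⟩ : ∃ d, c = edgeFst f ∧ d = edgeSnd f ∨ c = edgeSnd f ∧ d = edgeFst f :=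
      hc.elim (fun h => ⟨_, .inl ⟨h, rfl⟩⟩) (fun h => ⟨_, .inr ⟨h, rfl⟩⟩)
    refine crossing_of_segments he hf h1 h2 hab hcd ?_
    rcases h with ⟨h3, h4⟩ | ⟨h3, h4⟩
    · replace h3 : Near (relPos q (edgeFst e)) (relPos q (edgeSnd e)) (relPos q c) := h3
      replace h4 : Near (relPos q (edgeFst f)) (relPos q (edgeSnd f)) (relPos q b) := h4
      apply cross_of_near_near
      · rcases hab with ⟨rfl, rfl⟩ | ⟨rfl, rfl⟩
        exacts [h3, h3.swap]
      · rcases hcd with ⟨rfl, rfl⟩ | ⟨rfl, rfl⟩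
        exacts [h4, h4.swap]
    · replace h3 := (crossing_spoke_iff hq he hc8).1 h3
      replace h4 := (crossing_spoke_iff hq hf hb8).1 h4
      apply cross_of_far_far
      · rcases hab with ⟨rfl, rfl⟩ | ⟨rfl, rfl⟩
        exacts [h3, h3.swap]
      · rcases hcd with ⟨rfl, rfl⟩ | ⟨rfl, rfl⟩
        exacts [h4, h4.swap]

omit hq in
theorem relPos_mirror (n : ℕ) : relPos (mirror ∘ q) n = mirror (relPos q n) :=
  mirror_sub _ _

end

theorem near_mirror {a b w : Plane} : Near (mirror a) (mirror b) (mirror w) ↔ Near a b w := by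
  simp only [Near, det_mirror]
  constructor
  · rintro (⟨h1, h2, h3⟩ | ⟨h1, h2, h3⟩)
    · exact .inr ⟨h2, h1, by linarith⟩
    · exact .inl ⟨h2, h1, by linarith⟩
  · rintro (⟨h1, h2, h3⟩ | ⟨h1, h2, h3⟩)
    · exact .inr ⟨h2, h1, by linarith⟩
    · exact .inl ⟨h2, h1, by linarith⟩

end ASAVertex

end

/-! ### Metric arguments -/

section

open RACSearch Plane ASAVertex

namespace Plane

/-- If the far point `w` is seen at a right angle to the segment from `a` to `b`, then the foot
of the perpendicular is between `0` and `w`. -/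
theorem inner_pos_of_far {a b w : Plane} (h : Far a b w) (hp : inner ℝ (b - a) w = 0) :
    0 < inner ℝ a w ∧ 0 < inner ℝ b w ∧ inner ℝ a w = inner ℝ b w ∧
      inner ℝ b w < inner ℝ w w := by
  have e : inner ℝ a w = inner ℝ b w := by
    rw [inner_sub_left] at hp; linarith
  have e1 : det a b * inner ℝ w w = det a w * inner ℝ b w + det w b * inner ℝ a w := by
    simp only [inner_eq, det]; ring
  have e2 : det b a * inner ℝ w w = det b w * inner ℝ a w + det w a * inner ℝ b w := by
    simp only [inner_eq, det]; ring
  have hw : 0 < inner ℝ w w := by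
    rw [real_inner_self_eq_norm_sq]
    have : w ≠ 0 := by
      rintro rfl
      rcases h with h | h
      · exact absurd h.2.1 (by simp [det])
      · exact absurd h.2.1 (by simp [det])
    positivity
  rw [e] at e1 e2
  rw [e]
  generalize inner ℝ b w = t at *
  generalize inner ℝ w w = N at *
  have key : ∀ A B D : ℝ, 0 < D → 0 < A → 0 < B → D < A + B → D * N = A * t + B * t →
      0 < t ∧ t < N := by
    intro A B D hD hA hB hAB h
    have ht : 0 < t := by
      by_contra hc
      nlinarith [mul_pos hD hw, mul_nonneg (add_pos hA hB).le (neg_nonneg.2 (not_lt.1 hc))]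
    refine ⟨ht, ?_⟩
    nlinarith [mul_pos (sub_pos.2 hAB) ht]
  have : 0 < t ∧ t < N := by
    rcases h with ⟨h0, h1, h2, h3⟩ | ⟨h0, h1, h2, h3⟩
    · exact key _ _ _ h0 h1 h2 h3 e1
    · exact key _ _ _ h0 h1 h2 h3 e2
  exact ⟨this.1, this.1, rfl, this.2⟩

/-- The crossing point of two perpendicular segments is the foot of the perpendicular. -/
theorem inner_pos_of_perp_crossing {a b c d : Plane} (hab : a ≠ b)
    (hp : inner ℝ (b - a) (d - c) = 0)
    (h : (openSegment ℝ a b ∩ openSegment ℝ c d).Nonempty) : 0 < inner ℝ (b - a) (c - a) := by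
  obtain ⟨z, ⟨s', s, hs', hs, hss, rfl⟩, ⟨t', t, ht', ht, htt, h⟩⟩ := h
  rw [ext_iff'] at h
  obtain rfl : s' = 1 - s := by linarith
  obtain rfl : t' = 1 - t := by linarith
  have h2 := sq_add_sq_pos (sub_ne_zero.2 hab.symm)
  simp only [inner_eq, PiLp.sub_apply, PiLp.add_apply, PiLp.smul_apply, smul_eq_mul] at *
  have : (b 0 - a 0) * (c 0 - a 0) + (b 1 - a 1) * (c 1 - a 1) =
      s * ((b 0 - a 0) ^ 2 + (b 1 - a 1) ^ 2) := by
    linear_combination (b 0 - a 0) * h.1 + (b 1 - a 1) * h.2 - t * hp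
  rw [this]
  positivity

theorem det_mul_norm_sq (a b d : Plane) :
    inner ℝ d d * det a b = inner ℝ a d * det d b + det a d * inner ℝ b d := by
  simp only [inner_eq, det]; ring

/-- Let `x₀` lie beyond the segment `x₇x₁` that its spoke crosses at a right angle, and in the
triangle spanned by `x₅x₇`; then an edge from `x₀` that crosses `x₅x₇` at a right angle turns
clockwise. -/
theorem det_neg_of_near_triangle {x0 x1 x5 x6 x7 : Plane} (hf : Far x7 x1 x0)
    (hp : inner ℝ (x1 - x7) x0 = 0) (h01 : 0 ≤ det x0 x1) (hn : Near x5 x7 x0)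
    (hp' : inner ℝ (x7 - x5) (x0 - x6) = 0)
    (hX : (openSegment ℝ x5 x7 ∩ openSegment ℝ x6 x0).Nonempty) :
    det x0 x6 < 0 ∧ 0 < inner ℝ x0 x5 := by
  obtain ⟨ht, -, he, hN⟩ := inner_pos_of_far hf hp
  rw [← he] at hN
  have h70 : 0 < det x7 x0 := by
    rcases hf with h | h
    · exact h.2.1
    · linarith [h.2.1, det_comm x0 x1]
  obtain ⟨h1, h2, h3⟩ : 0 < det x7 x0 ∧ 0 < det x0 x5 ∧ det x7 x0 + det x0 x5 < det x7 x5 := by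
    rcases hn with h | h
    · linarith [h.2.1, det_comm x7 x0]
    · exact h
  have e1 : det x7 x5 * inner ℝ x0 x0 = det x7 x0 * inner ℝ x0 x5 + det x0 x5 * inner ℝ x7 x0 := by
    simp only [inner_eq, det]; ring
  -- Write `x₀` as a combination of `x₇` and `x₅`. As the coefficients add up to less than 1 and
  -- `x₇` is below `x₀`, the point `x₅` is above `x₀`, and so above `x₇`.
  have h5 : inner ℝ x7 x0 < inner ℝ x0 x5 := by
    by_contra hc
    push Not at hc
    nlinarith [mul_le_mul_of_nonneg_left hc h1.le, mul_pos (sub_pos.2 h3) ht,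
      mul_pos (sub_pos.2 hN) (add_pos h1 h2)]
  have hD : det (x7 - x5) (x0 - x6) ≠ 0 := by
    refine det_ne_zero_of_inner_eq_zero (sub_ne_zero.2 ?_) (sub_ne_zero.2 ?_) hp'
    · rintro rfl; linarith [real_inner_comm x0 x7]
    · rintro rfl
      obtain ⟨z, hz, hz'⟩ := hX
      rw [openSegment_same, mem_singleton_iff] at hz'
      subst hz'
      obtain ⟨s, t, hs, ht, hst, rfl⟩ := hz
      obtain rfl : s = 1 - t := by linarith
      apply h3.ne
      simp only [det, PiLp.add_apply, PiLp.smul_apply, smul_eq_mul]; ring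
  have hop := det_mul_det_neg_of_inter hD hX
  have e2 : det (x7 - x5) (x0 - x5) = det x7 x0 + det x0 x5 - det x7 x5 := by
    simp only [det, PiLp.sub_apply]; ring
  have h6 : 0 < det (x7 - x5) (x6 - x5) := by
    rw [e2] at hop
    by_contra hc
    nlinarith
  -- Hence the edge leaves `x₀` to the left of the direction `x₇ - x₅`, which points downwards.
  have h7 : 0 < det (x7 - x5) (x6 - x0) := by
    have : det (x7 - x5) (x6 - x0) = det (x7 - x5) (x6 - x5) - det (x7 - x5) (x0 - x5) := by
      simp only [det, PiLp.sub_apply]; ring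
    rw [this, e2]; linarith
  have e3 := det_mul_norm_sq x0 (x6 - x0) (x7 - x5)
  have e4 : inner ℝ (x6 - x0) (x7 - x5) = 0 := by
    rw [real_inner_comm, ← neg_sub x0 x6, inner_neg_right, hp', neg_zero]
  have e5 : det x0 (x6 - x0) = det x0 x6 := by
    simp only [det, PiLp.sub_apply]; ring
  have e6 : inner ℝ x0 (x7 - x5) = inner ℝ x7 x0 - inner ℝ x0 x5 := by
    rw [inner_sub_right, real_inner_comm x7 x0]
  rw [e4, mul_zero, add_zero, e5, e6] at e3
  refine ⟨?_, by linarith⟩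
  by_contra hc
  have := mul_nonneg (real_inner_self_nonneg (x := x7 - x5)) (not_lt.1 hc)
  nlinarith [mul_pos (sub_pos.2 h5) h7]

/-- If the edge `x₀x₂` crosses `x₁x₃` at a right angle and `x₂` lies on the near side of `x₁x₃`,
then `x₃` is not below the line through `x₁` orthogonal to `x₀`. -/
theorem inner_le_of_perp_crossing {x0 x1 x2 x3 : Plane} (h01 : 0 < det x0 x1)
    (hN : inner ℝ x1 x0 < inner ℝ x0 x0) (h13 : 0 ≤ det x1 x3) (hn : Near x1 x3 x2)
    (hp : inner ℝ (x3 - x1) (x2 - x0) = 0)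
    (hX : (openSegment ℝ x1 x3 ∩ openSegment ℝ x0 x2).Nonempty) :
    inner ℝ x1 x0 ≤ inner ℝ x3 x0 := by
  have hne : x1 ≠ x3 := by
    rintro rfl
    rcases hn with h | h
    · have := det_comm x1 x1
      linarith [h.1, h.2.1, h.2.2]
    · have := det_comm x1 x1
      linarith [h.1, h.2.1, h.2.2]
  have h1 := inner_pos_of_perp_crossing hne hp hX
  obtain ⟨n1, n2, n3⟩ : 0 < det x1 x2 ∧ 0 < det x2 x3 ∧ det x1 x2 + det x2 x3 < det x1 x3 := by
    rcases hn with h | h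
    · exact h
    · linarith [h.1, h.2.1, h.2.2, det_comm x1 x3]
  have hne' : x2 - x0 ≠ 0 := by
    intro h0
    rw [sub_eq_zero] at h0
    subst h0
    linarith [det_comm x1 x2]
  have hD := det_ne_zero_of_inner_eq_zero (sub_ne_zero.2 hne.symm) hne' hp
  have hop := det_mul_det_neg_of_inter hD hX
  have e2 : det (x3 - x1) (x2 - x1) = det x1 x3 - (det x1 x2 + det x2 x3) := by
    simp only [det, PiLp.sub_apply]; ring
  have h2 : det (x3 - x1) (x0 - x1) < 0 := by
    rw [e2] at hop
    by_contra hc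
    nlinarith
  by_contra hc
  -- Compare the vectors `x₃ - x₁` and `x₀ - x₁` in the orthogonal coordinates given by `x₀`: the
  -- first one would point down, the second one points up, they form an acute angle, and the second
  -- one is on the right of the first one.
  have hr : inner ℝ (x3 - x1) x0 < 0 := by rw [inner_sub_left]; linarith
  have hw : 0 < inner ℝ (x0 - x1) x0 := by rw [inner_sub_left]; linarith
  have hwd : det (x0 - x1) x0 = det x0 x1 := by
    simp only [det, PiLp.sub_apply]; ring
  have e3 : inner ℝ x0 x0 * inner ℝ (x3 - x1) (x0 - x1) =
      inner ℝ (x3 - x1) x0 * inner ℝ (x0 - x1) x0 + det (x3 - x1) x0 * det (x0 - x1) x0 := by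
    simp only [inner_eq, det]; ring
  have e4 : inner ℝ x0 x0 * det (x3 - x1) (x0 - x1) =
      det (x3 - x1) x0 * inner ℝ (x0 - x1) x0 - inner ℝ (x3 - x1) x0 * det (x0 - x1) x0 := by
    simp only [inner_eq, det]; ring
  rw [hwd] at e3 e4
  have h0 := real_inner_self_nonneg (x := x0)
  have hr2 : 0 < det (x3 - x1) x0 := by
    by_contra hc
    nlinarith [mul_nonneg h0 h1.le, mul_pos (neg_pos.2 hr) hw,
      mul_nonneg (neg_nonneg.2 (not_lt.1 hc)) h01.le]
  nlinarith [mul_nonneg h0 (neg_nonneg.2 h2.le), mul_pos hr2 hw, mul_pos (neg_pos.2 hr) h01]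

/-- Vectors in an open half plane do not turn counterclockwise all the way round. -/
theorem not_cyclic_in_halfPlane {n a b c d : Plane} (ha : 0 < inner ℝ a n) (hb : 0 < inner ℝ b n)
    (hc : 0 < inner ℝ c n) (hd : 0 < inner ℝ d n) (hab : 0 < det a b) (hbc : 0 ≤ det b c)
    (hcd : 0 ≤ det c d) (hda : 0 ≤ det d a) : False := by
  have h0 : 0 ≤ inner ℝ n n := real_inner_self_nonneg
  have hbd : 0 ≤ det b d := by
    have : inner ℝ c n * det b d = inner ℝ d n * det b c + inner ℝ b n * det c d := by
      simp only [inner_eq, det]; ring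
    by_contra h
    nlinarith [mul_nonneg hd.le hbc, mul_nonneg hb.le hcd, mul_pos hc (neg_pos.2 (not_le.1 h))]
  have hba : 0 ≤ det b a := by
    have : inner ℝ d n * det b a = inner ℝ a n * det b d + inner ℝ b n * det d a := by
      simp only [inner_eq, det]; ring
    by_contra h
    nlinarith [mul_nonneg ha.le hbd, mul_nonneg hb.le hda, mul_pos hd (neg_pos.2 (not_le.1 h))]
  rw [det_comm] at hba
  linarith

/-- Two successive turns by acute angles to the left make up a turn to the left. -/
theorem det_nonneg_of_acute {a b c : Plane} (h1 : 0 ≤ det a c) (h2 : 0 ≤ det c b)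
    (h3 : 0 < inner ℝ a c) (h4 : 0 ≤ inner ℝ b c) : 0 ≤ det a b := by
  have h0 : 0 < inner ℝ c c := by
    rw [real_inner_self_eq_norm_sq]
    have : c ≠ 0 := by rintro rfl; simp at h3
    positivity
  have k := det_mul_norm_sq a b c
  by_contra h
  nlinarith only [k, mul_pos h0 (neg_pos.2 (not_le.1 h)), mul_nonneg h1 h4, mul_nonneg h3.le h2]

theorem far_mirror {a b w : Plane} : Far (mirror a) (mirror b) (mirror w) ↔ Far a b w := by
  simp only [Far, det_mirror]
  constructor
  · rintro (⟨h0, h1, h2, h3⟩ | ⟨h0, h1, h2, h3⟩)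
    · exact .inr ⟨h0, h2, h1, by linarith⟩
    · exact .inl ⟨h0, h2, h1, by linarith⟩
  · rintro (⟨h0, h1, h2, h3⟩ | ⟨h0, h1, h2, h3⟩)
    · exact .inr ⟨h0, h2, h1, by linarith⟩
    · exact .inl ⟨h0, h2, h1, by linarith⟩

theorem mirror_segments_inter {a b c d : Plane}
    (h : (openSegment ℝ a b ∩ openSegment ℝ c d).Nonempty) :
    (openSegment ℝ (mirror a) (mirror b) ∩ openSegment ℝ (mirror c) (mirror d)).Nonempty := by
  rw [← mirror_image_openSegment, ← mirror_image_openSegment,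
    ← image_inter mirror_injective, image_nonempty]
  exact h

end Plane

namespace ASAVertex

attribute [local irreducible] nearBit crossBit signBit

theorem relPos_eight (q : ASAVertex → Plane) : relPos q 8 = 0 := sub_self _

theorem segments_inter_of_crossing {q : ASAVertex → Plane} {e f : ℕ} (h : crossing q e f) :
    (openSegment ℝ (relPos q (edgeFst e)) (relPos q (edgeSnd e)) ∩
      openSegment ℝ (relPos q (edgeFst f)) (relPos q (edgeSnd f))).Nonempty := by
  obtain ⟨-, z, hz1, hz2⟩ := h
  refine ⟨-q none + z, ?_, ?_⟩
  · have := (mem_openSegment_translate ℝ (-q none)).2 hz1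
    simpa [relPos, sub_eq_neg_add] using this
  · have := (mem_openSegment_translate ℝ (-q none)).2 hz2
    simpa [relPos, sub_eq_neg_add] using this

theorem inner_eq_zero_of_crossing {q : ASAVertex → Plane}
    (hq : IsRACDrawing augmentedSquareAntiprism q) {e f : ℕ} (he : e < 24) (hf : f < 24)
    (h : crossing q e f) : inner ℝ (relPos q (edgeSnd e) - relPos q (edgeFst e))
      (relPos q (edgeSnd f) - relPos q (edgeFst f)) = 0 := by
  have := hq.right_angle _ _ _ _ (adj_edge e he) (adj_edge f hf) h
  simpa [relPos] using this

theorem inner_eq_zero_of_crossing_spoke {q : ASAVertex → Plane}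
    (hq : IsRACDrawing augmentedSquareAntiprism q) {e z : ℕ} (he : e < 16) (hz : z < 8)
    (h : crossing q e (16 + z)) :
    inner ℝ (relPos q (edgeSnd e) - relPos q (edgeFst e)) (relPos q z) = 0 := by
  have := inner_eq_zero_of_crossing hq (by omega) (by omega) h
  rw [(spoke_ends z hz).1, (spoke_ends z hz).2, relPos_eight, zero_sub, inner_neg_right,
    neg_eq_zero] at this
  exact this

/-- What the spurious goals say about a drawing. -/
theorem facts_of_spuriousGoals {q : ASAVertex → Plane} {y : ℕ → Plane} (hy : IsPerturbation q y)
    {m : ℕ} (hm : m ∈ spuriousGoals) (h : (modelOf q y).Holds m) :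
    (0 ≤ det (relPos q 0) (relPos q 1) ∧
      ((Near (relPos q 5) (relPos q 7) (relPos q 0) ∧ crossing q 13 14 ∧
          (0 ≤ det (relPos q 0) (relPos q 6) ∨
            0 ≤ det (relPos q 0) (relPos q 5) ∧ 0 ≤ det (relPos q 5) (relPos q 6))) ∨
        (Near (relPos q 1) (relPos q 3) (relPos q 0) ∧ crossing q 9 8 ∧
          (0 ≤ det (relPos q 2) (relPos q 0) ∨
            0 ≤ det (relPos q 3) (relPos q 0) ∧ 0 ≤ det (relPos q 2) (relPos q 3))) ∨
        (Near (relPos q 1) (relPos q 3) (relPos q 2) ∧ crossing q 9 8 ∧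
          Near (relPos q 5) (relPos q 7) (relPos q 6) ∧ crossing q 13 14 ∧
          0 ≤ det (relPos q 1) (relPos q 3) ∧ 0 ≤ det (relPos q 3) (relPos q 5) ∧
          0 ≤ det (relPos q 5) (relPos q 7)))) ∨
    (0 ≤ det (relPos q 3) (relPos q 4) ∧ 0 ≤ det (relPos q 4) (relPos q 5) ∧
      0 ≤ det (relPos q 5) (relPos q 3)) := by
  have sgn : ∀ a < 8, ∀ b < 8, (modelOf q y).Holds (signBit a b) →
      0 ≤ det (relPos q a) (relPos q b) := fun a ha b hb h =>
    det_nonneg_of_perturbation hy ha hb ((Model.holds_signBit hb ha).1 h)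
  have nr : ∀ e < 16, ∀ z < 8, (modelOf q y).Holds (nearBit e z) →
      nearVertex q e z := fun e he z hz h => (Model.holds_nearBit he hz).1 h
  have cr : ∀ e f, f < 24 → (modelOf q y).Holds (crossBit e f) →
      crossing q e f := fun e f hf h => (Model.holds_crossBit hf).1 h
  simp only [spuriousGoals, List.mem_cons, List.not_mem_nil, or_false] at hm
  rcases hm with rfl | rfl | rfl | rfl | rfl | rfl <;> rw [Model.holds_mask] at h <;>
    simp only [List.forall_mem_cons, List.not_mem_nil, false_imp_iff, imp_true_iff, and_true] at h
  · obtain ⟨g1, g2, g3, g4⟩ := h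
    exact .inl ⟨sgn 0 (by omega) 1 (by omega) g4, .inl ⟨nr 13 (by omega) 0 (by omega) g1,
      cr 13 14 (by omega) g2, .inl (sgn 0 (by omega) 6 (by omega) g3)⟩⟩
  · obtain ⟨g1, g2, g3, g5, g4⟩ := h
    exact .inl ⟨sgn 0 (by omega) 1 (by omega) g4, .inl ⟨nr 13 (by omega) 0 (by omega) g1,
      cr 13 14 (by omega) g2, .inr ⟨sgn 0 (by omega) 5 (by omega) g3,
        sgn 5 (by omega) 6 (by omega) g5⟩⟩⟩
  · obtain ⟨g1, g2, g3, g4⟩ := h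
    exact .inl ⟨sgn 0 (by omega) 1 (by omega) g4, .inr (.inl ⟨nr 9 (by omega) 0 (by omega) g1,
      cr 9 8 (by omega) g2, .inl (sgn 2 (by omega) 0 (by omega) g3)⟩)⟩
  · obtain ⟨g1, g2, g3, g5, g4⟩ := h
    exact .inl ⟨sgn 0 (by omega) 1 (by omega) g4, .inr (.inl ⟨nr 9 (by omega) 0 (by omega) g1,
      cr 9 8 (by omega) g2, .inr ⟨sgn 3 (by omega) 0 (by omega) g3,
        sgn 2 (by omega) 3 (by omega) g5⟩⟩)⟩
  · obtain ⟨g1, g2, g3, g4, g5, g6, g7, g8⟩ := h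
    exact .inl ⟨sgn 0 (by omega) 1 (by omega) g8, .inr (.inr ⟨nr 9 (by omega) 2 (by omega) g1,
      cr 9 8 (by omega) g2, nr 13 (by omega) 6 (by omega) g3, cr 13 14 (by omega) g4,
      sgn 1 (by omega) 3 (by omega) g5, sgn 3 (by omega) 5 (by omega) g6,
      sgn 5 (by omega) 7 (by omega) g7⟩)⟩
  · obtain ⟨g1, g2, g3⟩ := h
    exact .inr ⟨sgn 3 (by omega) 4 (by omega) g1, sgn 4 (by omega) 5 (by omega) g2,
      sgn 5 (by omega) 3 (by omega) g3⟩

theorem perp_segments_of_crossing {q : ASAVertex → Plane}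
    (hq : IsRACDrawing augmentedSquareAntiprism q) {e f : ℕ} (he : e < 24) (hf : f < 24)
    (h : crossing q e f) {a b c d : ℕ} (ha : edgeFst e = a) (hb : edgeSnd e = b)
    (hc : edgeFst f = c) (hd : edgeSnd f = d) :
    inner ℝ (relPos q b - relPos q a) (relPos q d - relPos q c) = 0 ∧
      (openSegment ℝ (relPos q a) (relPos q b) ∩
        openSegment ℝ (relPos q c) (relPos q d)).Nonempty := by
  subst ha hb hc hd
  exact ⟨inner_eq_zero_of_crossing hq he hf h, segments_inter_of_crossing h⟩

/-- The spurious configurations contradict the right angles. With `x₀` as the upward direction,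
`x₇` and `x₁` are at the same positive height. In the first two cases an edge at `x₀` would have
to turn to the wrong side, in the third one `x₁`, `x₃`, `x₅`, `x₇` would be above the center
although they run around it, and in the last one two acute angles would add up to more than `π`. -/
theorem not_spurious {q : ASAVertex → Plane} (hq : IsRACDrawing augmentedSquareAntiprism q)
    {y : ℕ → Plane} (hy : IsPerturbation q y) (h0 : crossing q (midEdge 0) (16 + 0))
    (h3 : crossing q (midEdge 3) (16 + 3)) (h5 : crossing q (midEdge 5) (16 + 5)) (m : ℕ)
    (hm : m ∈ spuriousGoals) : ¬ (modelOf q y).Holds m := by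
  intro hm'
  have f0 := (crossing_spoke_iff hq (by decide) (by omega)).1 h0
  have f3 := (crossing_spoke_iff hq (by decide) (by omega)).1 h3
  have f5 := (crossing_spoke_iff hq (by decide) (by omega)).1 h5
  have p0 := inner_eq_zero_of_crossing_spoke hq (by decide) (by omega) h0
  have p3 := inner_eq_zero_of_crossing_spoke hq (by decide) (by omega) h3
  have p5 := inner_eq_zero_of_crossing_spoke hq (by decide) (by omega) h5
  simp only [show edgeFst (midEdge 0) = 7 from rfl, show edgeSnd (midEdge 0) = 1 from rfl,
    show edgeFst (midEdge 3) = 2 from rfl, show edgeSnd (midEdge 3) = 4 from rfl,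
    show edgeFst (midEdge 5) = 4 from rfl, show edgeSnd (midEdge 5) = 6 from rfl]
    at f0 f3 f5 p0 p3 p5
  -- Edges 13, 14, 9 and 8 join `x₅x₇`, `x₆x₀`, `x₁x₃` and `x₀x₂`.
  have c1 : ∀ (_ : crossing q 13 14), _ ∧ _ := fun h =>
    perp_segments_of_crossing hq (by omega) (by omega) h (a := 5) (b := 7) (c := 6) (d := 0)
      rfl rfl rfl rfl
  have c2 : ∀ (_ : crossing q 9 8), _ ∧ _ := fun h =>
    perp_segments_of_crossing hq (by omega) (by omega) h (a := 1) (b := 3) (c := 0) (d := 2)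
      rfl rfl rfl rfl
  have d53 := det_relPos_edge_ne_zero hq (e := 11) (by omega)
  rw [show edgeFst 11 = 3 from rfl, show edgeSnd 11 = 5 from rfl] at d53
  have hh := facts_of_spuriousGoals hy hm hm'
  clear hm hm' hy h0 h3 h5
  generalize relPos q 0 = x0 at *
  generalize relPos q 1 = x1 at *
  generalize relPos q 2 = x2 at *
  generalize relPos q 3 = x3 at *
  generalize relPos q 4 = x4 at *
  generalize relPos q 5 = x5 at *
  generalize relPos q 6 = x6 at *
  generalize relPos q 7 = x7 at *
  have t3 := inner_pos_of_far f3 p3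
  have t5 := inner_pos_of_far f5 p5
  rcases hh with ⟨s01, hh⟩ | ⟨g1, g2, g3⟩
  swap
  · have := det_nonneg_of_acute g1 g2 (by rw [real_inner_comm]; exact t3.2.1)
      (by rw [real_inner_comm]; exact t5.1.le)
    rw [det_comm] at this
    exact d53 (by rw [det_comm]; linarith)
  obtain ⟨s01, s70, s71⟩ : 0 < det x0 x1 ∧ 0 < det x7 x0 ∧ 0 < det x7 x1 := by
    rcases f0 with h | h
    · exact ⟨h.2.2.1, h.2.1, h.1⟩
    · linarith [h.2.1, det_comm x0 x1]
  -- The spurious goals that are mirror images are treated by the reflected drawing.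
  have f0' : Far (mirror x1) (mirror x7) (mirror x0) := (far_mirror.2 f0).swap
  have p0' : inner ℝ (mirror x7 - mirror x1) (mirror x0) = 0 := by
    rw [mirror_sub, inner_mirror, ← neg_sub, inner_neg_left, p0, neg_zero]
  obtain ⟨t7, t1, t71, tN⟩ := inner_pos_of_far f0 p0
  rcases hh with ⟨g1, g2, g3⟩ | ⟨g1, g2, g3⟩ | ⟨g1, g2, g3, g4, g5, g6, g7⟩
  · have := det_neg_of_near_triangle f0 p0 s01.le g1 (c1 g2).1 (c1 g2).2
    refine absurd this.1 (not_lt.2 ?_)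
    rcases g3 with g3 | ⟨g3, g4⟩
    · exact g3
    · exact det_nonneg_of_acute g3 g4 this.2 t5.2.1.le
  · have := det_neg_of_near_triangle (x5 := mirror x3) (x6 := mirror x2) f0' p0'
      (by rw [det_mirror]; exact s70.le) (near_mirror.2 g1.swap)
      (by
        rw [mirror_sub, mirror_sub, inner_mirror, ← neg_sub, inner_neg_left, ← neg_sub x2,
          inner_neg_right, neg_neg]
        exact (c2 g2).1)
      (by
        have := mirror_segments_inter (c2 g2).2
        rwa [openSegment_symm, openSegment_symm _ (mirror x2)])
    rw [det_mirror, inner_mirror] at this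
    refine absurd this.1 (not_lt.2 ?_)
    rcases g3 with g3 | ⟨g3, g4⟩
    · exact g3
    · exact det_nonneg_of_acute g4 g3 t3.1 this.2.le
  · have k3 := inner_le_of_perp_crossing s01 (t71 ▸ tN) g5 g1 (c2 g2).1 (c2 g2).2
    have k5 := inner_le_of_perp_crossing (x0 := mirror x0) (x1 := mirror x7)
      (x2 := mirror x6) (x3 := mirror x5) (by rw [det_mirror]; exact s70)
      (by rw [inner_mirror, inner_mirror]; linarith) (by rw [det_mirror]; exact g7)
      (near_mirror.2 g3.swap)
      (by
        rw [mirror_sub, mirror_sub, inner_mirror, ← neg_sub, inner_neg_left, ← neg_sub x0,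
          inner_neg_right, neg_neg]
        exact (c1 g4).1)
      (by
        have := mirror_segments_inter (c1 g4).2
        rwa [openSegment_symm, openSegment_symm _ (mirror x0)])
    rw [inner_mirror, inner_mirror] at k5
    exact not_cyclic_in_halfPlane t7 t1 (t1.trans_le k3) (t7.trans_le k5) s71 g5 g6 g7

/-- The models of RAC drawings are closed under the symmetries, as these only relabel the
vertices. -/
theorem isFamily_drawingFamily : IsFamily drawingFamily where
  lawful := by
    rintro M ⟨q, y, hq, hy, rfl⟩
    exact lawful_modelOf hq hy
  orient := by
    rintro M ⟨q, y, hq, hy, rfl⟩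
    have h := det_relPos_edge_ne_zero hq (e := 0) (by omega)
    rcases lt_or_gt_of_ne h with h | h
    · obtain ⟨y', hy'⟩ := exists_isPerturbation hq.mirror
      refine ⟨_, ⟨_, y', hq.mirror, hy', rfl⟩, hy'.2 0 (by omega) 1 (by omega) ?_, ?_, ?_⟩
      · rw [relPos_mirror, relPos_mirror, det_mirror, det_comm]
        exact neg_pos.2 h
      · ext e f; exact edgesCross_mirror
      · ext e z
        change Near _ _ _ ↔ Near _ _ _
        rw [relPos_mirror, relPos_mirror, relPos_mirror, near_mirror]
    · exact ⟨_, ⟨q, y, hq, hy, rfl⟩, hy.2 0 (by omega) 1 (by omega) h, rfl, rfl⟩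
  shift := by
    rintro M ⟨q, y, hq, hy, rfl⟩
    have hq' := hq.comp shiftIso.toEmbedding
    obtain ⟨y', hy'⟩ := exists_isPerturbation hq'
    refine ⟨_, ⟨_, y', hq', hy', rfl⟩, fun e he f hf h => ?_, fun e he z hz h => ?_⟩
    · refine (edgesCross_comp shift.injective).2 ?_
      rw [← (shift_edge e he).1, ← (shift_edge e he).2, ← (shift_edge f hf).1,
        ← (shift_edge f hf).2]
      exact h
    · have h' : Near (q (ofNat (edgeFst (shiftE e))) - q none)
        (q (ofNat (edgeSnd (shiftE e))) - q none) (q (ofNat (shiftV z)) - q none) := h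
      rw [(shift_edge e (by omega)).1, (shift_edge e (by omega)).2, shift_ofNat z hz] at h'
      exact h'
  refl := by
    rintro M ⟨q, y, hq, hy, rfl⟩
    have hq' := hq.comp flipIso.toEmbedding
    obtain ⟨y', hy'⟩ := exists_isPerturbation hq'
    refine ⟨_, ⟨_, y', hq', hy', rfl⟩, fun e he f hf h => ?_, fun e he z hz h => ?_⟩
    · refine (edgesCross_comp ASAVertex.flip.injective).2 ?_
      replace h : EdgesCross q _ _ _ _ := h
      rcases flip_edge e he with h1 | h1 <;> rcases flip_edge f hf with h2 | h2 <;>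
        rw [← h1.1, ← h1.2, ← h2.1, ← h2.2]
      · exact h
      · rwa [edgesCross_swap_right]
      · rwa [edgesCross_swap_left]
      · rwa [edgesCross_swap_left, edgesCross_swap_right]
    · have h' : Near (q (ofNat (edgeFst (reflE e))) - q none)
        (q (ofNat (edgeSnd (reflE e))) - q none) (q (ofNat (reflV z)) - q none) := h
      rw [flip_ofNat z hz] at h'
      change Near (q (ASAVertex.flip _) - q none) (q (ASAVertex.flip _) - q none)
        (q (ASAVertex.flip _) - q none)
      rcases flip_edge e (by omega) with h1 | h1 <;> rw [← h1.1, ← h1.2]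
      · exact h'
      · exact h'.swap
  not_spurious := by
    rintro M ⟨q, y, hq, hy, rfl⟩ h0 h3 h5
    exact not_spurious hq hy h0 h3 h5

/-- In a RAC drawing the spokes are in the cyclic order of the zigzag, and the spokes of one of the
quadrilaterals cross the edges of the other one. -/
theorem exists_nested {q : ASAVertex → Plane} (hq : IsRACDrawing augmentedSquareAntiprism q)
    (h : 0 < det (relPos q 0) (relPos q 1)) :
    (∀ j < 8, 0 < det (relPos q j) (relPos q ((j + 1) % 8))) ∧
    ((∀ j < 8, j % 2 = 1 → crossing q (midEdge j) (16 + j)) ∨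
      (∀ j < 8, j % 2 = 0 → crossing q (midEdge j) (16 + j))) := by
  obtain ⟨y, hy⟩ := exists_isPerturbation hq
  obtain ⟨h1, h2⟩ := isFamily_drawingFamily.nested_squares ⟨q, y, hq, hy, rfl⟩
    (hy.2 0 (by omega) 1 (by omega) h)
  refine ⟨fun j hj => lt_of_le_of_ne
    (det_nonneg_of_perturbation hy hj (by omega) (h1 j hj)) fun h => ?_, h2⟩
  refine det_relPos_edge_ne_zero hq (e := j) (by omega) ?_
  have : edgeFst j = j ∧ edgeSnd j = (j + 1) % 8 := by interval_cases j <;> decide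
  rw [this.1, this.2]
  exact h.symm

end ASAVertex

end

/-! ### Standard drawings -/

noncomputable section

open RACSearch Plane ASAVertex

namespace ASAVertex

/-- The vertex `a i`, relative to the center. -/
def innerVec (p : ASAVertex → Plane) (i : ZMod 4) : Plane := p (quad false i) - p center

/-- The vertex `b i`, relative to the center. -/
def outerVec (p : ASAVertex → Plane) (i : ZMod 4) : Plane := p (quad true i) - p center

/-- A RAC drawing in standard position: the spokes are in counterclockwise order `a 0`, `b 0`,
`a 1`, …, and the spoke of `b i` crosses the edge from `a i` to `a (i + 1)`. -/
structure IsStandard (p : ASAVertex → Plane) : Prop where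
  rac : IsRACDrawing augmentedSquareAntiprism p
  det_inner_outer : ∀ i, 0 < det (innerVec p i) (outerVec p i)
  det_outer_inner : ∀ i, 0 < det (outerVec p i) (innerVec p (i + 1))
  far : ∀ i, Far (innerVec p i) (innerVec p (i + 1)) (outerVec p i)

theorem ofNat_two_mul : ∀ i : ZMod 4, ofNat (2 * i.val) = quad false i ∧
    ofNat (2 * i.val + 1) = quad true i ∧ ofNat ((2 * i.val + 2) % 8) = quad false (i + 1) ∧
    ofNat ((2 * i.val + 3) % 8) = quad true (i + 1) ∧
    edgeFst (midEdge (2 * i.val + 1)) = 2 * i.val ∧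
    edgeSnd (midEdge (2 * i.val + 1)) = (2 * i.val + 2) % 8 ∧
    edgeFst (midEdge ((2 * i.val + 2) % 8)) = 2 * i.val + 1 ∧
    edgeSnd (midEdge ((2 * i.val + 2) % 8)) = (2 * i.val + 3) % 8 ∧ i.val < 4 := by
  decide +kernel

theorem isStandard_of_det_pos {q : ASAVertex → Plane}
    (hq : IsRACDrawing augmentedSquareAntiprism q) (h : 0 < det (relPos q 0) (relPos q 1)) :
    IsStandard q ∨ IsStandard (q ∘ shift) := by
  obtain ⟨h1, h2⟩ := exists_nested hq h
  have hA : ∀ i : ZMod 4, relPos q (2 * i.val) = innerVec q i := fun i => by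
    rw [relPos, (ofNat_two_mul i).1]; rfl
  have hB : ∀ i : ZMod 4, relPos q (2 * i.val + 1) = outerVec q i := fun i => by
    rw [relPos, (ofNat_two_mul i).2.1]; rfl
  have hA' : ∀ i : ZMod 4, relPos q ((2 * i.val + 2) % 8) = innerVec q (i + 1) := fun i => by
    rw [relPos, (ofNat_two_mul i).2.2.1]; rfl
  have hB' : ∀ i : ZMod 4, relPos q ((2 * i.val + 3) % 8) = outerVec q (i + 1) := fun i => by
    rw [relPos, (ofNat_two_mul i).2.2.2.1]; rfl
  have d1 : ∀ i, 0 < det (innerVec q i) (outerVec q i) := fun i => by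
    obtain ⟨-, -, -, -, -, -, -, -, hi⟩ := ofNat_two_mul i
    have := h1 (2 * i.val) (by omega)
    rwa [hA, Nat.mod_eq_of_lt (by omega), hB] at this
  have d2 : ∀ i, 0 < det (outerVec q i) (innerVec q (i + 1)) := fun i => by
    obtain ⟨-, -, -, -, -, -, -, -, hi⟩ := ofNat_two_mul i
    have := h1 (2 * i.val + 1) (by omega)
    rwa [hB, hA'] at this
  rcases h2 with h2 | h2
  · refine .inl ⟨hq, d1, d2, fun i => ?_⟩
    obtain ⟨-, -, -, -, e1, e2, -, -, hi⟩ := ofNat_two_mul i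
    have := (crossing_spoke_iff hq (by unfold midEdge; omega) (by omega)).1
      (h2 (2 * i.val + 1) (by omega) (by omega))
    rwa [e1, e2, hA, hA', hB] at this
  · refine .inr ⟨hq.comp shiftIso.toEmbedding, fun i => d2 i, fun i => d1 (i + 1), fun i => ?_⟩
    obtain ⟨-, -, -, -, -, -, e1, e2, hi⟩ := ofNat_two_mul i
    have := (crossing_spoke_iff hq (by unfold midEdge; omega) (by omega)).1
      (h2 ((2 * i.val + 2) % 8) (by omega) (by omega))
    rwa [e1, e2, hB, hB', hA'] at this

theorem mirror_comp_mirror {V : Type*} (p : V → Plane) : mirror ∘ mirror ∘ p = p := by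
  ext1 v; exact mirror_mirror _

/-- Up to a reflection and an exchange of the quadrilaterals, every RAC drawing is standard. -/
theorem exists_isStandard {q : ASAVertex → Plane}
    (hq : IsRACDrawing augmentedSquareAntiprism q) :
    ∃ q', (q' = q ∨ q' = mirror ∘ q) ∧ (IsStandard q' ∨ IsStandard (q' ∘ shift)) := by
  have h := det_relPos_edge_ne_zero hq (e := 0) (by omega)
  rcases lt_or_gt_of_ne h with h | h
  · refine ⟨_, .inr rfl, isStandard_of_det_pos hq.mirror ?_⟩
    rw [relPos_mirror, relPos_mirror, det_mirror, det_comm]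
    exact neg_pos.2 h
  · exact ⟨_, .inl rfl, isStandard_of_det_pos hq h⟩

theorem adj_center (k : Bool) (i : ZMod 4) : augmentedSquareAntiprism.Adj center (quad k i) := by
  revert k i; decide +kernel

theorem adj_quad (k : Bool) (i : ZMod 4) :
    augmentedSquareAntiprism.Adj (quad k i) (quad k (i + 1)) := by
  revert k i; decide +kernel

namespace IsStandard
variable {p : ASAVertex → Plane} (hp : IsStandard p)
include hp

/-- The reflection of the plane, combined with the reversal of the labels, preserves standard
position. -/
theorem mirror_flip : IsStandard (mirror ∘ p ∘ ASAVertex.flip) := by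
  have hA : ∀ i, innerVec (mirror ∘ p ∘ ASAVertex.flip) i = mirror (innerVec p (-i)) :=
    fun i => mirror_sub _ _
  have hB : ∀ i, outerVec (mirror ∘ p ∘ ASAVertex.flip) i = mirror (outerVec p (-i - 1)) :=
    fun i => mirror_sub _ _
  have e1 : ∀ i : ZMod 4, -(i + 1) = -i - 1 := fun i => by ring
  have e2 : ∀ i : ZMod 4, -i - 1 + 1 = -i := fun i => by ring
  refine ⟨(hp.rac.comp flipIso.toEmbedding).mirror, fun i => ?_, fun i => ?_, fun i => ?_⟩
  · rw [hA, hB, det_mirror]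
    simpa only [e2] using hp.det_outer_inner (-i - 1)
  · rw [hA, hB, det_mirror, e1]
    exact hp.det_inner_outer (-i - 1)
  · rw [hA, hB, hA, far_mirror, e1]
    simpa only [e2] using (hp.far (-i - 1)).swap

theorem far' (i : ZMod 4) : 0 < det (innerVec p i) (innerVec p (i + 1)) ∧
    det (innerVec p i) (innerVec p (i + 1)) <
      det (innerVec p i) (outerVec p i) + det (outerVec p i) (innerVec p (i + 1)) := by
  rcases hp.far i with h | h
  · exact ⟨h.1, h.2.2.2⟩
  · linarith [h.2.2.1, hp.det_inner_outer i, det_comm (innerVec p i) (outerVec p i)]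

theorem det_inner (i : ZMod 4) : 0 < det (innerVec p i) (innerVec p (i + 1)) := (hp.far' i).1

/-- The spoke of `b i` crosses the edge from `a i` to `a (i + 1)`. -/
theorem edgesCross (i : ZMod 4) :
    EdgesCross p (quad false i) (quad false (i + 1)) (quad true i) center :=
  (hp.rac.edgesCross_iff_far (adj_quad false i) (adj_center _ _) (adj_center _ _)).2
    (hp.far i)

/-- The crossing is at a right angle, hence the spoke of `b i` forms acute angles with those of
`a i` and `a (i + 1)`. -/
theorem inner_pos (i : ZMod 4) : 0 < inner ℝ (innerVec p i) (outerVec p i) ∧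
    0 < inner ℝ (innerVec p (i + 1)) (outerVec p i) := by
  have h := hp.rac.right_angle _ _ _ _ (adj_quad false i) (adj_center true i).symm
    (hp.edgesCross i)
  have h' : inner ℝ (innerVec p (i + 1) - innerVec p i) (outerVec p i) = 0 := by
    rw [innerVec, innerVec, outerVec, sub_sub_sub_cancel_right, ← neg_sub (p center),
      inner_neg_right, h, neg_zero]
  have := inner_pos_of_far (hp.far i) h'
  exact ⟨this.1, this.2.1⟩

theorem det_outer (i : ZMod 4) : 0 < det (outerVec p i) (outerVec p (i + 1)) := by
  have h1 := hp.det_outer_inner i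
  have h2 := hp.det_inner_outer (i + 1)
  have h3 := (hp.inner_pos i).2
  have h4 := (hp.inner_pos (i + 1)).1
  rw [real_inner_comm] at h3 h4
  have k := det_mul_norm_sq (outerVec p i) (outerVec p (i + 1)) (innerVec p (i + 1))
  refine pos_of_mul_pos_right (a := inner ℝ (innerVec p (i + 1)) (innerVec p (i + 1))) ?_
    real_inner_self_nonneg
  rw [k]; positivity

/-- The vertex `a (i + 1)` lies in the triangle of the center, `b i` and `b (i + 1)`. Otherwise
the edge from `b i` to `b (i + 1)` would cross the edge from `a i` to `a (i + 1)`, which already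
crosses another edge at `b i`. -/
theorem near (i : ZMod 4) : det (outerVec p i) (innerVec p (i + 1)) +
    det (innerVec p (i + 1)) (outerVec p (i + 1)) < det (outerVec p i) (outerVec p (i + 1)) := by
  have h1 := hp.det_outer_inner i
  have h2 := hp.det_inner_outer (i + 1)
  have h3 := hp.det_outer i
  rcases hp.rac.near_or_far_of_cone (w := quad false (i + 1)) (c := center) (adj_quad true i)
    (by simp) (by simp) (.inl ⟨h3, h1, h2⟩) with h | h
  · rcases h with h | h
    · exact h.2.2
    · have h4 : 0 < det (innerVec p (i + 1)) (outerVec p i) := h.2.1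
      linarith [det_comm (innerVec p (i + 1)) (outerVec p i)]
  · exfalso
    obtain ⟨z, hz1, hz2⟩ := cross_of_far_far (hp.far i) h
    refine hp.rac.not_edgesCross_fan (adj_quad false i) (adj_center true i).symm
      (adj_quad true i) (by simp) (hp.edgesCross i) ⟨?_, p center + z, ?_, ?_⟩
    · rw [Ne, Sym2.eq_iff]; simp
    · simpa [innerVec] using (mem_openSegment_translate ℝ (p center)).2 hz1
    · simpa [outerVec] using (mem_openSegment_translate ℝ (p center)).2 hz2

end IsStandard
end ASAVertex

end

/-! ### Star-shaped quadrilaterals -/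

noncomputable section

open Plane

namespace Star

variable (c : Plane) (P : ZMod 4 → Plane)

/-- The point `z` lies in the closed angle at `c` that is spanned by the `i`-th side. -/
def InCone (i : ZMod 4) (z : Plane) : Prop :=
  0 ≤ det (P i - c) (z - c) ∧ 0 ≤ det (z - c) (P (i + 1) - c)

/-- A linear function that vanishes on the `i`-th side and is negative at `c`. -/
def height (i : ZMod 4) (z : Plane) : ℝ :=
  det (P i - c) (z - c) + det (z - c) (P (i + 1) - c) - det (P i - c) (P (i + 1) - c)

/-- The closed region bounded by the polygon `P`, if `P` is star-shaped with respect to `c`. -/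
def lower : Set Plane := {z | ∃ i, InCone c P i z ∧ height c P i z ≤ 0}

/-- The closed exterior of the polygon. -/
def upper : Set Plane := {z | ∃ i, InCone c P i z ∧ 0 ≤ height c P i z}

/-- The polygon. -/
def curve : Set Plane := ⋃ i, segment ℝ (P i) (P (i + 1))

variable {c P}

/-- The angles of a polygon that turns counterclockwise around `c` cover the plane: otherwise all
its vertices would lie in a half plane. -/
theorem exists_inCone (hP : ∀ i, 0 < det (P i - c) (P (i + 1) - c)) (z : Plane) :
    ∃ i, InCone c P i z := by
  by_contra! h
  have h' : ∀ i, 0 ≤ det (P i - c) (z - c) → 0 < det (P (i + 1) - c) (z - c) := fun i hi => by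
    by_contra hc
    exact h i ⟨hi, by rw [det_comm]; linarith⟩
  have key : ∀ n : Plane, (∀ i, 0 < inner ℝ (P i - c) n) → False := fun n hn =>
    not_cyclic_in_halfPlane (hn 0) (hn (0 + 1)) (hn (0 + 1 + 1)) (hn (0 + 1 + 1 + 1))
      (hP 0) (hP _).le (hP _).le (by
        have h3 := hP (0 + 1 + 1 + 1)
        rw [(by decide : (0 : ZMod 4) + 1 + 1 + 1 + 1 = 0)] at h3
        exact h3.le)
  have e : ∀ x y : Plane, inner ℝ x (rot90 y) = - det x y := fun x y => by
    rw [inner_eq]; simp [rot90, det]; ring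
  by_cases h0 : ∃ i, 0 ≤ det (P i - c) (z - c)
  · obtain ⟨i, hi⟩ := h0
    have h1 := h' i hi
    have h2 := h' _ h1.le
    have h3 := h' _ h2.le
    have h4 := h' _ h3.le
    refine key (- rot90 (z - c)) fun j => ?_
    rw [inner_neg_right, e, neg_neg]
    have : j = i + 1 ∨ j = i + 1 + 1 ∨ j = i + 1 + 1 + 1 ∨ j = i + 1 + 1 + 1 + 1 :=
      (by decide : ∀ i j : ZMod 4, j = i + 1 ∨ j = i + 1 + 1 ∨ j = i + 1 + 1 + 1 ∨
        j = i + 1 + 1 + 1 + 1) i j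
    rcases this with rfl | rfl | rfl | rfl <;> assumption
  · push Not at h0
    refine key (rot90 (z - c)) fun j => ?_
    rw [e]
    linarith [h0 j]

/-- Opposite angles of a quadrilateral meet only in its center. -/
theorem eq_zero_of_opposite {a b d e z : Plane} (hab : 0 < det a b) (hbd : 0 < det b d)
    (hde : 0 < det d e) (hea : 0 < det e a) (h1 : 0 ≤ det a z) (h2 : 0 ≤ det z b)
    (h3 : 0 ≤ det d z) (h4 : 0 ≤ det z e) : z = 0 := by
  by_contra hz
  have hN := sq_add_sq_pos hz
  have key : ∀ x y, (z 0 ^ 2 + z 1 ^ 2) * det x y =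
      inner ℝ z x * det z y - det z x * inner ℝ z y := fun x y => by
    simp only [inner_eq, det]; ring
  have k1 := mul_pos hN hab
  have k2 := mul_pos hN hbd
  have k3 := mul_pos hN hde
  have k4 := mul_pos hN hea
  rw [key] at k1 k2 k3 k4
  rw [det_comm] at h1 h3
  clear key hab hbd hde hea hz
  generalize det z a = sa at *
  generalize det z b = sb at *
  generalize det z d = sd at *
  generalize det z e = se at *
  generalize inner ℝ z a = ta at *
  generalize inner ℝ z b = tb at *
  generalize inner ℝ z d = td at *
  generalize inner ℝ z e = te at *
  have hse : 0 < se ∨ 0 < sb := by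
    by_contra! hc
    have e1 : se = 0 := le_antisymm hc.1 h4
    have e2 : sb = 0 := le_antisymm hc.2 h2
    subst e1 e2
    have : 0 < tb := by
      by_contra hc; nlinarith
    nlinarith
  have s1 : 0 < (-sa) * (tb * se - te * sb) := by
    rcases hse with h | h
    · nlinarith [mul_pos k1 h, mul_nonneg k4.le h2]
    · nlinarith [mul_nonneg k1.le h4, mul_pos k4 h]
  have s2 : 0 < (-sd) * (te * sb - tb * se) := by
    rcases hse with h | h
    · nlinarith [mul_pos k2 h, mul_nonneg k3.le h2]
    · nlinarith [mul_nonneg k2.le h4, mul_pos k3 h]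
  have x1 := pos_of_mul_pos_right s1 h1
  have x2 := pos_of_mul_pos_right s2 h3
  linarith

/-- Adjacent angles meet in a ray, on which the height functions are proportional. -/
theorem height_adjacent {a b d z : Plane} (hab : 0 < det a b) (h1 : 0 ≤ det z b)
    (h2 : 0 ≤ det b z) : det a b * (det b z + det z d - det b d) =
      det b d * (det a z + det z b - det a b) := by
  have h : det z b = 0 := le_antisymm (by rw [det_comm]; linarith) h1
  have hb : b ≠ 0 := by rintro rfl; simp [det] at hab
  have hz : inner ℝ b b * det z d = inner ℝ z b * det b d := by
    have : inner ℝ b b * det z d = inner ℝ z b * det b d + det z b * inner ℝ d b := by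
      simp only [inner_eq, det]; ring
    rw [this, h]; ring
  have hz' : inner ℝ b b * det a z = inner ℝ z b * det a b := by
    have : inner ℝ b b * det a z = inner ℝ z b * det a b - det z b * inner ℝ a b := by
      simp only [inner_eq, det]; ring
    rw [this, h]; ring
  have hb2 : inner ℝ b b ≠ 0 := inner_self_ne_zero.2 hb
  apply mul_left_cancel₀ hb2
  rw [h, det_comm b z, h]
  linear_combination det a b * hz - det b d * hz'

/-- On common points of two of the angles the heights have the same sign. -/
theorem det_mul_height (hP : ∀ i, 0 < det (P i - c) (P (i + 1) - c)) {i j : ZMod 4} {z : Plane}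
    (hi : InCone c P i z) (hj : InCone c P j z) :
    det (P i - c) (P (i + 1) - c) * height c P j z =
      det (P j - c) (P (j + 1) - c) * height c P i z := by
  have hij : j = i ∨ j = i + 1 ∨ j = i + 1 + 1 ∨ i = j + 1 :=
    (by decide : ∀ i j : ZMod 4, j = i ∨ j = i + 1 ∨ j = i + 1 + 1 ∨ i = j + 1) i j
  rcases hij with rfl | rfl | rfl | rfl
  · rfl
  · exact height_adjacent (hP i) hi.2 hj.1
  · have hz : z - c = 0 := by
      refine eq_zero_of_opposite (hP i) (hP _) (hP _) ?_ hi.1 hi.2 hj.1 hj.2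
      have := hP (i + 1 + 1 + 1)
      rwa [(by decide : ∀ i : ZMod 4, i + 1 + 1 + 1 + 1 = i) i] at this
    simp only [height, hz]
    simp [det]; ring
  · exact (height_adjacent (hP j) hj.2 hi.1).symm

theorem notMem_lower (hP : ∀ i, 0 < det (P i - c) (P (i + 1) - c)) {i : ZMod 4} {z : Plane}
    (hi : InCone c P i z) (h : 0 < height c P i z) : z ∉ lower c P := by
  rintro ⟨j, hj, hj'⟩
  have := det_mul_height hP hi hj
  nlinarith [mul_pos (hP j) h, mul_nonneg (hP i).le (neg_nonneg.2 hj')]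

theorem notMem_upper (hP : ∀ i, 0 < det (P i - c) (P (i + 1) - c)) {i : ZMod 4} {z : Plane}
    (hi : InCone c P i z) (h : height c P i z < 0) : z ∉ upper c P := by
  rintro ⟨j, hj, hj'⟩
  have := det_mul_height hP hi hj
  nlinarith [mul_pos (hP j) (neg_pos.2 h), mul_nonneg (hP i).le hj']

theorem continuous_det {f g : Plane → Plane} (hf : Continuous f) (hg : Continuous g) :
    Continuous fun z => det (f z) (g z) := by
  simp only [det]; fun_prop

theorem continuous_height (i : ZMod 4) : Continuous (height c P i) := by
  have h1 : Continuous fun z : Plane => z - c := by fun_prop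
  exact ((continuous_det continuous_const h1).add (continuous_det h1 continuous_const)).sub
    continuous_const

theorem isClosed_inCone (i : ZMod 4) : IsClosed {z | InCone c P i z} := by
  have h1 : Continuous fun z : Plane => z - c := by fun_prop
  exact (isClosed_le continuous_const (continuous_det continuous_const h1)).inter
    (isClosed_le continuous_const (continuous_det h1 continuous_const))

theorem isClosed_lower : IsClosed (lower c P) := by
  have : lower c P = ⋃ i, ({z | InCone c P i z} ∩ {z | height c P i z ≤ 0}) := by
    ext z; simp [lower]
  rw [this]
  exact isClosed_iUnion_of_finite fun i =>
    (isClosed_inCone i).inter (isClosed_le (continuous_height i) continuous_const)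

theorem isClosed_upper : IsClosed (upper c P) := by
  have : upper c P = ⋃ i, ({z | InCone c P i z} ∩ {z | 0 ≤ height c P i z}) := by
    ext z; simp [upper]
  rw [this]
  exact isClosed_iUnion_of_finite fun i =>
    (isClosed_inCone i).inter (isClosed_le continuous_const (continuous_height i))

theorem mem_lower_or_mem_upper (hP : ∀ i, 0 < det (P i - c) (P (i + 1) - c)) (z : Plane) :
    z ∈ lower c P ∨ z ∈ upper c P := by
  obtain ⟨i, hi⟩ := exists_inCone hP z
  exact (le_total (height c P i z) 0).imp (fun h => ⟨i, hi, h⟩) (fun h => ⟨i, hi, h⟩)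

theorem mem_curve_of_mem (hP : ∀ i, 0 < det (P i - c) (P (i + 1) - c)) {z : Plane}
    (h1 : z ∈ lower c P) (h2 : z ∈ upper c P) : z ∈ curve P := by
  obtain ⟨i, hi, hi'⟩ := h1
  have h0 : height c P i z = 0 := by
    refine le_antisymm hi' (not_lt.1 fun h => notMem_upper hP hi h h2)
  refine mem_iUnion.2 ⟨i, ?_⟩
  have := mem_segment_of_det (hP i) hi.1 hi.2 (sub_eq_zero.1 h0)
  simpa using (mem_segment_translate ℝ c).2 this

theorem mem_of_mem_segment (hP : ∀ i, 0 < det (P i - c) (P (i + 1) - c)) {i : ZMod 4} {z : Plane}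
    (h : z ∈ segment ℝ (P i) (P (i + 1))) : InCone c P i z ∧ height c P i z = 0 := by
  obtain ⟨s, t, hs, ht, hst, rfl⟩ := h
  obtain rfl : s = 1 - t := by linarith
  have e1 : det (P i - c) ((1 - t) • P i + t • P (i + 1) - c) =
      t * det (P i - c) (P (i + 1) - c) := by
    simp only [det, PiLp.sub_apply, PiLp.add_apply, PiLp.smul_apply, smul_eq_mul]; ring
  have e2 : det ((1 - t) • P i + t • P (i + 1) - c) (P (i + 1) - c) =
      (1 - t) * det (P i - c) (P (i + 1) - c) := by
    simp only [det, PiLp.sub_apply, PiLp.add_apply, PiLp.smul_apply, smul_eq_mul]; ring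
  refine ⟨⟨?_, ?_⟩, ?_⟩
  · rw [e1]; exact mul_nonneg ht (hP i).le
  · rw [e2]; exact mul_nonneg hs (hP i).le
  · rw [height, e1, e2]; ring

theorem isBounded_lower (hP : ∀ i, 0 < det (P i - c) (P (i + 1) - c)) :
    Bornology.IsBounded (lower c P) := by
  have : lower c P ⊆ ⋃ i, Metric.closedBall c (‖P i - c‖ + ‖P (i + 1) - c‖) := by
    rintro z ⟨i, hi, hi'⟩
    refine mem_iUnion.2 ⟨i, ?_⟩
    have hD := hP i
    rw [height] at hi'
    rw [mem_closedBall_iff_norm]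
    have e : det (P i - c) (P (i + 1) - c) • (z - c) =
        det (z - c) (P (i + 1) - c) • (P i - c) + det (P i - c) (z - c) • (P (i + 1) - c) := by
      rw [ext_iff']
      simp only [det, PiLp.add_apply, PiLp.smul_apply, smul_eq_mul]
      constructor <;> ring
    have h2 := congrArg norm e
    rw [norm_smul, Real.norm_of_nonneg hD.le] at h2
    have h3 := norm_add_le (det (z - c) (P (i + 1) - c) • (P i - c))
      (det (P i - c) (z - c) • (P (i + 1) - c))
    rw [norm_smul, norm_smul, Real.norm_of_nonneg hi.1, Real.norm_of_nonneg hi.2] at h3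
    have n1 := norm_nonneg (P i - c)
    have n2 := norm_nonneg (P (i + 1) - c)
    have l1 := hi.1
    have l2 := hi.2
    by_contra hc
    nlinarith [mul_lt_mul_of_pos_left (not_le.1 hc) hD,
      mul_le_mul_of_nonneg_right
        (by linarith : det (z - c) (P (i + 1) - c) ≤ det (P i - c) (P (i + 1) - c)) n1,
      mul_le_mul_of_nonneg_right
        (by linarith : det (P i - c) (z - c) ≤ det (P i - c) (P (i + 1) - c)) n2]
  refine Bornology.IsBounded.subset ?_ this
  exact (Bornology.isBounded_iUnion).2 fun i => Metric.isBounded_closedBall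

/-- A point strictly inside the polygon lies in a bounded component of the complement of any set
that contains the polygon. -/
theorem isBounded_component (hP : ∀ i, 0 < det (P i - c) (P (i + 1) - c)) {D : Set Plane}
    (hD : curve P ⊆ D) {z : Plane} (hz : z ∉ D) (hz' : z ∉ upper c P) :
    Bornology.IsBounded (connectedComponentIn Dᶜ z) := by
  refine (isBounded_lower hP).subset ?_
  have h : connectedComponentIn Dᶜ z ⊆ (upper c P)ᶜ := by
    refine isPreconnected_connectedComponentIn.subset_left_of_subset_union
      (v := (lower c P)ᶜ)
      isClosed_upper.isOpen_compl (isClosed_lower (c := c) (P := P)).isOpen_compl ?_ ?_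
      ⟨z, mem_connectedComponentIn hz, hz'⟩
    · rw [disjoint_left]
      intro x h1 h2
      exact (mem_lower_or_mem_upper hP x).elim h2 h1
    · intro x hx
      by_contra hc
      simp only [mem_union, mem_compl_iff, not_or, not_not] at hc
      exact connectedComponentIn_subset _ _ hx (hD (mem_curve_of_mem hP hc.2 hc.1))
  exact fun x hx => (mem_lower_or_mem_upper hP x).resolve_right (h hx)

/-- A point strictly outside the polygon lies in an unbounded component of the complement of any
set in the closed region that the polygon bounds. -/
theorem not_isBounded_component (hP : ∀ i, 0 < det (P i - c) (P (i + 1) - c)) {D : Set Plane}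
    (hD : D ⊆ lower c P) {z : Plane} (hz : z ∉ lower c P) :
    ¬ Bornology.IsBounded (connectedComponentIn Dᶜ z) := by
  obtain ⟨i, hi⟩ := exists_inCone hP z
  have hh : 0 < height c P i z := not_le.1 fun h => hz ⟨i, hi, h⟩
  have hne : z - c ≠ 0 := by
    intro h0
    rw [height, h0] at hh
    have := hP i
    simp only [det, PiLp.zero_apply] at *
    linarith
  set ray : ℝ → Plane := fun s => c + s • (z - c) with hray
  have hcont : Continuous ray := by fun_prop
  have hmem : ∀ s, 1 ≤ s → ray s ∉ lower c P := by
    intro s hs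
    have e1 : det (P i - c) (ray s - c) = s * det (P i - c) (z - c) := by
      simp only [det, hray, PiLp.sub_apply, PiLp.add_apply, PiLp.smul_apply, smul_eq_mul]; ring
    have e2 : det (ray s - c) (P (i + 1) - c) = s * det (z - c) (P (i + 1) - c) := by
      simp only [det, hray, PiLp.sub_apply, PiLp.add_apply, PiLp.smul_apply, smul_eq_mul]; ring
    refine notMem_lower hP (i := i) ⟨?_, ?_⟩ ?_
    · rw [e1]; exact mul_nonneg (by linarith) hi.1
    · rw [e2]; exact mul_nonneg (by linarith) hi.2
    · rw [height, e1, e2]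
      rw [height] at hh
      nlinarith [hi.1, hi.2]
  have hsub : ray '' Ici 1 ⊆ connectedComponentIn Dᶜ z := by
    refine (isPreconnected_Ici.image _ hcont.continuousOn).subset_connectedComponentIn ?_ ?_
    · exact ⟨1, self_mem_Ici, by simp [hray]⟩
    · rintro _ ⟨s, hs, rfl⟩ hs'
      exact hmem s hs (hD hs')
  intro hb
  obtain ⟨R, hR⟩ := (hb.subset hsub).exists_norm_le
  have hn : 0 < ‖z - c‖ := norm_pos_iff.2 hne
  set s := max 1 ((R + ‖c‖ + 1) / ‖z - c‖) with hs
  have h1 := hR (ray s) ⟨s, mem_Ici.2 (le_max_left _ _), rfl⟩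
  have h2 : ‖s • (z - c)‖ ≤ ‖ray s‖ + ‖c‖ := by
    have : s • (z - c) = ray s - c := by simp [hray]
    rw [this]; exact norm_sub_le _ _
  rw [norm_smul, Real.norm_of_nonneg (le_trans zero_le_one (le_max_left _ _))] at h2
  have h3 : R + ‖c‖ + 1 ≤ s * ‖z - c‖ := by
    rw [← div_le_iff₀ hn]; exact le_max_right _ _
  linarith

theorem curve_subset_lower (hP : ∀ i, 0 < det (P i - c) (P (i + 1) - c)) :
    curve P ⊆ lower c P := by
  intro z hz
  obtain ⟨i, hi⟩ := mem_iUnion.1 hz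
  exact ⟨i, (mem_of_mem_segment hP hi).1, (mem_of_mem_segment hP hi).2.le⟩

theorem curve_subset_upper (hP : ∀ i, 0 < det (P i - c) (P (i + 1) - c)) :
    curve P ⊆ upper c P := by
  intro z hz
  obtain ⟨i, hi⟩ := mem_iUnion.1 hz
  exact ⟨i, (mem_of_mem_segment hP hi).1, (mem_of_mem_segment hP hi).2.ge⟩

/-- The interior of a star-shaped quadrilateral. -/
theorem curveInterior_curve (hP : ∀ i, 0 < det (P i - c) (P (i + 1) - c)) :
    curveInterior (curve P) = (upper c P)ᶜ := by
  ext z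
  constructor
  · rintro ⟨h1, h2⟩ h3
    refine not_isBounded_component hP (curve_subset_lower hP) (fun h4 => ?_) h2
    exact h1 (mem_curve_of_mem hP h4 h3)
  · intro h
    have h1 : z ∉ curve P := fun h' => h (curve_subset_upper hP h')
    exact ⟨h1, isBounded_component hP subset_rfl h1 h⟩

end Star

end

/-! ### Points and segments inside a star-shaped quadrilateral -/

noncomputable section

open Plane ASAVertex

namespace Star

variable {c : Plane} {P : ZMod 4 → Plane}

/-- The point `z` lies in the open angle at `c` that is spanned by the `i`-th side. -/
def InOpenCone (c : Plane) (P : ZMod 4 → Plane) (i : ZMod 4) (z : Plane) : Prop :=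
  0 < det (P i - c) (z - c) ∧ 0 < det (z - c) (P (i + 1) - c)

theorem InOpenCone.inCone {i : ZMod 4} {z : Plane} (h : InOpenCone c P i z) : InCone c P i z :=
  ⟨h.1.le, h.2.le⟩

/-- An open angle is disjoint from the other angles. -/
theorem InOpenCone.eq_of_inCone (hP : ∀ i, 0 < det (P i - c) (P (i + 1) - c)) {i j : ZMod 4}
    {z : Plane} (hi : InOpenCone c P i z) (hj : InCone c P j z) : i = j := by
  have hij : j = i ∨ j = i + 1 ∨ j = i + 1 + 1 ∨ i = j + 1 :=
    (by decide : ∀ i j : ZMod 4, j = i ∨ j = i + 1 ∨ j = i + 1 + 1 ∨ i = j + 1) i j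
  rcases hij with rfl | rfl | rfl | rfl
  · rfl
  · linarith [hi.2, hj.1, det_comm (z - c) (P (i + 1) - c)]
  · have hz : z - c = 0 := by
      refine eq_zero_of_opposite (hP i) (hP _) (hP _) ?_ hi.1.le hi.2.le hj.1 hj.2
      have := hP (i + 1 + 1 + 1)
      rwa [(by decide : ∀ i : ZMod 4, i + 1 + 1 + 1 + 1 = i) i] at this
    have := hi.1
    rw [hz] at this
    simp [det] at this
  · linarith [hi.1, hj.2, det_comm (z - c) (P (j + 1) - c)]

theorem center_notMem_upper (hP : ∀ i, 0 < det (P i - c) (P (i + 1) - c)) : c ∉ upper c P := by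
  have e : ∀ x y : Plane, det x (c - c) = 0 ∧ det (c - c) y = 0 := fun x y => by simp [det]
  refine notMem_upper hP (i := 0) ⟨(e _ 0).1.ge, (e 0 _).2.ge⟩ ?_
  rw [height, (e _ 0).1, (e 0 _).2]
  linarith [hP 0]

/-- The points of the `i`-th closed angle on the near side of the `i`-th side; for a polygon that
is star-shaped with respect to `c` this is a triangle. -/
def triangle (c : Plane) (P : ZMod 4 → Plane) (i : ZMod 4) : Set Plane :=
  {z | InCone c P i z ∧ height c P i z ≤ 0}

theorem triangle_subset_lower (i : ZMod 4) : triangle c P i ⊆ lower c P := fun _ h => ⟨i, h⟩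

theorem convex_triangle (i : ZMod 4) : Convex ℝ (triangle c P i) := by
  rintro x ⟨⟨h1, h2⟩, h3⟩ y ⟨⟨h4, h5⟩, h6⟩ s t hs ht hst
  obtain rfl : s = 1 - t := by linarith
  have e1 : det (P i - c) ((1 - t) • x + t • y - c) =
      (1 - t) * det (P i - c) (x - c) + t * det (P i - c) (y - c) := by
    simp only [det, PiLp.sub_apply, PiLp.add_apply, PiLp.smul_apply, smul_eq_mul]; ring
  have e2 : det ((1 - t) • x + t • y - c) (P (i + 1) - c) =
      (1 - t) * det (x - c) (P (i + 1) - c) + t * det (y - c) (P (i + 1) - c) := by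
    simp only [det, PiLp.sub_apply, PiLp.add_apply, PiLp.smul_apply, smul_eq_mul]; ring
  rw [height] at h3 h6
  refine ⟨⟨?_, ?_⟩, ?_⟩
  · rw [e1]; positivity
  · rw [e2]; positivity
  · rw [height, e1, e2]
    nlinarith [mul_le_mul_of_nonneg_left h3 hs, mul_le_mul_of_nonneg_left h6 ht]

theorem center_mem_triangle (hP : ∀ i, 0 < det (P i - c) (P (i + 1) - c)) (i : ZMod 4) :
    c ∈ triangle c P i := by
  have e : ∀ x y : Plane, det x (c - c) = 0 ∧ det (c - c) y = 0 := fun x y => by simp [det]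
  refine ⟨⟨(e _ 0).1.ge, (e 0 _).2.ge⟩, ?_⟩
  rw [height, (e _ 0).1, (e 0 _).2]
  linarith [hP i]

theorem left_mem_triangle (hP : ∀ i, 0 < det (P i - c) (P (i + 1) - c)) (i : ZMod 4) :
    P i ∈ triangle c P i :=
  (mem_of_mem_segment hP (left_mem_segment ℝ _ _)).imp_right le_of_eq

theorem right_mem_triangle (hP : ∀ i, 0 < det (P i - c) (P (i + 1) - c)) (i : ZMod 4) :
    P (i + 1) ∈ triangle c P i :=
  (mem_of_mem_segment hP (right_mem_segment ℝ _ _)).imp_right le_of_eq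

end Star

namespace Plane

/-- The angles that a point of an open segment forms with the end points. -/
theorem det_pos_of_mem_openSegment {a b c z : Plane} (h : 0 < det (a - c) (b - c))
    (hz : z ∈ openSegment ℝ a b) : 0 < det (a - c) (z - c) ∧ 0 < det (z - c) (b - c) := by
  obtain ⟨s, t, hs, ht, hst, rfl⟩ := hz
  obtain rfl : s = 1 - t := by linarith
  have e1 : det (a - c) ((1 - t) • a + t • b - c) = t * det (a - c) (b - c) := by
    simp only [det, PiLp.sub_apply, PiLp.add_apply, PiLp.smul_apply, smul_eq_mul]; ring
  have e2 : det ((1 - t) • a + t • b - c) (b - c) = (1 - t) * det (a - c) (b - c) := by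
    simp only [det, PiLp.sub_apply, PiLp.add_apply, PiLp.smul_apply, smul_eq_mul]; ring
  rw [e1, e2]
  exact ⟨by positivity, by positivity⟩

theorem det_pos_of_between {a b d z : Plane} (hab : 0 < det a b) (hbd : 0 < det b d)
    (had : 0 < det a d) (h1 : 0 < det a z) (h2 : 0 < det z b) : 0 < det z d := by
  have e : det a b * det z d = det z b * det a d + det a z * det b d := by
    simp only [det]; ring
  refine pos_of_mul_pos_right (a := det a b) ?_ hab.le
  rw [e]; positivity

theorem det_pos_of_between' {a b d z : Plane} (hab : 0 < det a b) (hbd : 0 < det b d)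
    (had : 0 < det a d) (h1 : 0 < det b z) (h2 : 0 < det z d) : 0 < det a z := by
  have e : det b d * det a z = det z d * det a b + det b z * det a d := by
    simp only [det]; ring
  refine pos_of_mul_pos_right (a := det b d) ?_ hbd.le
  rw [e]; positivity

/-- Let the ray of `b` cross the segment from `a` to `d` before it reaches `b`, and let `d` be on
the near side of the segment from `b` to `e`. Then the part of the segment from `a` to `d` beyond
that ray is on the near side of the segment from `b` to `e`. -/
theorem near_of_segment {a b d e z : Plane} (had : 0 < det a d) (hbd : 0 < det b d)
    (hde : 0 < det d e) (hbe : 0 < det b e) (hfar : det a d < det a b + det b d)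
    (hnear : det b d + det d e < det b e) (hz : z ∈ segment ℝ a d) (hbz : 0 ≤ det b z) :
    0 ≤ det z e ∧ det b z + det z e < det b e := by
  obtain ⟨s, t, hs, ht, hst, rfl⟩ := hz
  obtain rfl : s = 1 - t := by linarith
  have e0 : det ((1 - t) • a + t • d) d = (1 - t) * det a d := by
    simp only [det, PiLp.add_apply, PiLp.smul_apply, smul_eq_mul]; ring
  have e1 : det b ((1 - t) • a + t • d) = (1 - t) * - det a b + t * det b d := by
    simp only [det, PiLp.add_apply, PiLp.smul_apply, smul_eq_mul]; ring
  have e2 : det b d * det ((1 - t) • a + t • d) e =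
      det ((1 - t) • a + t • d) d * det b e + det b ((1 - t) • a + t • d) * det d e := by
    simp only [det, PiLp.add_apply, PiLp.smul_apply, smul_eq_mul]; ring
  set z := (1 - t) • a + t • d
  have hzd : 0 ≤ det z d := by rw [e0]; positivity
  refine ⟨?_, ?_⟩
  · refine (mul_nonneg_iff_of_pos_left hbd).1 ?_
    rw [e2]; positivity
  · have key : det b d * (det b e - det b z - det z e) =
        det b z * (det b e - det b d - det d e) + (det b d - det b z - det z d) * det b e := by
      linear_combination - e2
    have hL : det b d - det b z - det z d = (1 - t) * (det a b + det b d - det a d) := by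
      rw [e0, e1]; ring
    have : 0 < det b d * (det b e - det b z - det z e) := by
      rw [key, hL]
      rcases hs.eq_or_lt with h | h
      · have : det b z = det b d := by rw [e1, ← h, (by linarith : t = 1)]; ring
        rw [this, ← h]
        simp only [zero_mul, add_zero]
        exact mul_pos hbd (by linarith)
      · exact add_pos_of_nonneg_of_pos (mul_nonneg hbz (by linarith))
          (mul_pos (mul_pos h (by linarith)) hbe)
    linarith [pos_of_mul_pos_right this hbd.le]

end Plane

namespace ASAVertex.IsStandard
open Star
variable {p : ASAVertex → Plane} (hp : IsStandard p)
include hp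

/-- The inner quadrilateral is inside the outer one. The edge from `a i` to `a (i + 1)` is
divided by the spoke of `b i`, and its two parts are in the adjacent angles of the outer
quadrilateral. -/
theorem notMem_upper_of_mem_segment {i : ZMod 4} {z : Plane}
    (hz : z ∈ segment ℝ (p (quad false (i + 1))) (p (quad false (i + 1 + 1)))) :
    z ∉ upper (p center) fun j => p (quad true j) := by
  have tr : z - p center ∈ segment ℝ (innerVec p (i + 1)) (innerVec p (i + 1 + 1)) := by
    rw [← mem_segment_translate ℝ (p center)]
    simpa [innerVec] using hz
  rcases le_total 0 (det (outerVec p (i + 1)) (z - p center)) with h | h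
  · have hn := near_of_segment (hp.det_inner (i + 1)) (hp.det_outer_inner (i + 1))
      (hp.det_inner_outer (i + 1 + 1)) (hp.det_outer (i + 1)) (hp.far' (i + 1)).2
      (hp.near (i + 1)) tr h
    exact notMem_upper hp.det_outer (i := i + 1) ⟨h, hn.1⟩ (sub_neg.2 hn.2)
  · -- the mirror image of the first case
    have tr' : mirror (z - p center) ∈
        segment ℝ (mirror (innerVec p (i + 1 + 1))) (mirror (innerVec p (i + 1))) := by
      rw [segment_symm, ← mirror_image_segment]
      exact mem_image_of_mem _ tr
    have hn := near_of_segment (b := mirror (outerVec p (i + 1)))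
      (e := mirror (outerVec p i)) (z := mirror (z - p center))
      (a := mirror (innerVec p (i + 1 + 1)))
      (d := mirror (innerVec p (i + 1)))
    simp only [det_mirror] at hn
    have hn := hn (hp.det_inner (i + 1)) (hp.det_inner_outer (i + 1)) (hp.det_outer_inner i)
      (hp.det_outer i) (by linarith [(hp.far' (i + 1)).2]) (by linarith [hp.near i]) tr'
      (by linarith [det_comm (outerVec p (i + 1)) (z - p center)])
    have hc : InCone (p center) (fun j => p (quad true j)) i z :=
      ⟨hn.1, by
        have := det_comm (outerVec p (i + 1)) (z - p center)
        change 0 ≤ det (z - p center) (outerVec p (i + 1))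
        linarith⟩
    refine notMem_upper hp.det_outer hc ?_
    have := hn.2
    change det (outerVec p i) (z - p center) + det (z - p center) (outerVec p (i + 1)) -
      det (outerVec p i) (outerVec p (i + 1)) < 0
    linarith

end ASAVertex.IsStandard

end

/-! ### Edges in triangles and in angles -/

noncomputable section

open Plane ASAVertex Star

namespace ASAVertex

theorem adj_cases : ∀ u v : ASAVertex, augmentedSquareAntiprism.Adj u v → ∃ i : ZMod 4,
    s(u, v) = s(center, quad false i) ∨ s(u, v) = s(center, quad true i) ∨
    s(u, v) = s(quad false i, quad false (i + 1)) ∨ s(u, v) = s(quad true i, quad true (i + 1)) ∨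
    s(u, v) = s(quad false (i + 1), quad true (i + 1)) ∨
    s(u, v) = s(quad true i, quad false (i + 1)) := by
  decide +kernel

end ASAVertex

theorem edgesCross_congr_left {V : Type*} {p : V → Plane} {u v u' v' : V}
    (h : s(u, v) = s(u', v')) (x y : V) : EdgesCross p u v x y ↔ EdgesCross p u' v' x y := by
  rcases Sym2.eq_iff.1 h with ⟨rfl, rfl⟩ | ⟨rfl, rfl⟩
  · rfl
  · exact edgesCross_swap_left

theorem edgesCross_congr_right {V : Type*} {p : V → Plane} {x y x' y' : V}
    (h : s(x, y) = s(x', y')) (u v : V) : EdgesCross p u v x y ↔ EdgesCross p u v x' y' := by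
  rw [edgesCross_comm, edgesCross_congr_left h, edgesCross_comm]

theorem segment_congr {V : Type*} {p : V → Plane} {u v u' v' : V}
    (h : s(u, v) = s(u', v')) : segment ℝ (p u) (p v) = segment ℝ (p u') (p v') := by
  rcases Sym2.eq_iff.1 h with ⟨rfl, rfl⟩ | ⟨rfl, rfl⟩
  · rfl
  · exact segment_symm _ _ _

theorem openSegment_congr {V : Type*} {p : V → Plane} {u v u' v' : V}
    (h : s(u, v) = s(u', v')) : openSegment ℝ (p u) (p v) = openSegment ℝ (p u') (p v') := by
  rcases Sym2.eq_iff.1 h with ⟨rfl, rfl⟩ | ⟨rfl, rfl⟩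
  · rfl
  · exact openSegment_symm _ _ _

/-- Two edges that join vertices of the same triangle do not cross. -/
theorem IsStraightLineDrawing.not_edgesCross_of_mem_triangle {V : Type*} {G : SimpleGraph V}
    {p : V → Plane} (hp : IsStraightLineDrawing G p) {u v x y r s t : V} (huv : G.Adj u v)
    (hxy : G.Adj x y) (hu : u = r ∨ u = s ∨ u = t) (hv : v = r ∨ v = s ∨ v = t)
    (hx : x = r ∨ x = s ∨ x = t) (hy : y = r ∨ y = s ∨ y = t) : ¬ EdgesCross p u v x y := by
  have h : u = x ∨ u = y ∨ v = x ∨ v = y := by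
    have := huv.ne
    have := hxy.ne
    grind
  rcases h with rfl | rfl | rfl | rfl
  · exact hp.not_edgesCross_of_common huv hxy
  · rw [edgesCross_swap_right]
    exact hp.not_edgesCross_of_common huv hxy.symm
  · rw [edgesCross_swap_left]
    exact hp.not_edgesCross_of_common huv.symm hxy
  · rw [edgesCross_swap_left, edgesCross_swap_right]
    exact hp.not_edgesCross_of_common huv.symm hxy.symm

namespace ASAVertex.IsStandard
variable {p : ASAVertex → Plane} (hp : IsStandard p)
include hp

/-! ### The faces of a standard drawing -/

theorem star_inner (i : ZMod 4) :
    0 < det (p (quad false i) - p center) (p (quad false (i + 1)) - p center) := hp.det_inner i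

theorem star_outer (i : ZMod 4) :
    0 < det (p (quad true i) - p center) (p (quad true (i + 1)) - p center) := hp.det_outer i

theorem inner_mem_triangle (i : ZMod 4) :
    p (quad false (i + 1)) ∈ triangle (p center) (fun j => p (quad true j)) i :=
  ⟨⟨(hp.det_outer_inner i).le, (hp.det_inner_outer (i + 1)).le⟩, (sub_neg.2 (hp.near i)).le⟩

theorem quadCurve_inner_subset :
    quadCurve p false ⊆ (upper (p center) fun j => p (quad true j))ᶜ := by
  intro z hz
  obtain ⟨i, hi⟩ := mem_iUnion.1 hz
  obtain ⟨i, rfl⟩ : ∃ j, i = j + 1 := ⟨i - 1, by ring⟩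
  exact hp.notMem_upper_of_mem_segment hi

theorem drawnSet_subset :
    drawnSet augmentedSquareAntiprism p ⊆ lower (p center) fun j => p (quad true j) := by
  have hP := hp.star_outer
  have key : ∀ i x y, x ∈ triangle (p center) (fun j => p (quad true j)) i →
      y ∈ triangle (p center) (fun j => p (quad true j)) i →
      segment ℝ x y ⊆ lower (p center) fun j => p (quad true j) := fun i x y hx hy =>
    ((convex_triangle i).segment_subset hx hy).trans (triangle_subset_lower i)
  have hseg : ∀ u v, augmentedSquareAntiprism.Adj u v →
      segment ℝ (p u) (p v) ⊆ lower (p center) fun j => p (quad true j) := by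
    intro u v huv
    obtain ⟨i, h⟩ := adj_cases u v huv
    rcases h with h | h | h | h | h | h <;> rw [segment_congr h]
    · obtain ⟨i, rfl⟩ : ∃ j, i = j + 1 := ⟨i - 1, by ring⟩
      exact key i _ _ (center_mem_triangle hP i) (hp.inner_mem_triangle i)
    · exact key i _ _ (center_mem_triangle hP i) (left_mem_triangle hP i)
    · intro z hz
      exact (mem_lower_or_mem_upper hP z).resolve_right
        (hp.quadCurve_inner_subset (mem_iUnion.2 ⟨i, hz⟩))
    · exact key i _ _ (left_mem_triangle hP i) (right_mem_triangle hP i)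
    · exact key i _ _ (hp.inner_mem_triangle i) (right_mem_triangle hP i)
    · exact key i _ _ (left_mem_triangle hP i) (hp.inner_mem_triangle i)
  refine union_subset ?_ (iUnion_subset fun d => hseg _ _ d.adj)
  rintro _ ⟨v, rfl⟩
  rcases v with _ | ⟨k, i⟩
  · exact hseg _ _ (adj_center true 0) (left_mem_segment ℝ _ _)
  · exact hseg _ _ (adj_center k i) (right_mem_segment ℝ _ _)

omit hp in
theorem quadCurve_subset_drawnSet (k : Bool) :
    quadCurve p k ⊆ drawnSet augmentedSquareAntiprism p := by
  intro z hz
  obtain ⟨i, hi⟩ := mem_iUnion.1 hz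
  exact .inr (mem_iUnion.2 ⟨⟨(_, _), adj_quad k i⟩, hi⟩)

/-- The external face is the exterior of the outer quadrilateral. -/
theorem outerFace_eq :
    outerFace augmentedSquareAntiprism p = (lower (p center) fun j => p (quad true j))ᶜ := by
  ext z
  constructor
  · rintro ⟨h1, h2⟩ h3
    refine h2 (isBounded_component hp.star_outer (quadCurve_subset_drawnSet true) h1 fun h4 => ?_)
    exact h1 (quadCurve_subset_drawnSet true (mem_curve_of_mem hp.star_outer h3 h4))
  · intro h
    exact ⟨fun h' => h (hp.drawnSet_subset h'),
      not_isBounded_component hp.star_outer hp.drawnSet_subset h⟩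

theorem center_mem_curveInterior (k : Bool) : p center ∈ curveInterior (quadCurve p k) := by
  cases k
  · exact (curveInterior_curve hp.star_inner).ge (center_notMem_upper hp.star_inner)
  · exact (curveInterior_curve hp.star_outer).ge (center_notMem_upper hp.star_outer)

theorem isInnerQuad_iff (k : Bool) : IsInnerQuad p k ↔ k = false := by
  cases k
  · refine iff_of_true (fun z hz => ?_) rfl
    exact (curveInterior_curve hp.star_outer).ge (hp.quadCurve_inner_subset hz)
  · refine iff_of_false (fun h => ?_) (by simp)
    have h1 : p (quad true 0) ∈ quadCurve p true :=
      mem_iUnion.2 ⟨0, left_mem_segment ℝ _ _⟩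
    refine (curveInterior_curve hp.star_inner).le (h h1) ⟨0, ⟨(hp.det_inner_outer 0).le,
      (hp.det_outer_inner 0).le⟩, ?_⟩
    exact (sub_pos.2 (hp.far' 0).2).le

/-! ### The crossings of a standard drawing -/

/-- The edges that join two of the vertices `a i`, `b i`, `a (i + 1)` lie in the angle between `a i`
and `a (i + 1)`. -/
theorem mem_openCone_inner {i : ZMod 4} {u v : ASAVertex} {z : Plane}
    (h : s(u, v) = s(quad false i, quad false (i + 1)) ∨
      s(u, v) = s(quad false i, quad true i) ∨ s(u, v) = s(quad true i, quad false (i + 1)))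
    (hz : z ∈ openSegment ℝ (p u) (p v)) :
    InOpenCone (p center) (fun j => p (quad false j)) i z := by
  have h1 := hp.det_inner_outer i
  have h2 := hp.det_outer_inner i
  have h3 := hp.det_inner i
  rcases h with h | h | h <;> rw [openSegment_congr h] at hz
  · exact det_pos_of_mem_openSegment h3 hz
  · have := det_pos_of_mem_openSegment h1 hz
    exact ⟨this.1, det_pos_of_between h1 h2 h3 this.1 this.2⟩
  · have := det_pos_of_mem_openSegment h2 hz
    exact ⟨det_pos_of_between' h1 h2 h3 this.1 this.2, this.2⟩

/-- The edges that join two of the vertices `b i`, `a (i + 1)`, `b (i + 1)` lie in the angle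
between `b i` and `b (i + 1)`. -/
theorem mem_openCone_outer {i : ZMod 4} {u v : ASAVertex} {z : Plane}
    (h : s(u, v) = s(quad true i, quad true (i + 1)) ∨
      s(u, v) = s(quad true i, quad false (i + 1)) ∨
      s(u, v) = s(quad false (i + 1), quad true (i + 1)))
    (hz : z ∈ openSegment ℝ (p u) (p v)) :
    InOpenCone (p center) (fun j => p (quad true j)) i z := by
  have h1 := hp.det_outer_inner i
  have h2 := hp.det_inner_outer (i + 1)
  have h3 := hp.det_outer i
  rcases h with h | h | h <;> rw [openSegment_congr h] at hz
  · exact det_pos_of_mem_openSegment h3 hz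
  · have := det_pos_of_mem_openSegment h1 hz
    exact ⟨this.1, det_pos_of_between h1 h2 h3 this.1 this.2⟩
  · have := det_pos_of_mem_openSegment h2 hz
    exact ⟨det_pos_of_between' h1 h2 h3 this.1 this.2, this.2⟩

/-- The open angle of an edge of the inner quadrilateral meets only two angles of edges of the
outer one. -/
theorem index_of_mem_openCone {i j : ZMod 4} {z : Plane}
    (hi : InOpenCone (p center) (fun j => p (quad false j)) i z)
    (hj : InOpenCone (p center) (fun j => p (quad true j)) j z) : i = j ∨ i = j + 1 := by
  obtain ⟨i, rfl⟩ : ∃ j, i = j + 1 := ⟨i - 1, by ring⟩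
  have h1 := hp.det_inner_outer (i + 1)
  have h2 := hp.det_outer_inner (i + 1)
  have h3 := hp.det_inner_outer (i + 1 + 1)
  have h4 := hp.det_outer_inner i
  have h5 := hp.det_outer i
  have h6 := hp.det_outer (i + 1)
  have hi1 : 0 < det (innerVec p (i + 1)) (z - p center) := hi.1
  have hi2 : 0 < det (z - p center) (innerVec p (i + 1 + 1)) := hi.2
  have e1 : det (innerVec p (i + 1)) (outerVec p (i + 1)) * det (outerVec p i) (z - p center) =
      det (z - p center) (outerVec p (i + 1)) * det (outerVec p i) (innerVec p (i + 1)) +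
        det (innerVec p (i + 1)) (z - p center) * det (outerVec p i) (outerVec p (i + 1)) := by
    simp only [det]; ring
  have e2 : det (outerVec p (i + 1)) (innerVec p (i + 1 + 1)) *
      det (z - p center) (outerVec p (i + 1 + 1)) =
      det (z - p center) (innerVec p (i + 1 + 1)) *
        det (outerVec p (i + 1)) (outerVec p (i + 1 + 1)) +
      det (outerVec p (i + 1)) (z - p center) *
        det (innerVec p (i + 1 + 1)) (outerVec p (i + 1 + 1)) := by
    simp only [det]; ring
  rcases le_total 0 (det (outerVec p (i + 1)) (z - p center)) with h | h
  · left
    refine (hj.eq_of_inCone hp.star_outer ⟨h, ?_⟩).symm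
    refine le_of_lt (pos_of_mul_pos_right (a := det (outerVec p (i + 1))
      (innerVec p (i + 1 + 1))) ?_ h2.le)
    change 0 < _ * det (z - p center) (outerVec p (i + 1 + 1))
    rw [e2]; positivity
  · right
    have h' : 0 ≤ det (z - p center) (outerVec p (i + 1)) := by
      rw [det_comm]; linarith
    rw [hj.eq_of_inCone hp.star_outer (j := i) ⟨?_, h'⟩]
    refine le_of_lt (pos_of_mul_pos_right (a := det (innerVec p (i + 1))
      (outerVec p (i + 1))) ?_ h1.le)
    change 0 < _ * det (outerVec p i) (z - p center)
    rw [e1]; positivity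

/-- Edges of different quadrilaterals do not cross: the edge from `a i` to `a (i + 1)` is crossed
by the spoke of `b i`, and so by no other edge at `b i`. -/
theorem not_edgesCross_inner_outer (i j : ZMod 4) : ¬ EdgesCross p (quad false i)
    (quad false (i + 1)) (quad true j) (quad true (j + 1)) := by
  intro h
  obtain ⟨z, hz1, hz2⟩ := h.2
  rcases hp.index_of_mem_openCone (hp.mem_openCone_inner (.inl rfl) hz1)
    (hp.mem_openCone_outer (.inl rfl) hz2) with rfl | rfl
  · exact hp.rac.not_edgesCross_fan (adj_quad _ _) (adj_center _ _).symm (adj_quad _ _) (by simp)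
      (hp.edgesCross i) h
  · refine hp.rac.not_edgesCross_fan (adj_quad _ _) (adj_center _ _).symm (adj_quad _ _).symm
      (by simp) (hp.edgesCross (j + 1)) ?_
    rw [edgesCross_swap_right]
    exact h

omit hp in
theorem mem_triple_of_eq {u v r s t : ASAVertex} (h : s(u, v) = s(r, t) ∨ s(u, v) = s(r, s) ∨
    s(u, v) = s(s, t)) : (u = r ∨ u = s ∨ u = t) ∧ (v = r ∨ v = s ∨ v = t) := by
  simp only [Sym2.eq_iff] at h
  grind

/-- Edges that do not end at the center do not cross each other. -/
theorem not_edgesCross_of_ne_center {u v x y : ASAVertex}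
    (huv : augmentedSquareAntiprism.Adj u v) (hxy : augmentedSquareAntiprism.Adj x y)
    (hu : u ≠ center) (hv : v ≠ center) (hx : x ≠ center) (hy : y ≠ center) :
    ¬ EdgesCross p u v x y := by
  -- The edges other than those of the outer quadrilateral lie in the angles of the inner one, and
  -- those other than the edges of the inner quadrilateral lie in the angles of the outer one. So
  -- two edges that cross lie in the same angle, whose triangle of vertices they share, or they
  -- belong to different quadrilaterals.
  have hA : ∀ u v : ASAVertex, augmentedSquareAntiprism.Adj u v → u ≠ center → v ≠ center →
      (∃ i, s(u, v) = s(quad false i, quad false (i + 1)) ∨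
        s(u, v) = s(quad false i, quad true i) ∨ s(u, v) = s(quad true i, quad false (i + 1))) ∨
      ∃ i, s(u, v) = s(quad true i, quad true (i + 1)) := by
    decide +kernel
  have hB : ∀ u v : ASAVertex, augmentedSquareAntiprism.Adj u v → u ≠ center → v ≠ center →
      (∃ i, s(u, v) = s(quad true i, quad true (i + 1)) ∨
        s(u, v) = s(quad true i, quad false (i + 1)) ∨
        s(u, v) = s(quad false (i + 1), quad true (i + 1))) ∨
      ∃ i, s(u, v) = s(quad false i, quad false (i + 1)) := by
    decide +kernel
  intro h
  obtain ⟨z, hz1, hz2⟩ := h.2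
  have key1 : ∀ i j, (s(u, v) = s(quad false i, quad false (i + 1)) ∨
        s(u, v) = s(quad false i, quad true i) ∨ s(u, v) = s(quad true i, quad false (i + 1))) →
      (s(x, y) = s(quad false j, quad false (j + 1)) ∨
        s(x, y) = s(quad false j, quad true j) ∨ s(x, y) = s(quad true j, quad false (j + 1))) →
      False := by
    intro i j hi hj
    obtain rfl := (hp.mem_openCone_inner hi hz1).eq_of_inCone hp.star_inner
      (hp.mem_openCone_inner hj hz2).inCone
    have t1 := mem_triple_of_eq hi
    have t2 := mem_triple_of_eq hj
    exact hp.rac.not_edgesCross_of_mem_triangle huv hxy t1.1 t1.2 t2.1 t2.2 h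
  have key2 : ∀ i j, (s(u, v) = s(quad true i, quad true (i + 1)) ∨
        s(u, v) = s(quad true i, quad false (i + 1)) ∨
        s(u, v) = s(quad false (i + 1), quad true (i + 1))) →
      (s(x, y) = s(quad true j, quad true (j + 1)) ∨
        s(x, y) = s(quad true j, quad false (j + 1)) ∨
        s(x, y) = s(quad false (j + 1), quad true (j + 1))) → False := by
    intro i j hi hj
    obtain rfl := (hp.mem_openCone_outer hi hz1).eq_of_inCone hp.star_outer
      (hp.mem_openCone_outer hj hz2).inCone
    have t1 := mem_triple_of_eq hi
    have t2 := mem_triple_of_eq hj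
    exact hp.rac.not_edgesCross_of_mem_triangle huv hxy t1.1 t1.2 t2.1 t2.2 h
  rcases hA u v huv hu hv with ⟨i, hi⟩ | ⟨i, hi⟩
  · rcases hA x y hxy hx hy with ⟨j, hj⟩ | ⟨j, hj⟩
    · exact key1 i j hi hj
    · rcases hB u v huv hu hv with ⟨i', hi'⟩ | ⟨i', hi'⟩
      · exact key2 i' j hi' (.inl hj)
      · rw [edgesCross_congr_left hi', edgesCross_congr_right hj] at h
        exact hp.not_edgesCross_inner_outer _ _ h
  · rcases hB x y hxy hx hy with ⟨j, hj⟩ | ⟨j, hj⟩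
    · exact key2 i j (.inl hi) hj
    · rw [edgesCross_congr_left hi, edgesCross_congr_right hj] at h
      exact hp.not_edgesCross_inner_outer _ _ h.symm

/-- A spoke crosses only the edge of the inner quadrilateral that it passes. -/
theorem edge_of_edgesCross_spoke {u v w : ASAVertex} (huv : augmentedSquareAntiprism.Adj u v)
    (hu : u ≠ center) (hv : v ≠ center) (hw : w ≠ center) (h : EdgesCross p u v w center) :
    ∃ i, s(u, v) = s(quad false i, quad false (i + 1)) ∧ w = quad true i := by
  have hA : ∀ w : ASAVertex, w ≠ center → ∃ i, w = quad false i ∨ w = quad true i := by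
    decide +kernel
  have hc : ∀ w : ASAVertex, w ≠ center → augmentedSquareAntiprism.Adj center w := by
    decide +kernel
  obtain ⟨i, hi⟩ := adj_cases u v huv
  -- The vertex `w` is in the open angle of the edge, and no vertex of a quadrilateral is in an
  -- open angle of that quadrilateral. For an edge of a quadrilateral this leaves only vertices of
  -- the other quadrilateral, and for an edge between the two it leaves none.
  have key : ∀ u' v', s(u, v) = s(u', v') → 0 < det (p u' - p center) (p v' - p center) →
      0 < det (p u' - p center) (p w - p center) ∧
      0 < det (p w - p center) (p v' - p center) ∧
      Far (p u' - p center) (p v' - p center) (p w - p center) := by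
    intro u' v' h1 h2
    have h3 : Far (p u' - p center) (p v' - p center) (p w - p center) := by
      rw [hp.rac.edgesCross_iff_far huv (hc u hu) (hc v hv)] at h
      rcases Sym2.eq_iff.1 h1 with ⟨rfl, rfl⟩ | ⟨rfl, rfl⟩
      · exact h
      · exact h.swap
    rcases h3.cone with h4 | h4
    · exact ⟨h4.2.1, h4.2.2, h3⟩
    · linarith [h4.1, det_comm (p u' - p center) (p v' - p center)]
  have irrefl : ∀ x : Plane, ¬ 0 < det x x := fun x hx => by
    have : det x x = 0 := by simp only [det]; ring
    linarith
  have nA : ∀ i j, w = quad false j →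
      ¬ InOpenCone (p center) (fun j => p (quad false j)) i (p w) := by
    rintro i j rfl h
    obtain rfl := h.eq_of_inCone hp.star_inner (left_mem_triangle hp.star_inner j).1
    exact irrefl _ h.1
  have nB : ∀ i j, w = quad true j →
      ¬ InOpenCone (p center) (fun j => p (quad true j)) i (p w) := by
    rintro i j rfl h
    obtain rfl := h.eq_of_inCone hp.star_outer (left_mem_triangle hp.star_outer j).1
    exact irrefl _ h.1
  obtain ⟨j, hj⟩ := hA w hw
  rcases hi with hi | hi | hi | hi | hi | hi
  · rcases Sym2.eq_iff.1 hi with ⟨h, -⟩ | ⟨-, h⟩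
    exacts [absurd h hu, absurd h hv]
  · rcases Sym2.eq_iff.1 hi with ⟨h, -⟩ | ⟨-, h⟩
    exacts [absurd h hu, absurd h hv]
  · obtain ⟨k1, k2, -⟩ := key _ _ hi (hp.det_inner i)
    rcases hj with hj | hj
    · exact absurd ⟨k1, k2⟩ (nA i j hj)
    · refine ⟨i, hi, hj.trans ?_⟩
      subst hj
      rw [InOpenCone.eq_of_inCone hp.star_inner (i := i) ⟨k1, k2⟩
        ⟨(hp.det_inner_outer j).le, (hp.det_outer_inner j).le⟩]
  · obtain ⟨k1, k2, k3⟩ := key _ _ hi (hp.det_outer i)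
    rcases hj with hj | hj
    · obtain ⟨j, rfl⟩ : ∃ l, j = l + 1 := ⟨j - 1, by ring⟩
      subst hj
      obtain rfl := InOpenCone.eq_of_inCone hp.star_outer (i := i) ⟨k1, k2⟩
        (hp.inner_mem_triangle j).1
      -- The vertex `a (j + 1)` is in the angle of the outer edge, but it is near.
      have n := hp.near i
      simp only [innerVec, outerVec] at n
      rcases k3 with k3 | k3
      · linarith [k3.2.2.2]
      · linarith [k3.1, hp.star_outer i, det_comm (p (quad true i) - p center)
          (p (quad true (i + 1)) - p center)]
    · exact absurd ⟨k1, k2⟩ (nB i j hj)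
  · obtain ⟨k1, k2, -⟩ := key _ _ hi (hp.det_inner_outer (i + 1))
    rcases hj with hj | hj
    · exact absurd ⟨k1, det_pos_of_between (hp.det_inner_outer (i + 1))
        (hp.det_outer_inner (i + 1)) (hp.det_inner (i + 1)) k1 k2⟩ (nA (i + 1) j hj)
    · exact absurd ⟨det_pos_of_between' (hp.det_outer_inner i)
        (hp.det_inner_outer (i + 1)) (hp.det_outer i) k1 k2, k2⟩ (nB i j hj)
  · obtain ⟨k1, k2, -⟩ := key _ _ hi (hp.det_outer_inner i)
    rcases hj with hj | hj
    · exact absurd ⟨det_pos_of_between' (hp.det_inner_outer i)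
        (hp.det_outer_inner i) (hp.det_inner i) k1 k2, k2⟩ (nA i j hj)
    · exact absurd ⟨k1, det_pos_of_between (hp.det_outer_inner i)
        (hp.det_inner_outer (i + 1)) (hp.det_outer i) k1 k2⟩ (nB i j hj)

/-- The crossing pairs of edges are exactly an edge of the inner quadrilateral and the spoke that
passes it. -/
theorem edgesCross_iff {u v x y : ASAVertex} (huv : augmentedSquareAntiprism.Adj u v)
    (hxy : augmentedSquareAntiprism.Adj x y) : EdgesCross p u v x y ↔ ∃ i,
      (s(u, v) = s(quad false i, quad false (i + 1)) ∧ s(x, y) = s(center, quad true i)) ∨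
      (s(x, y) = s(quad false i, quad false (i + 1)) ∧ s(u, v) = s(center, quad true i)) := by
  constructor
  · intro h
    have key : ∀ {u v x y : ASAVertex}, augmentedSquareAntiprism.Adj u v →
        augmentedSquareAntiprism.Adj x y → EdgesCross p u v x y → u = center ∨ v = center →
        ∃ i, s(x, y) = s(quad false i, quad false (i + 1)) ∧ s(u, v) = s(center, quad true i) := by
      intro u v x y huv hxy h hc
      have key' : ∀ w, s(u, v) = s(w, center) → ∃ i,
          s(x, y) = s(quad false i, quad false (i + 1)) ∧ s(u, v) = s(center, quad true i) := by
        intro w hw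
        have hw' : augmentedSquareAntiprism.Adj center w := by
          rcases Sym2.eq_iff.1 hw with ⟨rfl, rfl⟩ | ⟨rfl, rfl⟩
          exacts [huv.symm, huv]
        rw [edgesCross_congr_left hw] at h
        have hx : x ≠ center := by
          rintro rfl
          rw [edgesCross_swap_left] at h
          exact hp.rac.not_edgesCross_of_common hw' hxy h
        have hy : y ≠ center := by
          rintro rfl
          rw [edgesCross_swap_left, edgesCross_swap_right] at h
          exact hp.rac.not_edgesCross_of_common hw' hxy.symm h
        obtain ⟨i, h1, rfl⟩ := hp.edge_of_edgesCross_spoke hxy hx hy hw'.ne' h.symm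
        exact ⟨i, h1, hw.trans Sym2.eq_swap⟩
      rcases hc with rfl | rfl
      · exact key' v Sym2.eq_swap
      · exact key' u rfl
    by_cases h1 : u = center ∨ v = center
    · obtain ⟨i, hi⟩ := key huv hxy h h1
      exact ⟨i, .inr hi⟩
    by_cases h2 : x = center ∨ y = center
    · obtain ⟨i, hi⟩ := key hxy huv h.symm h2
      exact ⟨i, .inl hi⟩
    push Not at h1 h2
    exact absurd h (hp.not_edgesCross_of_ne_center huv hxy h1.1 h1.2 h2.1 h2.2)
  · rintro ⟨i, ⟨h1, h2⟩ | ⟨h1, h2⟩⟩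
    · rw [edgesCross_congr_left h1, edgesCross_congr_right h2, edgesCross_swap_right]
      exact hp.edgesCross i
    · rw [edgesCross_congr_right h1, edgesCross_congr_left h2, edgesCross_comm,
        edgesCross_swap_right]
      exact hp.edgesCross i

end ASAVertex.IsStandard

end

/-! ### The inner quadrilateral -/

noncomputable section

open Plane ASAVertex Star

namespace ASAVertex

/-- The geometric part of the classification: quadrilateral `k` is the inner one, and the spokes
of the other quadrilateral cross its edges. The crossing spokes are matched to the crossed edges
by a bijection. -/
structure HasInner (p : ASAVertex → Plane) (k : Bool) : Prop where
  not_quadEdgesCross : ∀ l m i j, ¬ QuadEdgesCross p l i m j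
  center_mem : ∀ l, p center ∈ curveInterior (quadCurve p l)
  isInnerQuad_iff : ∀ l, IsInnerQuad p l ↔ l = k
  exists_equiv : ∃ e : ZMod 4 ≃ ZMod 4, ∀ i j, SpokeCrossesPerp p (!k) i k j ↔ e i = j

theorem edge_injective : ∀ i j : ZMod 4, s(quad false i, quad false (i + 1)) =
    s(quad false j, quad false (j + 1)) → i = j := by
  decide +kernel

theorem IsStandard.hasInner {p : ASAVertex → Plane} (hp : IsStandard p) : HasInner p false where
  not_quadEdgesCross l m i j :=
    hp.not_edgesCross_of_ne_center (adj_quad _ _) (adj_quad _ _) (by simp) (by simp) (by simp)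
      (by simp)
  center_mem := hp.center_mem_curveInterior
  isInnerQuad_iff := hp.isInnerQuad_iff
  exists_equiv := by
    refine ⟨Equiv.refl _, fun i j => ?_⟩
    constructor
    · rintro ⟨h, -⟩
      rw [hp.edgesCross_iff (adj_center _ _) (adj_quad _ _)] at h
      obtain ⟨l, ⟨-, h⟩ | ⟨h1, h2⟩⟩ := h
      · simp at h
      · have h2 : i = l := by simpa using h2
        subst h2
        exact edge_injective _ _ h1.symm
    · rintro rfl
      have h := hp.edgesCross i
      rw [edgesCross_swap_right, edgesCross_comm] at h
      exact ⟨h, hp.rac.right_angle _ _ _ _ (adj_center _ _) (adj_quad _ _) h⟩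

/-- The effect of `shift` on the indices. -/
def shiftIndex (k : Bool) : ZMod 4 ≃ ZMod 4 := if k then Equiv.addRight 1 else Equiv.refl _

theorem shift_quad (k : Bool) (i : ZMod 4) : shift (quad k i) = quad (!k) (shiftIndex k i) := by
  cases k <;> rfl

theorem shiftIndex_add_one (k : Bool) (i : ZMod 4) :
    shiftIndex k (i + 1) = shiftIndex k i + 1 := by
  revert k i; decide

/-- The effect of `flip` on the indices of the edges of the quadrilaterals. -/
def flipIndex (k : Bool) : ZMod 4 ≃ ZMod 4 :=
  if k then (Equiv.neg _).trans (Equiv.subRight 2) else (Equiv.neg _).trans (Equiv.subRight 1)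

theorem flip_quad (k : Bool) (i : ZMod 4) : flip (quad k i) = quad k (flipIndex k i + 1) ∧
    flip (quad k (i + 1)) = quad k (flipIndex k i) := by
  revert k i; decide

variable {p : ASAVertex → Plane}

theorem quadCurve_comp_shift (k : Bool) : quadCurve (p ∘ shift) k = quadCurve p (!k) := by
  rw [quadCurve, quadCurve, ← (shiftIndex k).surjective.iUnion_comp (fun i =>
    segment ℝ (p (quad (!k) i)) (p (quad (!k) (i + 1))))]
  simp only [Function.comp_apply, shift_quad, shiftIndex_add_one]

theorem quadCurve_comp_flip (k : Bool) : quadCurve (p ∘ flip) k = quadCurve p k := by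
  rw [quadCurve, quadCurve, ← (flipIndex k).surjective.iUnion_comp (fun i =>
    segment ℝ (p (quad k i)) (p (quad k (i + 1))))]
  refine iUnion_congr fun i => ?_
  rw [Function.comp_apply, Function.comp_apply, (flip_quad k i).2, (flip_quad k i).1]
  exact segment_symm _ _ _

theorem edgesCross_comp_equiv {V W : Type*} (e : V ≃ W) {p : W → Plane} {u v x y : V} :
    EdgesCross (p ∘ e) u v x y ↔ EdgesCross p (e u) (e v) (e x) (e y) :=
  edgesCross_comp e.injective

theorem quadEdgesCross_comp_shift (k l : Bool) (i j : ZMod 4) :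
    QuadEdgesCross (p ∘ shift) k i l j ↔
      QuadEdgesCross p (!k) (shiftIndex k i) (!l) (shiftIndex l j) := by
  rw [QuadEdgesCross, edgesCross_comp_equiv, QuadEdgesCross]
  simp only [shift_quad, shiftIndex_add_one]

theorem quadEdgesCross_comp_flip (k l : Bool) (i j : ZMod 4) :
    QuadEdgesCross (p ∘ flip) k i l j ↔ QuadEdgesCross p k (flipIndex k i) l (flipIndex l j) := by
  rw [QuadEdgesCross, edgesCross_comp_equiv, QuadEdgesCross, (flip_quad k i).1, (flip_quad k i).2,
    (flip_quad l j).1, (flip_quad l j).2, edgesCross_swap_left, edgesCross_swap_right]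

theorem spokeCrossesPerp_comp_shift (k l : Bool) (i j : ZMod 4) :
    SpokeCrossesPerp (p ∘ shift) k i l j ↔
      SpokeCrossesPerp p (!k) (shiftIndex k i) (!l) (shiftIndex l j) := by
  rw [SpokeCrossesPerp, edgesCross_comp_equiv, SpokeCrossesPerp]
  simp only [Function.comp_apply, shift_quad, shiftIndex_add_one]
  rfl

theorem spokeCrossesPerp_comp_flip (k l : Bool) (i j : ZMod 4) :
    SpokeCrossesPerp (p ∘ flip) k i l j ↔
      SpokeCrossesPerp p k (flipIndex k i + 1) l (flipIndex l j) := by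
  rw [SpokeCrossesPerp, edgesCross_comp_equiv, SpokeCrossesPerp]
  simp only [Function.comp_apply, (flip_quad l j).1, (flip_quad l j).2, (flip_quad k i).1]
  rw [edgesCross_swap_right, ← neg_sub (p (quad l (flipIndex l j + 1))), inner_neg_right,
    neg_eq_zero]
  rfl

theorem HasInner.of_comp_shift {k : Bool} (h : HasInner (p ∘ shift) k) : HasInner p (!k) where
  not_quadEdgesCross l m i j h' := by
    refine h.not_quadEdgesCross (!l) (!m) ((shiftIndex (!l)).symm i) ((shiftIndex (!m)).symm j) ?_
    rw [quadEdgesCross_comp_shift]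
    simpa using h'
  center_mem l := by
    have := h.center_mem (!l)
    rwa [quadCurve_comp_shift, Bool.not_not] at this
  isInnerQuad_iff l := by
    have := h.isInnerQuad_iff (!l)
    rw [IsInnerQuad, quadCurve_comp_shift, quadCurve_comp_shift, Bool.not_not] at this
    rw [IsInnerQuad, this]
    exact (by decide : ∀ l k : Bool, (!l) = k ↔ l = !k) l k
  exists_equiv := by
    obtain ⟨e, he⟩ := h.exists_equiv
    refine ⟨(shiftIndex (!k)).symm.trans (e.trans (shiftIndex k)), fun i j => ?_⟩
    have := he ((shiftIndex (!k)).symm i) ((shiftIndex k).symm j)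
    rw [spokeCrossesPerp_comp_shift, Equiv.apply_symm_apply, Equiv.apply_symm_apply] at this
    rw [this]
    simp [Equiv.eq_symm_apply]

theorem HasInner.of_comp_flip {k : Bool} (h : HasInner (p ∘ flip) k) : HasInner p k where
  not_quadEdgesCross l m i j h' := by
    refine h.not_quadEdgesCross l m ((flipIndex l).symm i) ((flipIndex m).symm j) ?_
    rw [quadEdgesCross_comp_flip]
    simpa using h'
  center_mem l := by
    have := h.center_mem l
    rwa [quadCurve_comp_flip] at this
  isInnerQuad_iff l := by
    have := h.isInnerQuad_iff l
    rwa [IsInnerQuad, quadCurve_comp_flip, quadCurve_comp_flip] at this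
  exists_equiv := by
    obtain ⟨e, he⟩ := h.exists_equiv
    refine ⟨(Equiv.subRight 1).trans ((flipIndex (!k)).symm.trans (e.trans (flipIndex k))),
      fun i j => ?_⟩
    have := he ((flipIndex (!k)).symm (i - 1)) ((flipIndex k).symm j)
    rw [spokeCrossesPerp_comp_flip, Equiv.apply_symm_apply, Equiv.apply_symm_apply,
      sub_add_cancel] at this
    rw [this]
    simp [Equiv.eq_symm_apply]

/-- The reflection is undone by the reversal of the labels, which preserves the quadrilaterals. -/
theorem HasInner.of_mirror_isStandard (h : IsStandard (mirror ∘ p)) : HasInner p false := by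
  have := h.mirror_flip
  rw [← Function.comp_assoc mirror, ← Function.comp_assoc] at this
  have e : (mirror ∘ mirror) ∘ p = p := mirror_comp_mirror p
  rw [e] at this
  exact this.hasInner.of_comp_flip

end ASAVertex

end

/-! ### The rotation system -/

noncomputable section

open Plane ASAVertex Star

namespace Plane

theorem CyclicCCW.rotate {x y z : Plane} (h : CyclicCCW x y z) : CyclicCCW y z x := by
  rcases h with h | h | h
  exacts [.inr (.inr h), .inl h, .inr (.inl h)]

theorem CyclicCCW.not_swap {x y z : Plane} (h : CyclicCCW x y z) : ¬ CyclicCCW y x z := by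
  intro h'
  have h1 := det_comm x y
  have h2 := det_comm y z
  have h3 := det_comm z x
  rcases h with h | h | h <;> rcases h' with h' | h' | h' <;> linarith [h.1, h.2, h'.1, h'.2]

theorem not_cyclicCCW_self (x z : Plane) : ¬ CyclicCCW x x z := fun h => h.not_swap h

/-- Transitivity of the cyclic order. -/
theorem CyclicCCW.trans {o x y z : Plane} (h1 : CyclicCCW o x y) (h2 : CyclicCCW o y z) :
    CyclicCCW o x z ∧ CyclicCCW x y z := by
  have gp : det o x * det y z - det o y * det x z + det o z * det x y = 0 := by
    simp only [det]; ring
  simp only [CyclicCCW, det_comm y o, det_comm z o, det_comm z x] at *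
  generalize det o x = a at *
  generalize det o y = b at *
  generalize det o z = c at *
  generalize det x y = d at *
  generalize det y z = e at *
  generalize det x z = f at *
  rcases h1 with ⟨h1, h3⟩ | ⟨h1, h3⟩ | ⟨h1, h3⟩ <;> rcases h2 with ⟨h2, h4⟩ | ⟨h2, h4⟩ | ⟨h2, h4⟩
  · refine ⟨?_, .inl ⟨h3, h4⟩⟩
    rcases le_or_gt 0 c with hc | hc
    · exact .inl ⟨h1, by by_contra! hf; nlinarith [mul_pos h1 h4, mul_nonneg hc h3.le]⟩
    · exact .inr (.inr ⟨by linarith, h1⟩)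
  · exact ⟨.inr (.inr ⟨h4, h1⟩), .inl ⟨h3, h2⟩⟩
  · refine ⟨.inr (.inr ⟨h2, h1⟩), ?_⟩
    rcases le_or_gt e 0 with he | he
    · exact .inr (.inr ⟨by
        by_contra! hf
        nlinarith [mul_nonneg h1.le (neg_nonneg.2 he), mul_pos h2 h3], h3⟩)
    · exact .inl ⟨h3, he⟩
  · linarith
  · refine ⟨?_, .inl ⟨h1, h2⟩⟩
    rcases le_or_gt a 0 with ha | ha
    · refine .inr (.inl ⟨?_, h4⟩)
      by_contra! hf
      nlinarith [mul_nonneg h2.le (neg_nonneg.2 ha), mul_pos h4 h1]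
    · exact .inr (.inr ⟨h4, ha⟩)
  · linarith
  · linarith
  · refine ⟨.inr (.inr ⟨h4, h3⟩), ?_⟩
    rcases le_or_gt d 0 with hd | hd
    · refine .inr (.inl ⟨h2, ?_⟩)
      by_contra! hf
      nlinarith [mul_pos h2 h3, mul_nonneg h4.le (neg_nonneg.2 hd)]
    · exact .inl ⟨hd, h2⟩
  · linarith

/-- A list of vectors that is sorted counterclockwise realizes the cyclic order of its indices. -/
theorem cyclicCCW_iff {n : ℕ} {w : ℕ → Plane}
    (h : ∀ i, 1 ≤ i → i + 1 < n → CyclicCCW (w 0) (w i) (w (i + 1))) {i j k : ℕ}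
    (hi : i < n) (hj : j < n) (hk : k < n) :
    CyclicCCW (w i) (w j) (w k) ↔ (i < j ∧ j < k) ∨ (j < k ∧ k < i) ∨ (k < i ∧ i < j) := by
  have h0 : ∀ j i, 1 ≤ i → i < j → j < n → CyclicCCW (w 0) (w i) (w j) := by
    intro j
    induction j with
    | zero => omega
    | succ j ih =>
      intro i hi hij hj
      rcases (Nat.lt_succ_iff.1 hij).eq_or_lt with rfl | h'
      · exact h i hi hj
      · exact ((ih i hi h' (by omega)).trans (h j (by omega) hj)).1
  have key : ∀ i j k, i < j → j < k → k < n → CyclicCCW (w i) (w j) (w k) := by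
    intro i j k hij hjk hk
    rcases Nat.eq_zero_or_pos i with rfl | hi
    · exact h0 k j hij hjk hk
    · exact ((h0 j i hi hij (by omega)).trans (h0 k j (by omega) hjk hk)).2
  constructor
  · intro hc
    by_contra hn
    have h5 : i = j ∨ j = k ∨ k = i ∨ (j < i ∧ i < k) ∨ (i < k ∧ k < j) ∨ (k < j ∧ j < i) := by
      omega
    rcases h5 with rfl | rfl | rfl | h5 | h5 | h5
    · exact not_cyclicCCW_self _ _ hc
    · exact not_cyclicCCW_self _ _ hc.rotate
    · exact not_cyclicCCW_self _ _ hc.rotate.rotate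
    · exact (key _ _ _ h5.1 h5.2 hk).not_swap hc
    · exact (key _ _ _ h5.1 h5.2 hj).rotate.rotate.not_swap hc
    · exact (key _ _ _ h5.1 h5.2 hi).rotate.not_swap hc
  · rintro (h5 | h5 | h5)
    · exact key _ _ _ h5.1 h5.2 hk
    · exact (key _ _ _ h5.1 h5.2 hi).rotate.rotate
    · exact (key _ _ _ h5.1 h5.2 hj).rotate

theorem det_sub_sub (a b c : Plane) : det (a - b) (c - b) = det a c - det a b - det b c := by
  simp only [det, PiLp.sub_apply]; ring

theorem det_zero_sub_sub (b c : Plane) : det (0 - b) (c - b) = det c b := by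
  simp only [det, PiLp.sub_apply, PiLp.zero_apply]; ring

end Plane

namespace ASAVertex

/-- The neighbors of a vertex in counterclockwise order, for a standard drawing. The last neighbor
of a vertex other than the center is the default value of the list. -/
def neighbor : ASAVertex → ℕ → ASAVertex
  | none, n => ofNat n
  | some (false, i), n => [none, quad false (i - 1), quad true (i - 1), quad true i].getD n
      (quad false (i + 1))
  | some (true, i), n => [none, quad false i, quad true (i - 1), quad true (i + 1)].getD n
      (quad false (i + 1))

/-- The number of neighbors that `neighbor` lists. -/
def degree : ASAVertex → ℕ
  | none => 8
  | some _ => 5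

theorem exists_neighbor : ∀ u v, augmentedSquareAntiprism.Adj u v →
    ∃ n < degree u, neighbor u n = v := by
  decide +kernel

/-- The neighbors are listed in counterclockwise order: at a vertex of the quadrilaterals this is
given by the near and far positions, and at the center by the order of the spokes. -/
theorem IsStandard.cyclicCCW_neighbor {p : ASAVertex → Plane} (hp : IsStandard p) (u : ASAVertex)
    (n : ℕ) (h1 : 1 ≤ n) (hn : n + 1 < degree u) :
    CyclicCCW (p (neighbor u 0) - p u) (p (neighbor u n) - p u) (p (neighbor u (n + 1)) - p u) := by
  have tr : ∀ u v, p v - p u = (p v - p center) - (p u - p center) := fun u v => by simp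
  have tr0 : ∀ u, p center - p u = 0 - (p u - p center) := fun u => by simp
  rcases u with _ | ⟨_ | _, i⟩
  · have a01 : 0 < det (innerVec p 0) (innerVec p 1) := hp.det_inner 0
    have a12 : 0 < det (innerVec p 1) (innerVec p 2) := hp.det_inner 1
    have a23 : 0 < det (innerVec p 2) (innerVec p 3) := hp.det_inner 2
    have a30 : 0 < det (innerVec p 3) (innerVec p 0) := hp.det_inner 3
    have b0 : 0 < det (outerVec p 0) (innerVec p 1) := hp.det_outer_inner 0
    have b1 : 0 < det (outerVec p 1) (innerVec p 2) := hp.det_outer_inner 1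
    have b2 : 0 < det (outerVec p 2) (innerVec p 3) := hp.det_outer_inner 2
    have b3 : 0 < det (outerVec p 3) (innerVec p 0) := hp.det_outer_inner 3
    have c0 := hp.det_inner_outer 0
    have c1 := hp.det_inner_outer 1
    have c2 := hp.det_inner_outer 2
    have c3 := hp.det_inner_outer 3
    -- Consecutive spokes make left turns; transitivity gives their order relative to `a 0`.
    have t1 := CyclicCCW.trans (o := innerVec p 1) (.inl ⟨c1, b1⟩)
      (CyclicCCW.rotate (x := innerVec p 0) (.inl ⟨a01, a12⟩))
    have t2 := CyclicCCW.trans (o := innerVec p 2) (.inl ⟨c2, b2⟩)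
      (CyclicCCW.rotate (x := innerVec p 0) (.inr (.inl ⟨a23, a30⟩)))
    have hn : n = 1 ∨ n = 2 ∨ n = 3 ∨ n = 4 ∨ n = 5 ∨ n = 6 := by
      simp only [degree] at hn; omega
    rcases hn with rfl | rfl | rfl | rfl | rfl | rfl
    · exact .inl ⟨c0, b0⟩
    · exact .inl ⟨a01, c1⟩
    · exact t1.2.rotate.rotate
    · exact t2.1.rotate.rotate
    · exact t2.2.rotate.rotate
    · exact .inr (.inl ⟨c3, b3⟩)
  · obtain ⟨i, rfl⟩ : ∃ j, i = j + 1 := ⟨i - 1, by ring⟩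
    have hn : n = 1 ∨ n = 2 ∨ n = 3 := by simp only [degree] at hn; omega
    have e1 := hp.far' i
    have e2 := hp.far' (i + 1)
    have e3 := hp.det_outer_inner i
    have e4 := hp.det_inner_outer (i + 1)
    have c1 := det_comm (innerVec p (i + 1)) (outerVec p (i + 1))
    have c2 := det_comm (innerVec p (i + 1)) (innerVec p (i + 1 + 1))
    have s1 : i + 1 - 1 = i := by ring
    rcases hn with rfl | rfl | rfl
    · refine .inl ⟨?_, ?_⟩
      · simp only [neighbor, List.getD_cons_zero, List.getD_cons_succ, s1]
        rw [tr0 (some _), tr _ (quad false i), det_zero_sub_sub]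
        exact e1.1
      · simp only [neighbor, List.getD_cons_zero, List.getD_cons_succ, s1]
        rw [tr _ (quad false i), tr _ (quad true i), det_sub_sub]
        change 0 < det (innerVec p i) (outerVec p i) - det (innerVec p i) (innerVec p (i + 1)) -
          det (innerVec p (i + 1)) (outerVec p i)
        linarith [det_comm (innerVec p (i + 1)) (outerVec p i)]
    · refine .inr (.inr ⟨?_, ?_⟩)
      · simp only [neighbor, List.getD_cons_zero, List.getD_cons_succ]
        rw [det_comm, tr0 (some _), tr _ (quad true (i + 1)), det_zero_sub_sub, ← det_comm]
        exact e4
      · simp only [neighbor, List.getD_cons_zero, List.getD_cons_succ, s1]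
        rw [tr0 (some _), tr _ (quad true i), det_zero_sub_sub]
        exact e3
    · refine .inr (.inl ⟨?_, ?_⟩)
      · simp only [neighbor, List.getD_cons_zero, List.getD_cons_succ, List.getD_nil]
        rw [tr _ (quad true (i + 1)), tr _ (quad false (i + 1 + 1)), det_sub_sub]
        change 0 < det (outerVec p (i + 1)) (innerVec p (i + 1 + 1)) -
          det (outerVec p (i + 1)) (innerVec p (i + 1)) -
          det (innerVec p (i + 1)) (innerVec p (i + 1 + 1))
        linarith
      · simp only [neighbor, List.getD_cons_zero, List.getD_cons_succ, List.getD_nil]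
        rw [det_comm, tr0 (some _), tr _ (quad false (i + 1 + 1)), det_zero_sub_sub, ← det_comm]
        exact e2.1
  · obtain ⟨i, rfl⟩ : ∃ j, i = j + 1 := ⟨i - 1, by ring⟩
    have hn : n = 1 ∨ n = 2 ∨ n = 3 := by simp only [degree] at hn; omega
    have e1 := hp.near i
    have e2 := hp.near (i + 1)
    have e3 := hp.det_outer_inner (i + 1)
    have e4 := hp.det_inner_outer (i + 1)
    have e5 := hp.det_outer i
    have e6 := hp.det_outer (i + 1)
    have s1 : i + 1 - 1 = i := by ring
    rcases hn with rfl | rfl | rfl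
    · refine .inl ⟨?_, ?_⟩
      · simp only [neighbor, List.getD_cons_zero, List.getD_cons_succ]
        rw [tr0 (some _), tr _ (quad false (i + 1)), det_zero_sub_sub]
        exact e4
      · simp only [neighbor, List.getD_cons_zero, List.getD_cons_succ, s1]
        rw [tr _ (quad false (i + 1)), tr _ (quad true i), det_sub_sub]
        change 0 < det (innerVec p (i + 1)) (outerVec p i) -
          det (innerVec p (i + 1)) (outerVec p (i + 1)) - det (outerVec p (i + 1)) (outerVec p i)
        linarith [det_comm (innerVec p (i + 1)) (outerVec p i),
          det_comm (outerVec p (i + 1)) (outerVec p i)]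
    · refine .inr (.inr ⟨?_, ?_⟩)
      · simp only [neighbor, List.getD_cons_zero, List.getD_cons_succ]
        rw [det_comm, tr0 (some _), tr _ (quad true (i + 1 + 1)), det_zero_sub_sub, ← det_comm]
        exact e6
      · simp only [neighbor, List.getD_cons_zero, List.getD_cons_succ, s1]
        rw [tr0 (some _), tr _ (quad true i), det_zero_sub_sub]
        exact e5
    · refine .inr (.inl ⟨?_, ?_⟩)
      · simp only [neighbor, List.getD_cons_zero, List.getD_cons_succ, List.getD_nil]
        rw [tr _ (quad true (i + 1 + 1)), tr _ (quad false (i + 1 + 1)), det_sub_sub]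
        change 0 < det (outerVec p (i + 1 + 1)) (innerVec p (i + 1 + 1)) -
          det (outerVec p (i + 1 + 1)) (outerVec p (i + 1)) -
          det (outerVec p (i + 1)) (innerVec p (i + 1 + 1))
        linarith [det_comm (outerVec p (i + 1 + 1)) (innerVec p (i + 1 + 1)),
          det_comm (outerVec p (i + 1 + 1)) (outerVec p (i + 1))]
      · simp only [neighbor, List.getD_cons_zero, List.getD_cons_succ, List.getD_nil]
        rw [det_comm, tr0 (some _), tr _ (quad false (i + 1 + 1)), det_zero_sub_sub, ← det_comm]
        exact e3

/-- All standard drawings have the same rotation system. -/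
theorem IsStandard.rotation_imp {p q : ASAVertex → Plane} (hp : IsStandard p) (hq : IsStandard q)
    (d e f : augmentedSquareAntiprism.Dart)
    (h : (orientedEmbedding augmentedSquareAntiprism p).rotation d e f) :
    (orientedEmbedding augmentedSquareAntiprism q).rotation d e f := by
  obtain ⟨⟨u, x⟩, hx⟩ := d
  obtain ⟨⟨u', y⟩, hy⟩ := e
  obtain ⟨⟨u'', z⟩, hz⟩ := f
  obtain ⟨h1, h2, h3⟩ := h
  refine ⟨h1, h2, ?_⟩
  simp only at h1 h2 h3 hx hy hz ⊢
  subst h1 h2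
  obtain ⟨i, hi, rfl⟩ := exists_neighbor _ _ hx
  obtain ⟨j, hj, rfl⟩ := exists_neighbor _ _ hy
  obtain ⟨k, hk, rfl⟩ := exists_neighbor _ _ hz
  rw [cyclicCCW_iff (w := fun n => p (neighbor u n) - p u) (hp.cyclicCCW_neighbor u) hi hj hk] at h3
  exact (cyclicCCW_iff (w := fun n => q (neighbor u n) - q u)
    (hq.cyclicCCW_neighbor u) hi hj hk).2 h3

end ASAVertex

end

/-! ### The combinatorial embedding of a standard drawing -/

noncomputable section

open Plane ASAVertex Star

namespace ASAVertex.IsStandard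

/-- In all standard drawings the same edges cross, with the same orientation: the spoke of `b i`
has `a i` on its right and `a (i + 1)` on its left. -/
theorem crossing_imp {p q : ASAVertex → Plane} (hp : IsStandard p) (hq : IsStandard q)
    (d e : augmentedSquareAntiprism.Dart)
    (h : (orientedEmbedding augmentedSquareAntiprism p).crossing d e) :
    (orientedEmbedding augmentedSquareAntiprism q).crossing d e := by
  obtain ⟨⟨u, v⟩, huv⟩ := d
  obtain ⟨⟨x, y⟩, hxy⟩ := e
  obtain ⟨h1, h2⟩ := h
  simp only at h1 h2 huv hxy
  have h3 := (hp.edgesCross_iff huv hxy).1 h1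
  refine ⟨(hq.edgesCross_iff huv hxy).2 h3, ?_⟩
  simp only
  have sign : ∀ {r : ASAVertex → Plane}, IsStandard r → ∀ i,
      0 < det (r (quad true i) - r center) (r (quad false (i + 1)) - r (quad false i)) := by
    intro r hr i
    have e1 := hr.det_inner_outer i
    have e2 := hr.det_outer_inner i
    have e3 := det_comm (innerVec r i) (outerVec r i)
    have e4 : det (r (quad true i) - r center) (r (quad false (i + 1)) - r (quad false i)) =
        det (outerVec r i) (innerVec r (i + 1)) - det (outerVec r i) (innerVec r i) := by
      simp only [outerVec, innerVec, det, PiLp.sub_apply]; ring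
    linarith
  have neg : ∀ x y z : Plane, det x (y - z) = - det x (z - y) ∧ det (y - z) x = - det (z - y) x :=
    fun x y z => by
      simp only [det, PiLp.sub_apply]; constructor <;> ring
  obtain ⟨i, ⟨h4, h5⟩ | ⟨h4, h5⟩⟩ := h3 <;> have sp := sign hp i <;> have sq := sign hq i <;>
    rcases Sym2.eq_iff.1 h4 with ⟨rfl, rfl⟩ | ⟨rfl, rfl⟩ <;>
    rcases Sym2.eq_iff.1 h5 with ⟨rfl, rfl⟩ | ⟨rfl, rfl⟩
  · rw [det_comm] at h2; linarith
  · rw [det_comm, (neg _ _ _).2, neg_neg]; exact sq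
  · rw [det_comm, (neg _ _ _).1, neg_neg]; exact sq
  · rw [det_comm, (neg _ _ _).1, (neg _ _ _).2] at h2; linarith
  · exact sq
  · rw [(neg _ _ _).2] at h2; linarith
  · rw [(neg _ _ _).1] at h2; linarith
  · rw [(neg _ _ _).1, (neg _ _ _).2, neg_neg]; exact sq

/-- An edge is crossed by at most one other edge. -/
theorem crossed_once {p : ASAVertex → Plane} (hp : IsStandard p) {u v x y x' y' : ASAVertex}
    (huv : augmentedSquareAntiprism.Adj u v) (hxy : augmentedSquareAntiprism.Adj x y)
    (hxy' : augmentedSquareAntiprism.Adj x' y') (h : EdgesCross p u v x y)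
    (h' : EdgesCross p u v x' y') : s(x, y) = s(x', y') := by
  rw [hp.edgesCross_iff huv hxy] at h
  rw [hp.edgesCross_iff huv hxy'] at h'
  obtain ⟨i, ⟨h1, h2⟩ | ⟨h1, h2⟩⟩ := h <;> obtain ⟨j, ⟨h3, h4⟩ | ⟨h3, h4⟩⟩ := h'
  · obtain rfl := edge_injective _ _ (h1.symm.trans h3)
    exact h2.trans h4.symm
  · have := h1.symm.trans h4
    simp at this
  · have := h2.symm.trans h3
    simp at this
  · have := h2.symm.trans h4
    have hij : i = j := by simpa using this
    subst hij
    exact h1.trans h3.symm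

/-- As every edge is crossed at most once, there is no order of crossings to record. -/
theorem not_before {p : ASAVertex → Plane} (hp : IsStandard p)
    (d e f : augmentedSquareAntiprism.Dart) :
    ¬ (orientedEmbedding augmentedSquareAntiprism p).before d e f := by
  rintro ⟨h1, h2, s, t, hs, hst, ht, h3, h4⟩
  rw [← openSegment_congr (p := p) (hp.crossed_once d.adj e.adj f.adj h1 h2)] at h4
  have hz : ∀ {z : Plane}, z ∈ openSegment ℝ (p e.fst) (p e.snd) →
      det (p e.snd - p e.fst) (z - p e.fst) = 0 := by
    rintro _ ⟨a, b, ha, hb, hab, rfl⟩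
    obtain rfl : a = 1 - b := by linarith
    simp only [det, PiLp.sub_apply, PiLp.add_apply, PiLp.smul_apply, smul_eq_mul]
    ring
  have k3 := hz h3
  have k4 := hz h4
  have k5 : (t - s) * det (p e.snd - p e.fst) (p d.snd - p d.fst) = 0 := by
    rw [AffineMap.lineMap_apply, vsub_eq_sub, vadd_eq_add] at k3 k4
    simp only [det, PiLp.sub_apply, PiLp.add_apply, PiLp.smul_apply, smul_eq_mul] at k3 k4 ⊢
    linear_combination k4 - k3
  rcases mul_eq_zero.1 k5 with h | h
  · linarith
  · exact hp.rac.det_ne_zero e.adj d.adj h1.symm h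

theorem eventually_pos {a : ℝ} (ha : 0 < a) (b : ℝ) : ∀ᶠ t in 𝓝[>] (0 : ℝ), 0 < a + t * b := by
  have h : ContinuousAt (fun t : ℝ => a + t * b) 0 := by fun_prop
  have h' : ∀ᶠ t in 𝓝 (0 : ℝ), 0 < a + t * b :=
    h.eventually (lt_mem_nhds (by simpa using ha))
  exact h'.filter_mono nhdsWithin_le_nhds

variable {p : ASAVertex → Plane} (hp : IsStandard p)
include hp

theorem not_outer_of_eventually {d : augmentedSquareAntiprism.Dart}
    (h : ∀ᶠ δ in 𝓝[>] (0 : ℝ), ∀ᶠ r in 𝓝[>] (0 : ℝ),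
      p d.fst + r • ((p d.snd - p d.fst) + δ • rot90 (p d.snd - p d.fst)) ∈
        lower (p center) fun j => p (quad true j)) :
    ¬ (orientedEmbedding augmentedSquareAntiprism p).outer d := by
  intro h'
  obtain ⟨δ, h1, h2⟩ := (h.and h').exists
  obtain ⟨r, h3, h4⟩ := (h1.and h2).exists
  rw [hp.outerFace_eq] at h4
  exact h4 h3

theorem not_outer_of_notMem_upper {d : augmentedSquareAntiprism.Dart}
    (h : p d.fst ∉ upper (p center) fun j => p (quad true j)) :
    ¬ (orientedEmbedding augmentedSquareAntiprism p).outer d := by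
  refine hp.not_outer_of_eventually (Eventually.of_forall fun δ => ?_)
  have hc : ContinuousAt (fun r : ℝ => p d.fst +
      r • ((p d.snd - p d.fst) + δ • rot90 (p d.snd - p d.fst))) 0 := by fun_prop
  have h1 : ∀ᶠ r in 𝓝 (0 : ℝ), p d.fst +
      r • ((p d.snd - p d.fst) + δ • rot90 (p d.snd - p d.fst)) ∈
        (upper (p center) fun j => p (quad true j))ᶜ :=
    hc.eventually (isClosed_upper.isOpen_compl.mem_nhds (by simpa using h))
  filter_upwards [h1.filter_mono nhdsWithin_le_nhds] with r hr
  exact (mem_lower_or_mem_upper hp.star_outer _).resolve_right hr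

/-- A direction at an outer vertex that points into the outer quadrilateral: the first alternative
is for directions on the counterclockwise side of the spoke, the second one for directions on its
clockwise side. -/
theorem eventually_mem_lower {i : ZMod 4} {w : Plane}
    (h : (0 ≤ det (outerVec p (i + 1)) w ∧
        0 ≤ det (outerVec p (i + 1 + 1) - outerVec p (i + 1)) w) ∨
      (det (outerVec p (i + 1)) w ≤ 0 ∧ 0 ≤ det (outerVec p (i + 1) - outerVec p i) w)) :
    ∀ᶠ r in 𝓝[>] (0 : ℝ), p (quad true (i + 1)) + r • w ∈
      lower (p center) fun j => p (quad true j) := by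
  have e : ∀ r : ℝ, p (quad true (i + 1)) + r • w - p center = outerVec p (i + 1) + r • w :=
    fun r => by rw [outerVec]; abel
  rcases h with ⟨h1, h2⟩ | ⟨h1, h2⟩
  · filter_upwards [eventually_pos (hp.det_outer (i + 1)) (det w (outerVec p (i + 1 + 1))),
      self_mem_nhdsWithin] with r hr hr0
    have hr0 : 0 < r := hr0
    have e1 : det (outerVec p (i + 1)) (outerVec p (i + 1) + r • w) =
        r * det (outerVec p (i + 1)) w := by
      simp only [det, PiLp.add_apply, PiLp.smul_apply, smul_eq_mul]; ring
    have e2 : det (outerVec p (i + 1) + r • w) (outerVec p (i + 1 + 1)) =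
        det (outerVec p (i + 1)) (outerVec p (i + 1 + 1)) + r * det w (outerVec p (i + 1 + 1)) := by
      simp only [det, PiLp.add_apply, PiLp.smul_apply, smul_eq_mul]; ring
    have e3 : det (outerVec p (i + 1 + 1) - outerVec p (i + 1)) w =
        - det w (outerVec p (i + 1 + 1)) - det (outerVec p (i + 1)) w := by
      simp only [det, PiLp.sub_apply]; ring
    refine ⟨i + 1, ⟨?_, ?_⟩, ?_⟩
    · rw [e]
      change 0 ≤ det (outerVec p (i + 1)) _
      rw [e1]; positivity
    · rw [e]
      change 0 ≤ det _ (outerVec p (i + 1 + 1))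
      rw [e2]; exact hr.le
    · rw [height, e]
      change det (outerVec p (i + 1)) _ + det _ (outerVec p (i + 1 + 1)) -
        det (outerVec p (i + 1)) (outerVec p (i + 1 + 1)) ≤ 0
      rw [e1, e2]
      rw [e3] at h2
      nlinarith
  · filter_upwards [eventually_pos (hp.det_outer i) (det (outerVec p i) w),
      self_mem_nhdsWithin] with r hr hr0
    have hr0 : 0 < r := hr0
    have e1 : det (outerVec p (i + 1) + r • w) (outerVec p (i + 1)) =
        r * - det (outerVec p (i + 1)) w := by
      simp only [det, PiLp.add_apply, PiLp.smul_apply, smul_eq_mul]; ring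
    have e2 : det (outerVec p i) (outerVec p (i + 1) + r • w) =
        det (outerVec p i) (outerVec p (i + 1)) + r * det (outerVec p i) w := by
      simp only [det, PiLp.add_apply, PiLp.smul_apply, smul_eq_mul]; ring
    have e3 : det (outerVec p (i + 1) - outerVec p i) w =
        det (outerVec p (i + 1)) w - det (outerVec p i) w := by
      simp only [det, PiLp.sub_apply]; ring
    refine ⟨i, ⟨?_, ?_⟩, ?_⟩
    · rw [e]
      change 0 ≤ det (outerVec p i) _
      rw [e2]; exact hr.le
    · rw [e]
      change 0 ≤ det _ (outerVec p (i + 1))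
      rw [e1]; exact mul_nonneg hr0.le (neg_nonneg.2 h1)
    · rw [height, e]
      change det (outerVec p i) _ + det _ (outerVec p (i + 1)) -
        det (outerVec p i) (outerVec p (i + 1)) ≤ 0
      rw [e1, e2]
      rw [e3] at h2
      nlinarith

omit hp in
theorem det_add_smul (x v w : Plane) (δ : ℝ) : det x (v + δ • w) = det x v + δ * det x w := by
  simp only [det, PiLp.add_apply, PiLp.smul_apply, smul_eq_mul]; ring

omit hp in
theorem det_rot90_self_nonneg (v : Plane) : 0 ≤ det v (rot90 v) := by
  simp only [det, rot90]
  simp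
  nlinarith [sq_nonneg (v 0), sq_nonneg (v 1)]

omit hp in
theorem det_self (v : Plane) : det v v = 0 := by simp only [det]; ring

/-- At the vertex `b (i + 1)`, the edges other than the one to `b i` have an inner face on their
left. -/
theorem not_outer_of_fst {i : ZMod 4} {d : augmentedSquareAntiprism.Dart}
    (hd : d.fst = quad true (i + 1))
    (hd' : d.snd = center ∨ d.snd = quad true (i + 1 + 1) ∨ d.snd = quad false (i + 1) ∨
      d.snd = quad false (i + 1 + 1)) :
    ¬ (orientedEmbedding augmentedSquareAntiprism p).outer d := by
  refine hp.not_outer_of_eventually ?_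
  rw [hd]
  have tr : ∀ v, p v - p (quad true (i + 1)) = (p v - p center) - outerVec p (i + 1) :=
    fun v => by simp [outerVec]
  have n1 := hp.near i
  have n2 := hp.near (i + 1)
  have b1 := hp.det_outer i
  have b2 := hp.det_outer (i + 1)
  have a1 := hp.det_inner_outer (i + 1)
  have a2 := hp.det_outer_inner (i + 1)
  rcases hd' with h | h | h | h <;> rw [h, tr]
  · have e0 : p center - p center - outerVec p (i + 1) = - outerVec p (i + 1) := by simp
    rw [e0]
    have e1 : 0 < det (outerVec p (i + 1) - outerVec p i) (- outerVec p (i + 1)) := by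
      have : det (outerVec p (i + 1) - outerVec p i) (- outerVec p (i + 1)) =
          det (outerVec p i) (outerVec p (i + 1)) := by
        simp only [det, PiLp.sub_apply, PiLp.neg_apply]; ring
      rwa [this]
    filter_upwards [eventually_pos e1 _, self_mem_nhdsWithin] with δ h1 h0
    refine hp.eventually_mem_lower (.inr ⟨?_, (det_add_smul _ _ _ _).symm ▸ h1.le⟩)
    have h2 := det_rot90_self_nonneg (outerVec p (i + 1))
    have h3 : det (outerVec p (i + 1)) (- outerVec p (i + 1) + δ • rot90 (- outerVec p (i + 1))) =
        - (δ * det (outerVec p (i + 1)) (rot90 (outerVec p (i + 1)))) := by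
      simp [det, rot90]; ring
    rw [h3]
    exact neg_nonpos.2 (mul_nonneg (le_of_lt h0) h2)
  · change ∀ᶠ δ in 𝓝[>] (0 : ℝ), ∀ᶠ r in 𝓝[>] (0 : ℝ), p (quad true (i + 1)) +
      r • ((outerVec p (i + 1 + 1) - outerVec p (i + 1)) +
        δ • rot90 (outerVec p (i + 1 + 1) - outerVec p (i + 1))) ∈ _
    have e1 : 0 < det (outerVec p (i + 1)) (outerVec p (i + 1 + 1) - outerVec p (i + 1)) := by
      have : det (outerVec p (i + 1)) (outerVec p (i + 1 + 1) - outerVec p (i + 1)) =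
          det (outerVec p (i + 1)) (outerVec p (i + 1 + 1)) := by
        simp only [det, PiLp.sub_apply]; ring
      rwa [this]
    filter_upwards [eventually_pos e1 _, self_mem_nhdsWithin] with δ h1 h0
    refine hp.eventually_mem_lower (.inl ⟨(det_add_smul _ _ _ _).symm ▸ h1.le, ?_⟩)
    rw [det_add_smul, det_self, zero_add]
    exact mul_nonneg (le_of_lt h0) (det_rot90_self_nonneg _)
  · change ∀ᶠ δ in 𝓝[>] (0 : ℝ), ∀ᶠ r in 𝓝[>] (0 : ℝ), p (quad true (i + 1)) +
      r • ((innerVec p (i + 1) - outerVec p (i + 1)) +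
        δ • rot90 (innerVec p (i + 1) - outerVec p (i + 1))) ∈ _
    have e1 : 0 < - det (outerVec p (i + 1)) (innerVec p (i + 1) - outerVec p (i + 1)) := by
      have : - det (outerVec p (i + 1)) (innerVec p (i + 1) - outerVec p (i + 1)) =
          det (innerVec p (i + 1)) (outerVec p (i + 1)) := by
        simp only [det, PiLp.sub_apply]; ring
      rwa [this]
    have e2 : 0 < det (outerVec p (i + 1) - outerVec p i)
        (innerVec p (i + 1) - outerVec p (i + 1)) := by
      have : det (outerVec p (i + 1) - outerVec p i) (innerVec p (i + 1) - outerVec p (i + 1)) =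
          det (outerVec p i) (outerVec p (i + 1)) - det (outerVec p i) (innerVec p (i + 1)) -
            det (innerVec p (i + 1)) (outerVec p (i + 1)) := by
        simp only [det, PiLp.sub_apply]; ring
      rw [this]; linarith
    filter_upwards [eventually_pos e1 (- det (outerVec p (i + 1))
      (rot90 (innerVec p (i + 1) - outerVec p (i + 1)))), eventually_pos e2 _] with δ h1 h2
    refine hp.eventually_mem_lower (.inr ⟨?_, (det_add_smul _ _ _ _).symm ▸ h2.le⟩)
    rw [det_add_smul]
    linarith
  · change ∀ᶠ δ in 𝓝[>] (0 : ℝ), ∀ᶠ r in 𝓝[>] (0 : ℝ), p (quad true (i + 1)) +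
      r • ((innerVec p (i + 1 + 1) - outerVec p (i + 1)) +
        δ • rot90 (innerVec p (i + 1 + 1) - outerVec p (i + 1))) ∈ _
    have e1 : 0 < det (outerVec p (i + 1)) (innerVec p (i + 1 + 1) - outerVec p (i + 1)) := by
      have : det (outerVec p (i + 1)) (innerVec p (i + 1 + 1) - outerVec p (i + 1)) =
          det (outerVec p (i + 1)) (innerVec p (i + 1 + 1)) := by
        simp only [det, PiLp.sub_apply]; ring
      rwa [this]
    have e2 : 0 < det (outerVec p (i + 1 + 1) - outerVec p (i + 1))
        (innerVec p (i + 1 + 1) - outerVec p (i + 1)) := by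
      have : det (outerVec p (i + 1 + 1) - outerVec p (i + 1))
          (innerVec p (i + 1 + 1) - outerVec p (i + 1)) =
          det (outerVec p (i + 1)) (outerVec p (i + 1 + 1)) -
            det (outerVec p (i + 1)) (innerVec p (i + 1 + 1)) -
            det (innerVec p (i + 1 + 1)) (outerVec p (i + 1 + 1)) := by
        simp only [det, PiLp.sub_apply]; ring
      rw [this]; linarith
    filter_upwards [eventually_pos e1 _, eventually_pos e2 _] with δ h1 h2
    exact hp.eventually_mem_lower (.inl ⟨(det_add_smul _ _ _ _).symm ▸ h1.le,
      (det_add_smul _ _ _ _).symm ▸ h2.le⟩)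

/-- The dart from `b (i + 1)` to `b i` has the external face on its left: close to its tail the
height above this side is positive. -/
theorem outer_of_eq {i : ZMod 4} {d : augmentedSquareAntiprism.Dart}
    (hd : d.fst = quad true (i + 1)) (hd' : d.snd = quad true i) :
    (orientedEmbedding augmentedSquareAntiprism p).outer d := by
  have tr : p d.snd - p d.fst = outerVec p i - outerVec p (i + 1) := by
    rw [hd, hd']; simp [outerVec]
  have b1 := hp.det_outer i
  change ∀ᶠ δ in 𝓝[>] (0 : ℝ), ∀ᶠ r in 𝓝[>] (0 : ℝ), _
  rw [hp.outerFace_eq, tr, hd]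
  set v := outerVec p i - outerVec p (i + 1) with hv
  have e1 : 0 < det v (outerVec p (i + 1)) := by
    have : det v (outerVec p (i + 1)) = det (outerVec p i) (outerVec p (i + 1)) := by
      simp only [hv, det, PiLp.sub_apply]; ring
    rwa [this]
  have hv0 : v ≠ 0 := by
    intro h; rw [h] at e1; simp [det] at e1
  have e2 : 0 < det v (rot90 v) := by
    have := sq_add_sq_pos hv0
    simp only [det, rot90]
    simp
    nlinarith
  filter_upwards [eventually_pos e1 (det (rot90 v) (outerVec p (i + 1))),
    self_mem_nhdsWithin] with δ h1 h0
  have h0 : 0 < δ := h0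
  set w := v + δ • rot90 v with hw
  filter_upwards [eventually_pos b1 (det (outerVec p i) w), self_mem_nhdsWithin] with r h2 h3
  have h3 : 0 < r := h3
  have e : p (quad true (i + 1)) + r • w - p center = outerVec p (i + 1) + r • w := by
    rw [outerVec]; abel
  have e3 : det w (outerVec p (i + 1)) =
      det v (outerVec p (i + 1)) + δ * det (rot90 v) (outerVec p (i + 1)) := by
    simp only [hw, det, PiLp.add_apply, PiLp.smul_apply, smul_eq_mul]; ring
  have e4 : det (outerVec p i) (outerVec p (i + 1) + r • w) =
      det (outerVec p i) (outerVec p (i + 1)) + r * det (outerVec p i) w := det_add_smul _ _ _ _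
  have e5 : det (outerVec p (i + 1) + r • w) (outerVec p (i + 1)) =
      r * det w (outerVec p (i + 1)) := by
    simp only [det, PiLp.add_apply, PiLp.smul_apply, smul_eq_mul]; ring
  -- Only the rotated part of the direction contributes to the height.
  have e6 : det (outerVec p i) w + det w (outerVec p (i + 1)) = δ * det v (rot90 v) := by
    simp only [hw, hv, det, PiLp.add_apply, PiLp.smul_apply, PiLp.sub_apply, smul_eq_mul]; ring
  refine notMem_lower hp.star_outer (i := i) ⟨?_, ?_⟩ ?_
  · rw [e]
    change 0 ≤ det (outerVec p i) _
    rw [e4]; exact h2.le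
  · rw [e]
    change 0 ≤ det _ (outerVec p (i + 1))
    rw [e5, e3]; exact mul_nonneg h3.le h1.le
  · rw [height, e]
    change 0 < det (outerVec p i) _ + det _ (outerVec p (i + 1)) -
      det (outerVec p i) (outerVec p (i + 1))
    rw [e4, e5]
    have := mul_pos h3 (mul_pos h0 e2)
    rw [← e6] at this
    linarith

set_option synthInstance.maxSize 1000 in
set_option synthInstance.maxHeartbeats 200000 in
omit hp in
theorem dart_cases : ∀ u v : ASAVertex, augmentedSquareAntiprism.Adj u v → u = center ∨
    (∃ i, u = quad false (i + 1)) ∨ ∃ i, u = quad true (i + 1) ∧ (v = quad true i ∨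
      (v = center ∨ v = quad true (i + 1 + 1) ∨ v = quad false (i + 1) ∨
        v = quad false (i + 1 + 1))) := by
  decide +kernel

/-- The external face lies to the left of the clockwise darts of the outer quadrilateral only. -/
theorem outer_iff (d : augmentedSquareAntiprism.Dart) :
    (orientedEmbedding augmentedSquareAntiprism p).outer d ↔
      ∃ i, d.fst = quad true (i + 1) ∧ d.snd = quad true i := by
  refine ⟨fun h => ?_, fun ⟨i, h1, h2⟩ => hp.outer_of_eq h1 h2⟩
  rcases dart_cases _ _ d.adj with h1 | ⟨i, h1⟩ | ⟨i, h1, h2 | h2⟩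
  · refine absurd h (hp.not_outer_of_notMem_upper ?_)
    rw [h1]
    exact center_notMem_upper hp.star_outer
  · refine absurd h (hp.not_outer_of_notMem_upper ?_)
    rw [h1]
    exact hp.notMem_upper_of_mem_segment (left_mem_segment ℝ _ _)
  · exact ⟨i, h1, h2⟩
  · exact absurd h (hp.not_outer_of_fst h1 h2)

/-- All standard drawings have the same combinatorial data. -/
theorem orientedEmbedding_eq {q : ASAVertex → Plane} (hq : IsStandard q) :
    orientedEmbedding augmentedSquareAntiprism p =
      orientedEmbedding augmentedSquareAntiprism q := by
  ext d
  · exact ⟨hp.crossing_imp hq _ _, hq.crossing_imp hp _ _⟩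
  · exact iff_of_false (hp.not_before _ _ _) (hq.not_before _ _ _)
  · exact ⟨hp.rotation_imp hq _ _ _, hq.rotation_imp hp _ _ _⟩
  · rw [hp.outer_iff, hq.outer_iff]

end ASAVertex.IsStandard

end

/-! ### Relabelling -/

noncomputable section

open Plane ASAVertex Star

section Relabel
variable {V W : Type*} {G : SimpleGraph V} {H : SimpleGraph W} (g : G ≃g H) (p : W → Plane)

/-- The external face does not depend on the labels. -/
theorem outerFace_comp : outerFace G (p ∘ g) = outerFace H p := by
  have h : drawnSet G (p ∘ g) = drawnSet H p := by
    rw [drawnSet, drawnSet, EquivLike.range_comp]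
    congr 1
    ext z
    simp only [mem_iUnion]
    constructor
    · rintro ⟨d, hd⟩
      exact ⟨⟨(g d.fst, g d.snd), g.map_rel_iff.2 d.adj⟩, hd⟩
    · rintro ⟨d, hd⟩
      refine ⟨⟨(g.symm d.fst, g.symm d.snd), g.symm.map_rel_iff.2 d.adj⟩, ?_⟩
      simpa using hd
  rw [outerFace, outerFace, h]

/-- If two drawings have the same combinatorial data after the same relabelling of the vertices,
then they have the same combinatorial data. -/
theorem orientedEmbedding_eq_of_comp {q : W → Plane}
    (h : orientedEmbedding G (p ∘ g) = orientedEmbedding G (q ∘ g)) :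
    orientedEmbedding H p = orientedEmbedding H q := by
  set m : H.Dart → G.Dart := fun d =>
    ⟨(g.symm d.fst, g.symm d.snd), g.symm.map_rel_iff.2 d.adj⟩ with hm
  have cr : ∀ (r : W → Plane) d e, (orientedEmbedding G (r ∘ g)).crossing (m d) (m e) ↔
      (orientedEmbedding H r).crossing d e := fun r d e => by
    have := edgesCross_comp (p := r) g.injective (u := (m d).fst) (v := (m d).snd)
      (x := (m e).fst) (y := (m e).snd)
    simp only [orientedEmbedding, this]
    simp [hm]
  have be : ∀ (r : W → Plane) d e f, (orientedEmbedding G (r ∘ g)).before (m d) (m e) (m f) ↔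
      (orientedEmbedding H r).before d e f := fun r d e f => by
    have h1 := edgesCross_comp (p := r) g.injective (u := (m d).fst) (v := (m d).snd)
      (x := (m e).fst) (y := (m e).snd)
    have h2 := edgesCross_comp (p := r) g.injective (u := (m d).fst) (v := (m d).snd)
      (x := (m f).fst) (y := (m f).snd)
    simp only [orientedEmbedding, h1, h2]
    simp [hm]
  have ro : ∀ (r : W → Plane) d e f, (orientedEmbedding G (r ∘ g)).rotation (m d) (m e) (m f) ↔
      (orientedEmbedding H r).rotation d e f := fun r d e f => by
    simp [orientedEmbedding, hm]
  have ou : ∀ (r : W → Plane) d, (orientedEmbedding G (r ∘ g)).outer (m d) ↔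
      (orientedEmbedding H r).outer d := fun r d => by
    simp only [orientedEmbedding, outerFace_comp]
    simp [hm]
  ext d
  · rw [← cr, ← cr, h]
  · rw [← be, ← be, h]
  · rw [← ro, ← ro, h]
  · rw [← ou, ← ou, h]

end Relabel

theorem combinatorialEmbedding_mirror {V : Type*} (G : SimpleGraph V) (p : V → Plane) :
    combinatorialEmbedding G (mirror ∘ p) = combinatorialEmbedding G p := by
  rw [combinatorialEmbedding, combinatorialEmbedding, mirror_comp_mirror, Sym2.eq_swap]

/-- The combinatorial embedding determines which edges cross. -/
theorem edgesCross_of_combinatorialEmbedding_eq {V : Type*} {G : SimpleGraph V} {p q : V → Plane}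
    (hp : IsRACDrawing G p) (h : combinatorialEmbedding G p = combinatorialEmbedding G q)
    {u v x y : V} (huv : G.Adj u v) (hxy : G.Adj x y) (hc : EdgesCross p u v x y) :
    EdgesCross q u v x y := by
  have h1 : (orientedEmbedding G p).crossing ⟨(u, v), huv⟩ ⟨(x, y), hxy⟩ ∨
      (orientedEmbedding G p).crossing ⟨(x, y), hxy⟩ ⟨(u, v), huv⟩ := by
    rcases lt_or_gt_of_ne (hp.det_ne_zero huv hxy hc) with h2 | h2
    · refine .inr ⟨hc.symm, ?_⟩
      rw [det_comm]
      exact neg_pos.2 h2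
    · exact .inl ⟨hc, h2⟩
  rcases Sym2.eq_iff.1 h with ⟨h2, -⟩ | ⟨h2, -⟩ <;> rw [h2] at h1 <;> rcases h1 with h1 | h1
  · exact h1.1
  · exact h1.1.symm
  · exact edgesCross_mirror.1 h1.1
  · exact (edgesCross_mirror.1 h1.1).symm

/-! ### The classification of the embeddings -/

namespace ASAVertex

variable {p q : ASAVertex → Plane}

theorem IsStandard.combinatorialEmbedding_eq (hp : IsStandard p) (hq : IsStandard q) :
    combinatorialEmbedding augmentedSquareAntiprism p =
      combinatorialEmbedding augmentedSquareAntiprism q := by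
  rw [combinatorialEmbedding, combinatorialEmbedding, hp.orientedEmbedding_eq hq,
    orientedEmbedding_eq_of_comp flipIso (mirror ∘ p) (q := mirror ∘ q)
      (hp.mirror_flip.orientedEmbedding_eq hq.mirror_flip)]

theorem IsStandard.combinatorialEmbedding_eq_of_shift (hp : IsStandard (p ∘ shift))
    (hq : IsStandard (q ∘ shift)) :
    combinatorialEmbedding augmentedSquareAntiprism p =
      combinatorialEmbedding augmentedSquareAntiprism q := by
  rw [combinatorialEmbedding, combinatorialEmbedding,
    orientedEmbedding_eq_of_comp shiftIso p (hp.orientedEmbedding_eq hq),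
    orientedEmbedding_eq_of_comp shiftIso (mirror ∘ p) (q := mirror ∘ q)
      (orientedEmbedding_eq_of_comp flipIso ((mirror ∘ p) ∘ shift)
        (q := (mirror ∘ q) ∘ shift) (hp.mirror_flip.orientedEmbedding_eq hq.mirror_flip))]

/-- If `a i` are the vertices of the inner quadrilateral of `p`, then the edge from `a 1` to
`a 2` crosses a spoke, but not in a drawing in which the `a i` are the outer vertices. -/
theorem IsStandard.combinatorialEmbedding_ne (hp : IsStandard p) (hq : IsStandard (q ∘ shift)) :
    combinatorialEmbedding augmentedSquareAntiprism p ≠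
      combinatorialEmbedding augmentedSquareAntiprism q := by
  intro h
  have h1 := edgesCross_of_combinatorialEmbedding_eq hp.rac h (adj_quad false 1)
    (adj_center _ _).symm (hp.edgesCross 1)
  have h2 : EdgesCross (q ∘ shift) (quad true 0) (quad true (0 + 1)) (quad false 1) center :=
    (edgesCross_comp shift.injective).2 h1
  rw [hq.edgesCross_iff (adj_quad true 0) (adj_center _ _).symm] at h2
  obtain ⟨i, ⟨h3, -⟩ | ⟨h3, -⟩⟩ := h2 <;> simp at h3

/-- Every RAC drawing has an inner quadrilateral and the same combinatorial embedding as a drawing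
that is in standard position, up to an exchange of the two quadrilaterals. -/
theorem exists_hasInner (hp : IsRACDrawing augmentedSquareAntiprism p) :
    ∃ p', combinatorialEmbedding augmentedSquareAntiprism p' =
        combinatorialEmbedding augmentedSquareAntiprism p ∧
      (HasInner p false ∧ IsStandard p' ∨ HasInner p true ∧ IsStandard (p' ∘ shift)) := by
  obtain ⟨p', h | h, h' | h'⟩ := exists_isStandard hp <;> subst h
  · exact ⟨p', rfl, .inl ⟨h'.hasInner, h'⟩⟩
  · exact ⟨p', rfl, .inr ⟨h'.hasInner.of_comp_shift, h'⟩⟩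
  · exact ⟨_, combinatorialEmbedding_mirror _ _, .inl ⟨.of_mirror_isStandard h', h'⟩⟩
  · exact ⟨_, combinatorialEmbedding_mirror _ _,
      .inr ⟨HasInner.of_comp_shift (HasInner.of_mirror_isStandard h'), h'⟩⟩

theorem HasInner.eq {k l : Bool} (h : HasInner p k) (h' : HasInner p l) : k = l :=
  (h'.isInnerQuad_iff k).1 ((h.isInnerQuad_iff k).2 rfl)

/-- Two RAC drawings have the same combinatorial embedding exactly if they have the same inner
quadrilateral. -/
theorem combinatorialEmbedding_eq_iff (hp : IsRACDrawing augmentedSquareAntiprism p)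
    (hq : IsRACDrawing augmentedSquareAntiprism q) {k l : Bool} (hk : HasInner p k)
    (hl : HasInner q l) : combinatorialEmbedding augmentedSquareAntiprism p =
      combinatorialEmbedding augmentedSquareAntiprism q ↔ k = l := by
  obtain ⟨p', hp', ⟨h1, h2⟩ | ⟨h1, h2⟩⟩ := exists_hasInner hp <;>
    obtain ⟨q', hq', ⟨h3, h4⟩ | ⟨h3, h4⟩⟩ := exists_hasInner hq <;>
    obtain rfl := hk.eq h1 <;> obtain rfl := hl.eq h3 <;> rw [← hp', ← hq']
  · exact iff_of_true (h2.combinatorialEmbedding_eq h4) rfl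
  · exact iff_of_false (h2.combinatorialEmbedding_ne h4) (by simp)
  · exact iff_of_false (h4.combinatorialEmbedding_ne h2).symm (by simp)
  · exact iff_of_true (h2.combinatorialEmbedding_eq_of_shift h4) rfl

end ASAVertex

end

/-! ### A drawing -/

noncomputable section

open Plane ASAVertex Star

namespace ASAVertex

/-- Integer coordinates of a RAC drawing: a square with an outer quadrilateral whose vertices are
opposite to the sides of the square. -/
def coord : ASAVertex → ℤ × ℤ
  | none => (0, 0)
  | some (false, i) => [(1, -1), (1, 1), (-1, 1)].getD i.val (-1, -1)
  | some (true, i) => [(3, 0), (0, 3), (-3, 0)].getD i.val (0, -3)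

/-- The drawing with the coordinates `coord`. -/
def exampleDrawing (v : ASAVertex) : Plane := !₂[((coord v).1 : ℝ), ((coord v).2 : ℝ)]

/-- The signed area that `v - u` and `x - w` span. -/
def coordDet (u v w x : ASAVertex) : ℤ :=
  ((coord v).1 - (coord u).1) * ((coord x).2 - (coord w).2) -
    ((coord v).2 - (coord u).2) * ((coord x).1 - (coord w).1)

/-- The inner product of `v - u` and `x - w`. -/
def coordInner (u v w x : ASAVertex) : ℤ :=
  ((coord v).1 - (coord u).1) * ((coord x).1 - (coord w).1) +
    ((coord v).2 - (coord u).2) * ((coord x).2 - (coord w).2)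

theorem det_exampleDrawing (u v w x : ASAVertex) :
    det (exampleDrawing v - exampleDrawing u) (exampleDrawing x - exampleDrawing w) =
      coordDet u v w x := by
  simp [det, exampleDrawing, coordDet]

theorem inner_exampleDrawing (u v w x : ASAVertex) :
    inner ℝ (exampleDrawing v - exampleDrawing u) (exampleDrawing x - exampleDrawing w) =
      (coordInner u v w x : ℝ) := by
  simp [inner_eq, exampleDrawing, coordInner]

theorem coord_injective : ∀ u v : ASAVertex, coord u = coord v → u = v := by decide +kernel

/-- A vertex is not on the line of an edge, or it is seen from the end points of the edge in
directions that form an acute angle. -/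
theorem coord_vertex_edge : ∀ u v : ASAVertex, augmentedSquareAntiprism.Adj u v →
    ∀ w : ASAVertex, w ≠ u → w ≠ v → coordDet u v u w ≠ 0 ∨ 0 < coordInner u w v w := by
  decide +kernel

set_option synthInstance.maxSize 1000 in
set_option synthInstance.maxHeartbeats 200000 in
/-- Two distinct edges are perpendicular, or the line of one of them does not separate the end
points of the other one, or one of them lies behind an end point of the other one. -/
theorem coord_edge_edge : ∀ u v : ASAVertex, augmentedSquareAntiprism.Adj u v →
    ∀ x y : ASAVertex, augmentedSquareAntiprism.Adj x y →
      s(u, v) = s(x, y) ∨ coordInner u v x y = 0 ∨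
      (0 ≤ coordDet u v u x * coordDet u v u y ∧
        (coordDet u v u x ≠ 0 ∨ coordDet u v u y ≠ 0)) ∨
      (0 ≤ coordDet x y x u * coordDet x y x v ∧
        (coordDet x y x u ≠ 0 ∨ coordDet x y x v ≠ 0)) ∨
      (coordInner u v u x ≤ 0 ∧ coordInner u v u y ≤ 0) ∨
      (coordInner v u v x ≤ 0 ∧ coordInner v u v y ≤ 0) := by
  decide +kernel

end ASAVertex

namespace Plane

/-- If the line of a segment does not separate the end points of a second segment that meets it,
then the two segments are on a common line. -/
theorem det_mul_det_neg_or_of_inter {a b c d : Plane}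
    (h : (openSegment ℝ a b ∩ openSegment ℝ c d).Nonempty)
    (h' : 0 ≤ det (b - a) (c - a) * det (b - a) (d - a)) :
    det (b - a) (c - a) = 0 ∧ det (b - a) (d - a) = 0 := by
  obtain ⟨z, ⟨s', s, hs', hs, hss, rfl⟩, ⟨t', t, ht', ht, htt, h⟩⟩ := h
  rw [ext_iff'] at h
  simp only [PiLp.add_apply, PiLp.smul_apply, smul_eq_mul] at h
  obtain rfl : s' = 1 - s := by linarith
  have e : t' * det (b - a) (c - a) + t * det (b - a) (d - a) = 0 := by
    obtain rfl : t' = 1 - t := by linarith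
    simp only [det, PiLp.sub_apply]
    linear_combination (b 0 - a 0) * h.2 - (b 1 - a 1) * h.1
  generalize det (b - a) (c - a) = x at *
  generalize det (b - a) (d - a) = y at *
  have hx : t' * x = - (t * y) := by linarith
  have k1 : t' * x ^ 2 = - (t * (x * y)) := by linear_combination x * hx
  have k2 : t * y ^ 2 = - (t' * (x * y)) := by linear_combination y * hx
  have m1 := mul_nonneg ht.le h'
  have m2 := mul_nonneg ht'.le h'
  constructor
  · by_contra hn
    have := mul_pos ht' (pow_pos (abs_pos.2 hn) 2)
    rw [sq_abs] at this
    linarith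
  · by_contra hn
    have := mul_pos ht (pow_pos (abs_pos.2 hn) 2)
    rw [sq_abs] at this
    linarith

theorem inner_pos_of_inter {a b c d : Plane} (hab : a ≠ b)
    (h : (openSegment ℝ a b ∩ openSegment ℝ c d).Nonempty) :
    0 < inner ℝ (b - a) (c - a) ∨ 0 < inner ℝ (b - a) (d - a) := by
  obtain ⟨z, ⟨s', s, hs', hs, hss, rfl⟩, ⟨t', t, ht', ht, htt, h⟩⟩ := h
  have e : t' * inner ℝ (b - a) (c - a) + t * inner ℝ (b - a) (d - a) =
      s * inner ℝ (b - a) (b - a) := by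
    obtain rfl : s' = 1 - s := by linarith
    obtain rfl : t' = 1 - t := by linarith
    rw [ext_iff'] at h
    simp only [PiLp.add_apply, PiLp.smul_apply, smul_eq_mul] at h
    simp only [inner_eq, PiLp.sub_apply]
    linear_combination (b 0 - a 0) * h.1 + (b 1 - a 1) * h.2
  have hp : 0 < s * inner ℝ (b - a) (b - a) :=
    mul_pos hs (real_inner_self_pos.2 (sub_ne_zero.2 hab.symm))
  by_contra! hn
  nlinarith [mul_nonneg ht'.le (neg_nonneg.2 hn.1), mul_nonneg ht.le (neg_nonneg.2 hn.2)]

end Plane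

namespace ASAVertex

theorem isRACDrawing_exampleDrawing : IsRACDrawing augmentedSquareAntiprism exampleDrawing := by
  have hinj : Function.Injective exampleDrawing := by
    intro u v h
    apply coord_injective
    rw [ext_iff'] at h
    simpa [exampleDrawing, Prod.ext_iff] using h
  refine ⟨⟨hinj, ?_⟩, ?_⟩
  · intro u v w huv hu hv hw
    obtain ⟨s, t, hs, ht, hst, h⟩ := hw
    obtain rfl : s = 1 - t := by linarith
    rw [ext_iff'] at h
    simp only [PiLp.add_apply, PiLp.smul_apply, smul_eq_mul] at h
    rcases coord_vertex_edge u v huv w hu hv with h1 | h1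
    · refine h1 ?_
      have : ((coordDet u v u w : ℤ) : ℝ) = 0 := by
        rw [← det_exampleDrawing]
        simp only [det, PiLp.sub_apply, ← h.1, ← h.2]
        ring
      exact_mod_cast this
    · have h2 : (0 : ℝ) < coordInner u w v w := by exact_mod_cast h1
      rw [← inner_exampleDrawing, inner_eq] at h2
      simp only [PiLp.sub_apply, ← h.1, ← h.2] at h2
      have h3 : 0 ≤ t * (1 - t) * ((exampleDrawing v 0 - exampleDrawing u 0) ^ 2 +
          (exampleDrawing v 1 - exampleDrawing u 1) ^ 2) := by positivity
      nlinarith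
  · intro u v x y huv hxy hc
    have h2 := hc.symm.2
    -- The edge from `c` to `d` does not meet that from `a` to `b` if it is on one side of its
    -- line.
    have key : ∀ a b c d : ASAVertex, 0 ≤ coordDet a b a c * coordDet a b a d ∧
        (coordDet a b a c ≠ 0 ∨ coordDet a b a d ≠ 0) →
        ¬ (openSegment ℝ (exampleDrawing a) (exampleDrawing b) ∩
          openSegment ℝ (exampleDrawing c) (exampleDrawing d)).Nonempty := by
      rintro a b c d ⟨h3, h4⟩ h5
      have := det_mul_det_neg_or_of_inter h5 (by
        rw [det_exampleDrawing, det_exampleDrawing]; exact_mod_cast h3)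
      rw [det_exampleDrawing, det_exampleDrawing] at this
      rcases h4 with h4 | h4
      · exact h4 (by exact_mod_cast this.1)
      · exact h4 (by exact_mod_cast this.2)
    -- The edge from `c` to `d` does not meet that from `a` to `b` if it lies behind `a`.
    have key' : ∀ a b c d : ASAVertex, a ≠ b → coordInner a b a c ≤ 0 ∧ coordInner a b a d ≤ 0 →
        ¬ (openSegment ℝ (exampleDrawing a) (exampleDrawing b) ∩
          openSegment ℝ (exampleDrawing c) (exampleDrawing d)).Nonempty := by
      rintro a b c d hab ⟨h3, h4⟩ h5
      have := inner_pos_of_inter (hinj.ne hab) h5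
      rw [inner_exampleDrawing, inner_exampleDrawing] at this
      rcases this with h | h
      · exact absurd h (not_lt.2 (by exact_mod_cast h3))
      · exact absurd h (not_lt.2 (by exact_mod_cast h4))
    rcases coord_edge_edge u v huv x y hxy with h | h | h | h | h | h
    · exact absurd h hc.1
    · rw [inner_exampleDrawing, h, Int.cast_zero]
    · exact absurd hc.2 (key _ _ _ _ h)
    · exact absurd h2 (key _ _ _ _ h)
    · exact absurd hc.2 (key' _ _ _ _ huv.ne h)
    · rw [edgesCross_swap_left] at hc
      exact absurd hc.2 (key' _ _ _ _ huv.ne' h)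

/-- Both quadrilaterals are the inner one in some drawing. -/
theorem exists_isRACDrawing (k : Bool) :
    ∃ p, IsRACDrawing augmentedSquareAntiprism p ∧ HasInner p k := by
  have h0 := isRACDrawing_exampleDrawing
  have h1 := h0.comp shiftIso.toEmbedding
  have hk : ∀ {p : ASAVertex → Plane}, IsRACDrawing augmentedSquareAntiprism p →
      ∃ l, HasInner p l := fun hp => by
    obtain ⟨_, _, h | h⟩ := exists_hasInner hp
    exacts [⟨_, h.1⟩, ⟨_, h.1⟩]
  obtain ⟨l, hl⟩ := hk h0
  obtain ⟨m, hm⟩ := hk h1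
  obtain rfl : l = !m := hl.eq (HasInner.of_comp_shift hm)
  by_cases h : k = m
  · exact ⟨_, h1, h ▸ hm⟩
  · obtain rfl : k = !m := by revert h; cases k <;> cases m <;> simp
    exact ⟨_, h0, hl⟩

end ASAVertex

end

/-! ### The two embeddings -/

/-- The straight-line RAC drawings of the augmented square antiprism graph have exactly two
combinatorial embeddings, distinguished by which of the two quadrilaterals is the inner one. -/
theorem mainTheorem1 :
    -- the structure of every drawing
    (∀ p : ASAVertex → Plane, IsRACDrawing augmentedSquareAntiprism p →
      (∀ (k : Bool) (i j : ZMod 4), ¬ QuadEdgesCross p k i k j) ∧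
      (∀ i j : ZMod 4, ¬ QuadEdgesCross p false i true j) ∧
      (∀ k : Bool, p .center ∈ curveInterior (quadCurve p k)) ∧
      ∃ k : Bool, IsInnerQuad p k ∧
        (∀ i : ZMod 4, ∃! j : ZMod 4, SpokeCrossesPerp p (!k) i k j) ∧
        (∀ j : ZMod 4, ∃! i : ZMod 4, SpokeCrossesPerp p (!k) i k j)) ∧
    -- the number of embeddings
    {E | ∃ p : ASAVertex → Plane, IsRACDrawing augmentedSquareAntiprism p ∧
      combinatorialEmbedding augmentedSquareAntiprism p = E}.ncard = 2 ∧
    -- the embedding is determined by the inner quadrilateral, and determines it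
    (∀ p q : ASAVertex → Plane, IsRACDrawing augmentedSquareAntiprism p →
      IsRACDrawing augmentedSquareAntiprism q →
      (combinatorialEmbedding augmentedSquareAntiprism p =
          combinatorialEmbedding augmentedSquareAntiprism q ↔
        ∃ k : Bool, IsInnerQuad p k ∧ IsInnerQuad q k)) := by
  have hex : ∀ {p : ASAVertex → Plane}, IsRACDrawing augmentedSquareAntiprism p →
      ∃ k, ASAVertex.HasInner p k := fun hp => by
    obtain ⟨_, _, h | h⟩ := ASAVertex.exists_hasInner hp
    exacts [⟨_, h.1⟩, ⟨_, h.1⟩]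
  refine ⟨fun p hp => ?_, ?_, fun p q hp hq => ?_⟩
  · obtain ⟨k, hk⟩ := hex hp
    obtain ⟨e, he⟩ := hk.exists_equiv
    refine ⟨fun l => hk.not_quadEdgesCross l l, hk.not_quadEdgesCross false true, hk.center_mem,
      k, (hk.isInnerQuad_iff k).2 rfl, fun i => ?_, fun j => ?_⟩
    · simp only [he]
      exact ⟨e i, rfl, fun _ h => h.symm⟩
    · simp only [he]
      exact e.bijective.existsUnique j
  · obtain ⟨p, hp, hk⟩ := ASAVertex.exists_isRACDrawing false
    obtain ⟨q, hq, hl⟩ := ASAVertex.exists_isRACDrawing true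
    rw [Set.ncard_eq_two]
    refine ⟨_, _, fun h => Bool.false_ne_true
      ((ASAVertex.combinatorialEmbedding_eq_iff hp hq hk hl).1 h), Set.Subset.antisymm ?_ ?_⟩
    · rintro _ ⟨r, hr, rfl⟩
      obtain ⟨m, hm⟩ := hex hr
      cases m
      · exact .inl ((ASAVertex.combinatorialEmbedding_eq_iff hr hp hm hk).2 rfl)
      · exact .inr ((ASAVertex.combinatorialEmbedding_eq_iff hr hq hm hl).2 rfl)
    · rintro _ (rfl | rfl)
      exacts [⟨p, hp, rfl⟩, ⟨q, hq, rfl⟩]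
  · obtain ⟨k, hk⟩ := hex hp
    obtain ⟨l, hl⟩ := hex hq
    rw [ASAVertex.combinatorialEmbedding_eq_iff hp hq hk hl]
    constructor
    · rintro rfl
      exact ⟨k, (hk.isInnerQuad_iff k).2 rfl, (hl.isInnerQuad_iff k).2 rfl⟩
    · rintro ⟨m, h1, h2⟩
      exact ((hk.isInnerQuad_iff m).1 h1).symm.trans ((hl.isInnerQuad_iff m).1 h2)
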